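/- **Setting.** Let $m\ge 2$, $d\ge 1$, and let $\mathcal G$ be a connected graph on the agents $1,\dots,m$. For each agent $i$ let $X^{(i)}\subseteq D^{(i)}\subseteq\mathbb R^d$ be convex, $X^{(i)}$ closed; let $\tilde f_i$ be convex on $D^{(i)}$ with an $\tilde L$-Lipschitz gradient there ($\tilde L>0$); let $\nu_i$ be lower semicontinuous and strongly convex with modulus $1$ on $X^{(i)}$; let $\mu\ge 0$. All norms are Euclidean. For $x=(x^{(1)},\dots,x^{(m)})\in\mathcal X:=X^{(1)}\times\dots\times X^{(m)}$ put $f(x)=\sum_i\big(\tilde f_i(x^{(i)})+\mu\nu_i(x^{(i)})\big)$. Let $\mathcal A=K\otimes I_d$, where $K$ is the graph Laplacian or the transpose of an oriented incidence matrix of $\mathcal G$; $\|\mathcal A\|$ is its operator norm. Consider $\min_{x\in\mathcal X}f(x)$ subject to $\mathcal Ax=0$, and let $(x^*,z^*)$ be a saddle point of $\min_{x\in\mathcal X}\max_z f(x)+\langle\mathcal Ax,z\rangle$. For $x^{(i)}\in D^{(i)}$ an oracle returns $G_i(x^{(i)},\xi^{(i)})$ with $\mathbb E\,G_i(x^{(i)},\xi^{(i)})=\nabla\tilde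 f_i(x^{(i)})$ and, for the stacked estimator, $\sum_i\mathbb E\|G_i(x^{(i)},\xi^{(i)})-\nabla\tilde f_i(x^{(i)})\|^2\le\sigma^2$. The joint samples $\xi_k^j=(\xi_k^{(i),j})_i$, over all $(k,j)$, are independent, and $\xi_k^{(i),j}$ has the law of $\xi^{(i)}$. **Algorithm (SPDS).** Given $x_0\in\mathcal X$, $\underline x_0\in\mathcal X$, set $\hat x_0=x_{-1}=x_0$, $z_0=0$. For $k=1,\dots,N$: put $\tilde x_k=x_{k-1}+\lambda_k(\hat x_{k-1}-x_{k-2})$, $\underline x_k=(\tilde x_k+\tau_k\underline x_{k-1})/(1+\tau_k)$, $v_k^{(i)}=\frac1{c_k}\sum_{j=1}^{c_k}G_i(\underline x_k^{(i)},\xi_k^{(i),j})$; set $x_k^0=x_{k-1}$, $z_k^0=z_{k-1}$, $x_k^{-1}=x_{k-1}^{T_{k-1}-1}$ ($x_1^{-1}=x_0$); for $t=1,\dots,T_k$ put $$\tilde u_k^t=x_k^{t-1}+\alpha_k^t(x_k^{t-1}-x_k^{t-2}),\qquad z_k^t=\operatorname*{argmin}_z\ \langle-\mathcal A\tilde u_k^t,z\rangle+\tfrac{q_k^t}{2}\|z-z_k^{t-1}\|^2,$$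 $$x_k^t=\operatorname*{argmin}_{x\in\mathcal X}\ \mu\sum_i\nu_i(x^{(i)})+\langle v_k+\mathcal A^\top z_k^t,x\rangle+\tfrac{\eta_k^t}2\|x_k^{t-1}-x\|^2+\tfrac{p_k}2\|x_{k-1}-x\|^2$$ (blockwise, by the agents); then $x_k=x_k^{T_k}$, $z_k=z_k^{T_k}$, $\hat x_k=\frac1{T_k}\sum_{t=1}^{T_k}x_k^t$. Output $\overline x_N=(\sum_{k=1}^N\beta_k)^{-1}\sum_{k=1}^N\beta_k\hat x_k$. If $\mu>0$, the query points $\underline x_k^{(i)}$, $1\le k\le N$, are assumed to lie in the oracle's domain $D^{(i)}$ (for instance $D^{(i)}=\mathbb R^d$). Each agent draws $\sum_{k=1}^N c_k$ samples, and there are $2\sum_{k=1}^N T_k$ rounds of communication. **Parameters.** Let $R,c>0$. If $\mu>0$ put $\tau=2\sqrt{\tilde L/\mu}$, $\lambda=\tau/(1+\tau)$, $\Delta=\lceil2\tau+1\rceil$; if $\mu=0$ put $\Delta=+\infty$. For $k\le\Delta$: $$\tau_k=\tfrac{k-1}2,\ \lambda_k=\tfrac{k-1}k,\ \beta_k=k,\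 p_k=\tfrac{4\tilde L}k,\ T_k=\Big\lceil\tfrac{kR\|\mathcal A\|}{\tilde L}\Big\rceil,\ c_k=\Big\lceil\tfrac{\min\{N,\Delta\}\beta_kc}{p_k\tilde L}\Big\rceil;$$ for $k\ge\Delta+1$: $$\tau_k=\tau,\ \lambda_k=\lambda,\ \beta_k=\Delta\lambda^{-(k-\Delta)},\ p_k=\tfrac{2\tilde L}{1+\tau},\ T_k=\Big\lceil\tfrac{2(1+\tau)R\|\mathcal A\|}{\tilde L\lambda^{(k-\Delta)/2}}\Big\rceil,\ c_k=\Big\lceil\tfrac{(1+\tau)^2\Delta c}{\tilde L^2\lambda^{(k+N-2\Delta)/2}}\Big\rceil;$$ for all $k,t$: $\eta_k^t=(p_k+\mu)(t-1)+p_kT_k$, $q_k^t=\frac{\tilde LT_k}{4\beta_kR^2}$, $\alpha_k^t=\frac{\beta_{k-1}T_k}{\beta_kT_{k-1}}$ if $k\ge2$ and $t=1$, and $\alpha_k^t=1$ otherwise. **Theorem.** For every $N\ge1$ the following expectations are finite and, with $\rho_N:=\min\{2/N^2,\lambda^{N-\Delta}\}$ ($:=2/N^2$ if $\mu=0$), $$\mathbb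 E[f(\overline x_N)-f(x^*)]\le\rho_N\Big[4\tilde L\|x_0-x^*\|^2+\tfrac{\tilde L\sigma^2}c\Big],$$ $$\mathbb E\|\mathcal A\overline x_N\|\le\rho_N\Big[\tfrac{\tilde L}{8R^2}(\|z^*\|+1)^2+4\tilde L\|x_0-x^*\|^2+\tfrac{\tilde L\sigma^2}c\Big].$$ Now let $\sigma>0$, $x_0\ne x^*$, $R=\frac{\|z^*\|+1}{2\|x_0-x^*\|}$, $c=\frac{2\sigma^2}{\|x_0-x^*\|^2}$, and let $\varepsilon>0$. Call $\overline x_N$ a stochastic $\varepsilon$-solution if $\mathbb E[f(\overline x_N)-f(x^*)]\le\varepsilon$ and $\mathbb E\|\mathcal A\overline x_N\|\le\varepsilon$. a) If $\mu=0$ and $N=\big\lceil\sqrt{10\tilde L\|x_0-x^*\|^2/\varepsilon}\big\rceil$, then $\overline x_N$ is a stochastic $\varepsilon$-solution. If moreover $\varepsilon\le10\tilde L\|x_0-x^*\|^2$, it takes at most $N+800\,\sigma^2\|x_0-x^*\|^2/\varepsilon^2$ samples per agent and at most $2N+30\,\|x_0-x^*\|(\|z^*\|+1)\|\mathcal A\|/\varepsilon$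 rounds of communication. b) There is a function $C=C(\tilde L,\mu,\|x_0-x^*\|,\|z^*\|)$ of these four numbers only (so independent of $\sigma$, $N$, $\|\mathcal A\|$, $\varepsilon$, $m$, $d$ and the rest of the problem) such that, if $\mu>0$ and $N=\big\lceil\Delta+\log_{\lambda^{-1}}(5\tilde L\|x_0-x^*\|^2/\varepsilon)\big\rceil$ (read as $0$ if the number inside is negative), then $\overline x_N$ is a stochastic $\varepsilon$-solution provided $N\ge1$, the number of samples per agent is at most $N+C\sigma^2(1+1/\varepsilon)$, and the number of rounds is at most $2N+C\|\mathcal A\|(1+1/\sqrt\varepsilon)$. If moreover $\varepsilon\le\tilde L\|x_0-x^*\|^2$, then $$N\le3+4\sqrt{\tilde L/\mu}+\big(1+2\sqrt{\tilde L/\mu}\big)\log\tfrac{5\tilde L\|x_0-x^*\|^2}{\varepsilon},$$ the number of samples per agent is at most $C\big(1+\sqrt{\tilde L/\mu}\,\log\frac{\tilde L\|x_0-x^*\|^2}\varepsilon+\sigma^2(1+\frac1\varepsilon)\big)$, and the number of rounds is at most $C\big(1+\sqrt{\tilde L/\mu}\,\log\frac{\tilde L\|x_0-x^*\|^2}\varepsilon+\|\mathcal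 A\|(1+\frac1{\sqrt\varepsilon})\big)$. -/

import Mathlib

open MeasureTheory ProbabilityTheory
open scoped InnerProductSpace

noncomputable section

namespace SPDS

/-- The space `ℝ^d` of one agent, with the Euclidean norm. -/
abbrev Vec (d : ℕ) := EuclideanSpace ℝ (Fin d)

/-- Stacked vectors `(x^(i))_{i ∈ ι}` with blocks in `ℝ^d`, with the Euclidean norm. -/
abbrev Stack (ι : Type*) (d : ℕ) := PiLp 2 (fun _ : ι => Vec d)

/-! ### The decentralized problem -/

/-- The data of `min ∑ i, (f̃_i + μ ν_i) (x^(i))` over `x ∈ X^(1) × ⋯ × X^(m)`, on a connected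
network of `m` agents. The smooth parts `f̃_i` live on convex sets `D i ⊇ X i` (for example
`D i = X i`, or `D i = ℝ^d`), on which they are convex with an `L`-Lipschitz gradient. -/
structure Problem (m d : ℕ) where
  graph : SimpleGraph (Fin m)
  connected : graph.Connected
  X : Fin m → Set (Vec d)
  isClosed_X : ∀ i, IsClosed (X i)
  convex_X : ∀ i, Convex ℝ (X i)
  D : Fin m → Set (Vec d)
  convex_D : ∀ i, Convex ℝ (D i)
  X_subset_D : ∀ i, X i ⊆ D i
  μ : ℝ
  μ_nonneg : 0 ≤ μ
  L : ℝ
  L_pos : 0 < L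
  ft : Fin m → Vec d → ℝ
  gradft : Fin m → Vec d → Vec d
  convexOn_ft : ∀ i, ConvexOn ℝ (D i) (ft i)
  hasGradient_ft : ∀ i, ∀ x ∈ D i, HasGradientWithinAt (ft i) (gradft i x) (D i) x
  lipschitz_gradft : ∀ i, ∀ x ∈ D i, ∀ y ∈ D i, ‖gradft i x - gradft i y‖ ≤ L * ‖x - y‖
  ν : Fin m → Vec d → ℝ
  strongConvexOn_ν : ∀ i, StrongConvexOn (X i) 1 (ν i)
  lsc_ν : ∀ i, LowerSemicontinuousOn (ν i) (X i)

/-- The overall objective `f(x) = ∑ i, (f̃_i(x^(i)) + μ ν_i(x^(i)))`. -/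
def Problem.f {m d : ℕ} (P : Problem m d) (x : Stack (Fin m) d) : ℝ :=
  ∑ i, (P.ft i (x i) + P.μ * P.ν i (x i))

/-- The feasible set `X^(1) × ⋯ × X^(m)`. -/
def Problem.feasible {m d : ℕ} (P : Problem m d) : Set (Stack (Fin m) d) :=
  {x | ∀ i, x i ∈ P.X i}

/-! ### The consensus constraint -/

open Classical in
/-- The two matrices used for the consensus constraint, up to a labelling of the rows: the graph
Laplacian, or the transpose of an oriented incidence matrix (one row per edge, with `1` at the
head and `-1` at the tail). -/
inductive IsNetworkMatrix {m : ℕ} (G : SimpleGraph (Fin m)) {ι : Type*}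
    (K : Matrix ι (Fin m) ℝ) : Prop
  | laplacian (e : ι ≃ Fin m) (h : ∀ a j, K a j = G.lapMatrix ℝ (e a) j) : IsNetworkMatrix G K
  | incidence (e : ι ≃ G.edgeSet) (tail head : ι → Fin m)
      (he : ∀ a, (e a : Sym2 (Fin m)) = s(tail a, head a))
      (h : ∀ a j, K a j = if j = head a then 1 else if j = tail a then -1 else 0) :
      IsNetworkMatrix G K

/-- The operator `𝒜 = K ⊗ I_d`, that is `(𝒜 x)^(a) = ∑ j, K a j • x^(j)`. Its norm is the
operator norm for the Euclidean norms. -/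
def netOp {ι κ : Type*} [Fintype ι] [Fintype κ] {d : ℕ} (K : Matrix ι κ ℝ) :
    Stack κ d →L[ℝ] Stack ι d :=
  (PiLp.continuousLinearEquiv 2 ℝ (fun _ : ι => Vec d)).symm.toContinuousLinearMap ∘L
    ContinuousLinearMap.pi (fun a => ∑ j, K a j • PiLp.proj 2 (fun _ : κ => Vec d) j)

theorem netOp_apply {ι κ : Type*} [Fintype ι] [Fintype κ] {d : ℕ} (K : Matrix ι κ ℝ)
    (x : Stack κ d) (a : ι) : netOp K x a = ∑ j, K a j • x j := by
  simp [netOp]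

/-- `(x*, z*)` is a saddle point of `min_{x ∈ 𝒳} max_z f(x) + ⟪𝒜 x, z⟫`. -/
structure IsSaddlePoint {m d : ℕ} {ι : Type*} [Fintype ι] (P : Problem m d)
    (K : Matrix ι (Fin m) ℝ) (xs : Stack (Fin m) d) (zs : Stack ι d) : Prop where
  mem : xs ∈ P.feasible
  max : ∀ z, P.f xs + ⟪netOp K xs, z⟫_ℝ ≤ P.f xs + ⟪netOp K xs, zs⟫_ℝ
  min : ∀ x ∈ P.feasible, P.f xs + ⟪netOp K xs, zs⟫_ℝ ≤ P.f x + ⟪netOp K x, zs⟫_ℝ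

/-! ### The stochastic oracle -/

/-- The stochastic first-order oracle: agent `i` draws a sample of law `law i` and receives
`G i x s`, an unbiased estimator of the gradient of `f̃_i` at `x`. The variance of the stacked
estimator `(G i (x^(i)) (s^(i)))_i` is at most `σ²`. -/
structure Oracle {m d : ℕ} (P : Problem m d) (S : Fin m → Type*)
    [∀ i, MeasurableSpace (S i)] where
  law : ∀ i, Measure (S i)
  isProb : ∀ i, IsProbabilityMeasure (law i)
  G : ∀ i, Vec d → S i → Vec d
  measurable_G : ∀ i, Measurable (fun q : Vec d × S i => G i q.1 q.2)
  σ : ℝ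
  σ_nonneg : 0 ≤ σ
  integrable_G : ∀ i, ∀ x ∈ P.D i, Integrable (G i x) (law i)
  unbiased : ∀ i, ∀ x ∈ P.D i, ∫ s, G i x s ∂(law i) = P.gradft i x
  integrable_sq : ∀ i, ∀ x ∈ P.D i,
    Integrable (fun s => ‖G i x s - P.gradft i x‖ ^ 2) (law i)
  variance_le : ∀ x : Stack (Fin m) d, (∀ i, x i ∈ P.D i) →
    ∑ i, ∫ s, ‖G i (x i) s - P.gradft i (x i)‖ ^ 2 ∂(law i) ≤ σ ^ 2

/-- The samples: `ξ k j ω i` is the `j`-th sample of agent `i` in outer iteration `k`. It has law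
`law i`, and the joint samples `ξ k j` for different `(k, j)` are independent. (Nothing is assumed
on the dependence between the agents within one joint sample.) -/
structure IsSampling {m d : ℕ} {P : Problem m d} {S : Fin m → Type*}
    [∀ i, MeasurableSpace (S i)] (O : Oracle P S) {Ω : Type*} [MeasurableSpace Ω]
    (Pr : Measure Ω) (ξ : ℕ → ℕ → Ω → (∀ i, S i)) : Prop where
  measurable : ∀ k j, Measurable (ξ k j)
  law_eq : ∀ k j i, Measure.map (fun ω => ξ k j ω i) Pr = O.law i
  indep : iIndepFun (fun kj : ℕ × ℕ => ξ kj.1 kj.2) Pr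

/-! ### The algorithm -/

/-- The parameters of the algorithm; `eta k t`, `q k t`, `alpha k t` stand for
`η_k^t`, `q_k^t`, `α_k^t`. -/
structure Params where
  tau : ℕ → ℝ
  lam : ℕ → ℝ
  beta : ℕ → ℝ
  p : ℕ → ℝ
  T : ℕ → ℕ
  c : ℕ → ℕ
  eta : ℕ → ℕ → ℝ
  q : ℕ → ℕ → ℝ
  alpha : ℕ → ℕ → ℝ

section Algorithm

variable {m d : ℕ} {ι : Type*} {Ω : Type*}

/-- `x̂_k`, the average of `x_k^1, …, x_k^{T_k}`; by convention `x̂_0 = x_0`. -/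
def xHat (par : Params) (x : ℕ → ℕ → Ω → Stack (Fin m) d) (k : ℕ) (ω : Ω) : Stack (Fin m) d :=
  if k = 0 then x 0 0 ω
  else ((par.T k : ℝ))⁻¹ • ∑ t ∈ Finset.Icc 1 (par.T k), x k t ω

/-- `x̃_k = x_{k-1} + λ_k (x̂_{k-1} - x_{k-2})` for `k ≥ 1`, where `x_k = x_k^{T_k}`. For `k = 1`
the truncated index `k - 2 = 0` gives the convention `x_{-1} = x_0`. -/
def xTilde (par : Params) (x : ℕ → ℕ → Ω → Stack (Fin m) d) (k : ℕ) (ω : Ω) : Stack (Fin m) d :=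
  x (k - 1) (par.T (k - 1)) ω
    + par.lam k • (xHat par x (k - 1) ω - x (k - 2) (par.T (k - 2)) ω)

/-- `x_k^{t-2}` for `k, t ≥ 1`, where `x_k^{-1} = x_{k-1}^{T_{k-1} - 1}`. -/
def xPrev (par : Params) (x : ℕ → ℕ → Ω → Stack (Fin m) d) (k t : ℕ) (ω : Ω) :
    Stack (Fin m) d :=
  if t = 1 then x (k - 1) (par.T (k - 1) - 1) ω else x k (t - 2) ω

/-- `ũ_k^t = x_k^{t-1} + α_k^t (x_k^{t-1} - x_k^{t-2})`. -/
def uTilde (par : Params) (x : ℕ → ℕ → Ω → Stack (Fin m) d) (k t : ℕ) (ω : Ω) :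
    Stack (Fin m) d :=
  x k (t - 1) ω + par.alpha k t • (x k (t - 1) ω - xPrev par x k t ω)

/-- The output `x̄_N`. -/
def xBar (par : Params) (x : ℕ → ℕ → Ω → Stack (Fin m) d) (N : ℕ) (ω : Ω) : Stack (Fin m) d :=
  (∑ k ∈ Finset.Icc 1 N, par.beta k)⁻¹ • ∑ k ∈ Finset.Icc 1 N, par.beta k • xHat par x k ω

/-- The mini-batch gradient estimator `v_k^(i) = (1/c_k) ∑_j G_i(x̲_k^(i), ξ_k^{(i),j})`. -/
def miniBatch {P : Problem m d} {S : Fin m → Type*} [∀ i, MeasurableSpace (S i)]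
    (O : Oracle P S) (ξ : ℕ → ℕ → Ω → (∀ i, S i)) (par : Params)
    (u : ℕ → Ω → Stack (Fin m) d) (k : ℕ) (ω : Ω) (i : Fin m) : Vec d :=
  ((par.c k : ℝ))⁻¹ • ∑ j ∈ Finset.range (par.c k), O.G i (u k ω i) (ξ k j ω i)

/-- The processes `x k t = x_k^t`, `z k t = z_k^t` and `u k = x̲_k` are generated by `N` outer
iterations of the stochastic primal-dual sliding algorithm, started at `x0`.
The values with `k = 0` only encode the initialization. -/
structure IsRun [Fintype ι] (P : Problem m d) (K : Matrix ι (Fin m) ℝ) {S : Fin m → Type*}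
    [∀ i, MeasurableSpace (S i)] (O : Oracle P S) (ξ : ℕ → ℕ → Ω → (∀ i, S i))
    (par : Params) (N : ℕ) (x0 : Stack (Fin m) d)
    (x : ℕ → ℕ → Ω → Stack (Fin m) d) (z : ℕ → ℕ → Ω → Stack ι d)
    (u : ℕ → Ω → Stack (Fin m) d) : Prop where
  x_init : ∀ t ω, x 0 t ω = x0
  z_init : ∀ t ω, z 0 t ω = 0
  u_init : ∃ u0 ∈ P.feasible, ∀ ω, u 0 ω = u0
  u_step : ∀ k, 1 ≤ k → k ≤ N → ∀ ω,
    u k ω = (1 + par.tau k)⁻¹ • (xTilde par x k ω + par.tau k • u (k - 1) ω)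
  /-- The oracle is only called inside its domain. (For `μ = 0` this needs no assumption.) -/
  query_mem : 0 < P.μ → ∀ k, 1 ≤ k → k ≤ N → ∀ ω i, u k ω i ∈ P.D i
  x_start : ∀ k, 1 ≤ k → k ≤ N → ∀ ω, x k 0 ω = x (k - 1) (par.T (k - 1)) ω
  z_start : ∀ k, 1 ≤ k → k ≤ N → ∀ ω, z k 0 ω = z (k - 1) (par.T (k - 1)) ω
  z_step : ∀ k, 1 ≤ k → k ≤ N → ∀ t, 1 ≤ t → t ≤ par.T k → ∀ ω a,
    IsMinOn (fun w : Vec d =>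
        ⟪-∑ j, K a j • uTilde par x k t ω j, w⟫_ℝ
          + par.q k t / 2 * ‖w - z k (t - 1) ω a‖ ^ 2)
      Set.univ (z k t ω a)
  x_mem : ∀ k, 1 ≤ k → k ≤ N → ∀ t, 1 ≤ t → t ≤ par.T k → ∀ ω i, x k t ω i ∈ P.X i
  x_step : ∀ k, 1 ≤ k → k ≤ N → ∀ t, 1 ≤ t → t ≤ par.T k → ∀ ω i,
    IsMinOn (fun w : Vec d =>
        P.μ * P.ν i w
          + ⟪miniBatch O ξ par u k ω i + ∑ a, K a i • z k t ω a, w⟫_ℝ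
          + par.eta k t / 2 * ‖x k (t - 1) ω i - w‖ ^ 2
          + par.p k / 2 * ‖x k 0 ω i - w‖ ^ 2)
      (P.X i) (x k t ω i)

end Algorithm

/-- The number of samples drawn by each agent in `N` outer iterations. -/
def sampleCount (par : Params) (N : ℕ) : ℕ := ∑ k ∈ Finset.Icc 1 N, par.c k

/-- The number of communication rounds in `N` outer iterations: each inner iteration has two, one
to exchange the `ũ_k^t` and one to exchange the `z_k^t`. -/
def roundCount (par : Params) (N : ℕ) : ℕ := 2 * ∑ k ∈ Finset.Icc 1 N, par.T k

/-! ### The choice of the parameters -/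

/-- `τ = 2 √(L/μ)` (used for `μ > 0`). -/
def tauC (L μ : ℝ) : ℝ := 2 * Real.sqrt (L / μ)

/-- `λ = τ / (1 + τ)` (used for `μ > 0`). -/
def lamC (L μ : ℝ) : ℝ := tauC L μ / (1 + tauC L μ)

/-- `Δ = ⌈2 τ + 1⌉` (used for `μ > 0`). -/
def DeltaC (L μ : ℝ) : ℕ := ⌈2 * tauC L μ + 1⌉₊

/-- `k ≤ Δ`, where `Δ = ∞` if `μ = 0`. -/
def BeforeDelta (L μ : ℝ) (k : ℕ) : Prop := μ = 0 ∨ k ≤ DeltaC L μ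

/-- `min {N, Δ}`, where `Δ = ∞` if `μ = 0`. -/
def minNDelta (L μ : ℝ) (N : ℕ) : ℕ := if μ = 0 then N else min N (DeltaC L μ)

/-- `min {2/N², λ^(N-Δ)}`, which is `2/N²` if `μ = 0`. -/
def rate (L μ : ℝ) (N : ℕ) : ℝ :=
  if μ = 0 then 2 / (N : ℝ) ^ 2
  else min (2 / (N : ℝ) ^ 2) (lamC L μ ^ ((N : ℝ) - DeltaC L μ))

section Choice

open Classical in
def tauK (L μ : ℝ) (k : ℕ) : ℝ :=
  if BeforeDelta L μ k then ((k : ℝ) - 1) / 2 else tauC L μ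

open Classical in
def lamK (L μ : ℝ) (k : ℕ) : ℝ :=
  if BeforeDelta L μ k then ((k : ℝ) - 1) / k else lamC L μ

open Classical in
def betaK (L μ : ℝ) (k : ℕ) : ℝ :=
  if BeforeDelta L μ k then (k : ℝ)
  else DeltaC L μ * lamC L μ ^ (-((k : ℝ) - DeltaC L μ))

open Classical in
def pK (L μ : ℝ) (k : ℕ) : ℝ :=
  if BeforeDelta L μ k then 4 * L / k else 2 * L / (1 + tauC L μ)

open Classical in
/-- `T_k`; here `A` stands for `‖𝒜‖`. -/
def TK (L μ R A : ℝ) (k : ℕ) : ℕ :=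
  if BeforeDelta L μ k then ⌈k * R * A / L⌉₊
  else ⌈2 * (1 + tauC L μ) * R * A / (L * lamC L μ ^ (((k : ℝ) - DeltaC L μ) / 2))⌉₊

open Classical in
def cK (L μ c : ℝ) (N k : ℕ) : ℕ :=
  if BeforeDelta L μ k then ⌈minNDelta L μ N * betaK L μ k * c / (pK L μ k * L)⌉₊
  else ⌈(1 + tauC L μ) ^ 2 * DeltaC L μ * c
        / (L ^ 2 * lamC L μ ^ (((k : ℝ) + N - 2 * DeltaC L μ) / 2))⌉₊

/-- The parameters of the theorem; here `A` stands for `‖𝒜‖`. -/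
def params (L μ R c A : ℝ) (N : ℕ) : Params where
  tau := tauK L μ
  lam := lamK L μ
  beta := betaK L μ
  p := pK L μ
  T := TK L μ R A
  c := cK L μ c N
  eta := fun k t => (pK L μ k + μ) * ((t : ℝ) - 1) + pK L μ k * TK L μ R A k
  q := fun k _ => L * TK L μ R A k / (4 * betaK L μ k * R ^ 2)
  alpha := fun k t =>
    if 2 ≤ k ∧ t = 1 then
      betaK L μ (k - 1) * TK L μ R A k / (betaK L μ k * TK L μ R A (k - 1))
    else 1

end Choice

/-- A random point `X̄` is a stochastic `ε`-solution: `𝔼[f(X̄) - f(x*)] ≤ ε` and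
`𝔼 ‖𝒜 X̄‖ ≤ ε`, the expectations being finite. -/
structure IsStochasticSolution {m d : ℕ} {ι : Type*} [Fintype ι] {Ω : Type*} [MeasurableSpace Ω]
    (P : Problem m d) (K : Matrix ι (Fin m) ℝ) (Pr : Measure Ω) (xs : Stack (Fin m) d)
    (ε : ℝ) (Xbar : Ω → Stack (Fin m) d) : Prop where
  integrable_gap : Integrable (fun ω => P.f (Xbar ω) - P.f xs) Pr
  gap_le : ∫ ω, (P.f (Xbar ω) - P.f xs) ∂Pr ≤ ε
  integrable_residual : Integrable (fun ω => ‖netOp K (Xbar ω)‖) Pr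
  residual_le : ∫ ω, ‖netOp K (Xbar ω)‖ ∂Pr ≤ ε

end SPDS

end

/-! The smooth part of the objective is treated by an accelerated gradient method (outer loop). In
each outer iteration the regulariser and the constraint are treated by `T_k` primal-dual steps
(inner loop) with the gradient estimate frozen. The first two points below hold for every
realisation of the samples.

Primal-dual part. One proximal step and one extrapolated dual step lower `slidingPotential` by at
least the Lagrangian gap of the linearised problem. By Jensen's inequality the gap bound passes to
the average of the inner iterates (`IsInnerRun.average_gap_le`). Weighted by `β_k / T_k`, the final
potential of iteration `k` dominates the initial potential of iteration `k + 1`, so the sum over `k`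
telescopes (`IsOuterRun.sum_gap_le`).

Acceleration. The smooth part at the weighted average is compared with its linearisations at the
query points. The errors are multiples of `‖x̂_k - x_{k-1}‖²` and are paid for by the proximal terms
with factor `p_k` (`accelerated_bound_two_phases`). The difficulty is the change of phase at `Δ`:
the accumulated weight is then larger than the geometric recursion fits, and later queries may leave
the convex hull of the iterates. The surplus weight is placed on the average of the first phase, and
the resulting extra error is summable. Adding both parts gives `IsRun.gap_le`.

Noise. The average `x̂_k` depends on the error `δ_k` of the estimator used to compute it, so `⟪δ_k,
x̂_k - x*⟫` need not have mean zero. It is compared with the average of an inner loop run with the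
exact gradient from the same state. The difference of two runs obeys the recursion of a single run,
so the two averages differ by at most `2/3 ‖δ_k‖ / p_k`, whatever `T_k` is
(`IsInnerRun.norm_sub_le`). The comparison average is a function of the past and is therefore
uncorrelated with `δ_k`. What remains is `2/3 σ² / (p_k c_k)`, and the batch sizes keep the weighted
sum of these terms below the rate (`noise_weight_le`).

Conclusion. The Lagrangian estimate holds for every multiplier: zero yields the objective, and a
multiplier of norm `‖z*‖ + 1` along the residual yields the residual. Taking expectations and using
that `Σ β_k` times the rate is at least `1` gives `IsRun.error_bounds`. The complexities come from
summing the ceilings and geometric series. -/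

section ConvexTools

/-! ### Convex analysis: proximal steps and smooth convex functions. -/

variable {E : Type*} [NormedAddCommGroup E] [InnerProductSpace ℝ E]

/-- Minimality is tested at the points `(1 - t) w + t x` of the segment; after division by `t`, the
limit `t → 0` gives the full quadratic gain. -/
theorem StrongConvexOn.add_sq_le_of_isMinOn {X : Set E} {m : ℝ} {ψ : E → ℝ}
    (hψ : StrongConvexOn X m ψ) {w x : E} (hw : w ∈ X) (hx : x ∈ X) (hmin : IsMinOn ψ X w) :
    ψ w + m / 2 * ‖w - x‖ ^ 2 ≤ ψ x := by
  have key : ∀ t : ℝ, 0 < t → t < 1 → ψ w + (1 - t) * (m / 2 * ‖w - x‖ ^ 2) ≤ ψ x := by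
    intro t ht ht1
    have h1 := hψ.2 hw hx (show 0 ≤ 1 - t by linarith) ht.le (by ring)
    have h2 : ψ w ≤ ψ ((1 - t) • w + t • x) :=
      isMinOn_iff.1 hmin _ (hψ.1 hw hx (show 0 ≤ 1 - t by linarith) ht.le (by ring))
    simp only [smul_eq_mul] at h1
    have h3 : t * (ψ w + (1 - t) * (m / 2 * ‖w - x‖ ^ 2)) ≤ t * ψ x := by nlinarith
    exact le_of_mul_le_mul_left h3 ht
  have hlim : Filter.Tendsto (fun t : ℝ => ψ w + (1 - t) * (m / 2 * ‖w - x‖ ^ 2))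
      (nhdsWithin 0 (Set.Ioi 0)) (nhds (ψ w + (1 - 0) * (m / 2 * ‖w - x‖ ^ 2))) := by
    refine Filter.Tendsto.mono_left ?_ nhdsWithin_le_nhds
    exact (Continuous.tendsto (by fun_prop) 0)
  have := le_of_tendsto hlim (b := ψ x) ?_
  · simpa using this
  · filter_upwards [Ioo_mem_nhdsGT (show (0 : ℝ) < 1 by norm_num)] with t ht
    exact key t ht.1 ht.2

/-- After subtraction of `(e + p) / 2 ‖y‖²` the two quadratics are affine, so the moduli add exactly
and no sign of `e` or `p` matters. -/
theorem strongConvexOn_add_quadratics {X : Set E} {μ e p : ℝ} {φ : E → ℝ}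
    (hφ : StrongConvexOn X μ φ) (g a b : E) :
    StrongConvexOn X (e + p + μ)
      (fun y => φ y + ⟪g, y⟫_ℝ + e / 2 * ‖a - y‖ ^ 2 + p / 2 * ‖b - y‖ ^ 2) := by
  rw [strongConvexOn_iff_convex] at hφ ⊢
  have hlin : ConvexOn ℝ X (fun y => ⟪g - e • a - p • b, y⟫_ℝ) :=
    ((innerSL ℝ (g - e • a - p • b)).toLinearMap.convexOn hφ.1)
  refine ((hφ.add hlin).add_const (e / 2 * ‖a‖ ^ 2 + p / 2 * ‖b‖ ^ 2)).congr ?_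
  intro y _
  simp only [Pi.add_apply, norm_sub_sq_real, inner_sub_left, real_inner_smul_left]
  ring

theorem prox_three_point {X : Set E} {μ e p : ℝ} {φ : E → ℝ}
    (hφ : StrongConvexOn X μ φ) {g a b w x : E} (hw : w ∈ X) (hx : x ∈ X)
    (hmin : IsMinOn (fun y => φ y + ⟪g, y⟫_ℝ + e / 2 * ‖a - y‖ ^ 2 + p / 2 * ‖b - y‖ ^ 2) X w) :
    φ w + ⟪g, w⟫_ℝ + e / 2 * ‖a - w‖ ^ 2 + p / 2 * ‖b - w‖ ^ 2 + (e + p + μ) / 2 * ‖w - x‖ ^ 2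
      ≤ φ x + ⟪g, x⟫_ℝ + e / 2 * ‖a - x‖ ^ 2 + p / 2 * ‖b - x‖ ^ 2 :=
  (strongConvexOn_add_quadratics hφ g a b).add_sq_le_of_isMinOn hw hx hmin

/-- A convex function that is bounded below on one ball decreases at most linearly, so the quadratic
wins far away and the minimisation takes place on a compact set. -/
theorem exists_isMinOn_add_sq [FiniteDimensional ℝ E] {X : Set E} {φ : E → ℝ}
    (hX : IsClosed X) (hne : X.Nonempty) (hφ : ConvexOn ℝ X φ) (hlsc : LowerSemicontinuousOn φ X)
    {s : ℝ} (hs : 0 < s) (c : E) :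
    ∃ w ∈ X, IsMinOn (fun y => φ y + s / 2 * ‖y - c‖ ^ 2) X w := by
  have hproper : ProperSpace E := FiniteDimensional.proper ℝ E
  obtain ⟨x0, hx0⟩ := hne
  -- a linear lower bound for `φ`
  obtain ⟨y0, hy0, hmin0⟩ := LowerSemicontinuousOn.exists_isMinOn
    (s := X ∩ Metric.closedBall x0 1) ⟨x0, hx0, by simp⟩
    ((isCompact_closedBall x0 1).inter_left hX) (hlsc.mono Set.inter_subset_left)
  rw [isMinOn_iff] at hmin0
  set C := φ x0 - φ y0 with hC
  have hC0 : 0 ≤ C := sub_nonneg.2 (hmin0 x0 ⟨hx0, by simp⟩)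
  have hlow : ∀ y ∈ X, φ x0 - C * (1 + ‖y - x0‖) ≤ φ y := by
    intro y hy
    rcases le_or_gt ‖y - x0‖ 1 with h | h
    · have h1 := hmin0 y ⟨hy, by simpa [dist_eq_norm] using h⟩
      nlinarith [norm_nonneg (y - x0)]
    · have hr : 0 < ‖y - x0‖ := by linarith
      set r := ‖y - x0‖ with hrdef
      have hri : r⁻¹ ≤ 1 := inv_le_one_of_one_le₀ h.le
      have hmem := hφ.1 hx0 hy (show 0 ≤ 1 - r⁻¹ by linarith) (show 0 ≤ r⁻¹ by positivity) (by ring)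
      have hconv := hφ.2 hx0 hy (show 0 ≤ 1 - r⁻¹ by linarith) (show 0 ≤ r⁻¹ by positivity) (by ring)
      have hball : (1 - r⁻¹) • x0 + r⁻¹ • y ∈ Metric.closedBall x0 1 := by
        have : (1 - r⁻¹) • x0 + r⁻¹ • y - x0 = r⁻¹ • (y - x0) := by module
        rw [Metric.mem_closedBall, dist_eq_norm, this, norm_smul, Real.norm_of_nonneg (by positivity)]
        rw [← hrdef]
        exact (inv_mul_cancel₀ hr.ne').le
      have h1 := hmin0 _ ⟨hmem, hball⟩
      simp only [smul_eq_mul] at hconv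
      have h2 : φ y0 ≤ (1 - r⁻¹) * φ x0 + r⁻¹ * φ y := h1.trans hconv
      have h3 : r * φ y0 ≤ (r - 1) * φ x0 + φ y := by
        have := mul_le_mul_of_nonneg_left h2 hr.le
        have e1 : r * ((1 - r⁻¹) * φ x0 + r⁻¹ * φ y) = (r - 1) * φ x0 + φ y := by
          field_simp
        linarith
      nlinarith
  -- outside a large ball the objective is larger than at `x0`
  set d := ‖x0 - c‖ with hd
  -- With `κ = 2 * C / s`, a radius `r > ρ` satisfies `r - 2 d ≥ 2 κ + 1` and `r ≥ 1`, whence `κ (1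
  -- + r) + d² ≤ (r - d)²`.
  set ρ := 2 * d + 2 * C / s + 1 + (2 * C / s) with hρ
  have hCs : 0 ≤ 2 * C / s := by positivity
  have hd0 : 0 ≤ d := norm_nonneg _
  have hρ0 : 0 ≤ ρ := by positivity
  obtain ⟨w, hw, hmin⟩ := LowerSemicontinuousOn.exists_isMinOn
    (s := X ∩ Metric.closedBall x0 ρ) (f := fun y => φ y + s / 2 * ‖y - c‖ ^ 2)
    ⟨x0, hx0, by simpa using hρ0⟩
    ((isCompact_closedBall x0 ρ).inter_left hX)
    ((hlsc.mono Set.inter_subset_left).add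
      ((show Continuous (fun y : E => s / 2 * ‖y - c‖ ^ 2) by fun_prop).lowerSemicontinuous.lowerSemicontinuousOn _))
  rw [isMinOn_iff] at hmin
  refine ⟨w, hw.1, isMinOn_iff.2 fun y hy => ?_⟩
  rcases le_or_gt ‖y - x0‖ ρ with h | h
  · exact hmin y ⟨hy, by simpa [dist_eq_norm] using h⟩
  · refine (hmin x0 ⟨hx0, by simpa using hρ0⟩).trans ?_
    have h1 := hlow y hy
    have h2 : ‖y - x0‖ - d ≤ ‖y - c‖ := by
      have := norm_sub_le (y - c) (x0 - c)
      rw [sub_sub_sub_cancel_right] at this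
      linarith
    set r := ‖y - x0‖ with hr
    have h3 : (r - d) ^ 2 ≤ ‖y - c‖ ^ 2 := by
      apply pow_le_pow_left₀ _ h2
      linarith
    have h4 : C = s / 2 * (2 * C / s) := by field_simp
    set κ := 2 * C / s with hκ
    have h5 : s / 2 * (κ * (1 + r) + d ^ 2) ≤ s / 2 * (r - d) ^ 2 := by
      apply mul_le_mul_of_nonneg_left _ (by positivity)
      nlinarith
    have h6 : s / 2 * (r - d) ^ 2 ≤ s / 2 * ‖y - c‖ ^ 2 :=
      mul_le_mul_of_nonneg_left h3 (by positivity)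
    have h7 : C * (1 + r) = s / 2 * (κ * (1 + r)) := by rw [h4]; ring
    show φ x0 + s / 2 * d ^ 2 ≤ φ y + s / 2 * ‖y - c‖ ^ 2
    nlinarith

/-- Each minimiser is tested against the other with the strong convexity gain; in the sum the values
of `φ` cancel and only `⟪c - c', w - w'⟫` remains. -/
theorem prox_nonexpansive {X : Set E} {s : ℝ} (hs : 0 < s) {φ : E → ℝ}
    (hφ : ConvexOn ℝ X φ) {c c' w w' : E} (hw : w ∈ X) (hw' : w' ∈ X)
    (hmin : IsMinOn (fun y => φ y + s / 2 * ‖y - c‖ ^ 2) X w)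
    (hmin' : IsMinOn (fun y => φ y + s / 2 * ‖y - c'‖ ^ 2) X w') :
    ‖w - w'‖ ≤ ‖c - c'‖ := by
  have conv : ∀ {c w w' : E}, w ∈ X → w' ∈ X →
      IsMinOn (fun y => φ y + s / 2 * ‖y - c‖ ^ 2) X w →
      φ w + s / 2 * ‖c - w‖ ^ 2 + s / 2 * ‖w - w'‖ ^ 2 ≤ φ w' + s / 2 * ‖c - w'‖ ^ 2 := by
    intro c w w' hw hw' h
    have := prox_three_point (e := s) (p := 0) (g := 0) (b := 0) (a := c)
      (strongConvexOn_zero.2 hφ) hw hw' (by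
        refine isMinOn_iff.2 fun y hy => ?_
        have := isMinOn_iff.1 h y hy
        simpa [norm_sub_rev c] using this)
    simpa using this
  have h1 := conv hw hw' hmin
  have h2 := conv hw' hw hmin'
  rw [norm_sub_rev w' w] at h2
  have h3 : ‖c - w'‖ ^ 2 + ‖c' - w‖ ^ 2 - ‖c - w‖ ^ 2 - ‖c' - w'‖ ^ 2 = 2 * ⟪c - c', w - w'⟫_ℝ := by
    simp only [norm_sub_sq_real, inner_sub_left, inner_sub_right]
    ring
  have h4 := real_inner_le_norm (c - c') (w - w')
  have h5 : s * ‖w - w'‖ ^ 2 ≤ s * (‖c - c'‖ * ‖w - w'‖) := by nlinarith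
  have h6 := le_of_mul_le_mul_left h5 hs
  rcases (norm_nonneg (w - w')).eq_or_lt with h | h
  · rw [← h]; positivity
  · rw [sq] at h6
    exact le_of_mul_le_mul_right h6 h

section Gradient

variable [CompleteSpace E]

theorem hasDerivWithinAt_comp_lineMap {D : Set E} (hD : Convex ℝ D) {f : E → ℝ} {g : E → E}
    (hg : ∀ x ∈ D, HasGradientWithinAt f (g x) D x) {x y : E} (hx : x ∈ D) (hy : y ∈ D) {t : ℝ}
    (ht : t ∈ Set.Icc (0 : ℝ) 1) :
    HasDerivWithinAt (fun s : ℝ => f (x + s • (y - x))) ⟪g (x + t • (y - x)), y - x⟫_ℝ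
      (Set.Icc 0 1) t := by
  have hmem : ∀ s ∈ Set.Icc (0 : ℝ) 1, x + s • (y - x) ∈ D := fun s hs =>
    hD.add_smul_sub_mem hx hy hs
  have h1 := (hg _ (hmem t ht)).hasFDerivWithinAt
  have h2 : HasDerivWithinAt (fun s : ℝ => x + s • (y - x)) (y - x) (Set.Icc 0 1) t := by
    simpa using (((hasDerivAt_id t).smul_const (y - x)).const_add x).hasDerivWithinAt
  have := h1.comp_hasDerivWithinAt t h2 hmem
  rwa [InnerProductSpace.toDual_apply_apply] at this

/-- On the segment this says that the derivative at `0` is at most the secant slope. The set `D` may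
have empty interior, because only derivatives along segments enter. -/
theorem ConvexOn.add_inner_le {D : Set E} {f : E → ℝ} {g : E → E} (hf : ConvexOn ℝ D f)
    (hg : ∀ x ∈ D, HasGradientWithinAt f (g x) D x) {x y : E} (hx : x ∈ D) (hy : y ∈ D) :
    f x + ⟪g x, y - x⟫_ℝ ≤ f y := by
  have h1 := hasDerivWithinAt_comp_lineMap hf.1 hg hx hy (t := 0) (by simp)
  have hcv : ConvexOn ℝ (Set.Icc (0 : ℝ) 1) (fun s : ℝ => f (x + s • (y - x))) := by
    refine ⟨convex_Icc 0 1, fun s hs t ht a b ha hb hab => ?_⟩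
    have := hf.2 (hf.1.add_smul_sub_mem hx hy hs) (hf.1.add_smul_sub_mem hx hy ht) ha hb hab
    have e : x + (a • s + b • t) • (y - x)
        = a • (x + s • (y - x)) + b • (x + t • (y - x)) := by
      have : x = a • x + b • x := by rw [← add_smul, hab, one_smul]
      simp only [smul_eq_mul, smul_add]
      nth_rewrite 1 [this]
      module
    simp only [e]
    exact this
  have h3 := hcv.le_slope_of_hasDerivWithinAt_Ioi (x := 0) (y := 1) (by simp) (by simp)
    one_pos (h1.mono_of_mem_nhdsWithin (Icc_mem_nhdsGT one_pos))
  simp only [slope_def_field, one_smul, zero_smul, add_zero, sub_zero, div_one] at h3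
  rw [add_sub_cancel] at h3
  linarith

/-- The defect `ψ` along the segment has nonpositive derivative by the Lipschitz condition;
monotonicity replaces integration of the gradient. -/
theorem le_add_inner_add_sq {D : Set E} (hD : Convex ℝ D) {f : E → ℝ} {g : E → E} {L : ℝ}
    (hg : ∀ x ∈ D, HasGradientWithinAt f (g x) D x)
    (hL : ∀ x ∈ D, ∀ y ∈ D, ‖g x - g y‖ ≤ L * ‖x - y‖) {x y : E} (hx : x ∈ D) (hy : y ∈ D) :
    f y ≤ f x + ⟪g x, y - x⟫_ℝ + L / 2 * ‖y - x‖ ^ 2 := by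
  set ψ : ℝ → ℝ := fun s => f (x + s • (y - x)) - s * ⟪g x, y - x⟫_ℝ - s ^ 2 * (L / 2 * ‖y - x‖ ^ 2)
    with hψ
  have hder : ∀ t ∈ Set.Icc (0 : ℝ) 1, HasDerivWithinAt ψ
      (⟪g (x + t • (y - x)), y - x⟫_ℝ - ⟪g x, y - x⟫_ℝ - (2 * t) * (L / 2 * ‖y - x‖ ^ 2))
      (Set.Icc 0 1) t := by
    intro t ht
    have h1 := hasDerivWithinAt_comp_lineMap hD hg hx hy ht
    have h2 : HasDerivWithinAt (fun s : ℝ => s * ⟪g x, y - x⟫_ℝ) (⟪g x, y - x⟫_ℝ)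
        (Set.Icc 0 1) t := by
      simpa using ((hasDerivAt_id t).mul_const (⟪g x, y - x⟫_ℝ)).hasDerivWithinAt
    have h3 : HasDerivWithinAt (fun s : ℝ => s ^ 2 * (L / 2 * ‖y - x‖ ^ 2))
        ((2 * t) * (L / 2 * ‖y - x‖ ^ 2)) (Set.Icc 0 1) t := by
      simpa using ((hasDerivAt_pow 2 t).mul_const (L / 2 * ‖y - x‖ ^ 2)).hasDerivWithinAt
    exact (h1.sub h2).sub h3
  have hanti : AntitoneOn ψ (Set.Icc 0 1) := by
    refine antitoneOn_of_hasDerivWithinAt_nonpos (convex_Icc 0 1)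
      (fun t ht => (hder t ht).continuousWithinAt)
      (fun t ht => (hder t (interior_subset ht)).mono interior_subset) ?_
    intro t ht
    have ht' : t ∈ Set.Icc (0 : ℝ) 1 := interior_subset ht
    have h1 := hL _ (hD.add_smul_sub_mem hx hy ht') x hx
    have e : x + t • (y - x) - x = t • (y - x) := by abel
    rw [e, norm_smul, Real.norm_of_nonneg ht'.1] at h1
    have h2 := real_inner_le_norm (g (x + t • (y - x)) - g x) (y - x)
    rw [inner_sub_left] at h2
    nlinarith [norm_nonneg (y - x)]
  have := hanti (Set.left_mem_Icc.2 zero_le_one) (Set.right_mem_Icc.2 zero_le_one) zero_le_one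
  simp only [hψ, one_smul, zero_smul, add_zero, zero_mul, one_mul, one_pow, sub_zero] at this
  rw [add_sub_cancel] at this
  nlinarith [this]

end Gradient

end ConvexTools

/-! ### Inner loop: potential of the primal-dual steps and stability in the gradient. -/

section InnerLoop

variable {E F : Type*} [NormedAddCommGroup E] [InnerProductSpace ℝ E]
  [NormedAddCommGroup F] [InnerProductSpace ℝ F]

theorem inner_le_add_half_mul_sq {c w : F} {K q : ℝ} (hK : 0 ≤ K) (hq : 0 < q)
    (h : ‖c‖ ^ 2 ≤ 2 * K * q) : ⟪c, w⟫_ℝ ≤ K + q / 2 * ‖w‖ ^ 2 := by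
  have h1 := real_inner_le_norm c w
  have h2 : ‖c‖ * ‖w‖ ≤ K + q / 2 * ‖w‖ ^ 2 := by
    apply abs_le_of_sq_le_sq' _ (by positivity) |>.2
    have : (‖c‖ * ‖w‖) ^ 2 ≤ 2 * K * q * ‖w‖ ^ 2 := by
      rw [mul_pow]; exact mul_le_mul_of_nonneg_right h (sq_nonneg _)
    nlinarith [sq_nonneg (K - q / 2 * ‖w‖ ^ 2)]
  linarith

/-- The extrapolation `a • y` predicts the move `x₁ - x₀`. The product of the true move with `z₁ -
z` goes into the new potential, that of the prediction with `z₀ - z` comes from the old one, and the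
mixed product with `z₁ - z₀` is paid for by `K` and `q / 2 ‖z₁ - z₀‖²`. -/
theorem dual_step_le (A : E →L[ℝ] F) {x₁ x₀ y x : E} {z₁ z₀ z : F} {a q K : ℝ}
    (hz : q • (z₁ - z₀) = A (x₀ + a • y))
    (hK : ∀ w, a * ⟪A y, w⟫_ℝ ≤ K + q / 2 * ‖w‖ ^ 2) :
    ⟪A x₁, z⟫_ℝ - ⟪A x, z₁⟫_ℝ + (q / 2 * ‖z₁ - z‖ ^ 2 + ⟪A (x₁ - x₀), z₁ - z⟫_ℝ)
      - (q / 2 * ‖z₀ - z‖ ^ 2 + a * ⟪A y, z₀ - z⟫_ℝ + K) ≤ ⟪A (x₁ - x), z₁⟫_ℝ := by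
  have h1 := hK (z₁ - z₀)
  have h2 : q * ⟪z₁ - z₀, z₁ - z⟫_ℝ = ⟪A x₀, z₁ - z⟫_ℝ + a * ⟪A y, z₁ - z⟫_ℝ := by
    rw [← real_inner_smul_left, hz, map_add, map_smul, inner_add_left, real_inner_smul_left]
  have h3 : ‖z₀ - z‖ ^ 2 = ‖z₁ - z‖ ^ 2 - 2 * ⟪z₁ - z₀, z₁ - z⟫_ℝ + ‖z₁ - z₀‖ ^ 2 := by
    rw [real_inner_comm, ← norm_sub_sq_real, sub_sub_sub_cancel_left]
  have h4 : ⟪A y, z₁ - z₀⟫_ℝ = ⟪A y, z₁ - z⟫_ℝ - ⟪A y, z₀ - z⟫_ℝ := by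
    rw [← inner_sub_right, sub_sub_sub_cancel_right]
  rw [h3]
  rw [h4] at h1
  simp only [map_sub, inner_sub_left, inner_sub_right] at *
  nlinarith

/-- The potential of the sliding iteration, measured against the comparison pair `(y, w)`. -/
noncomputable def slidingPotential (A : E →L[ℝ] F) (η : ℕ → ℝ) (q a K : ℝ) (xp : E) (x : ℕ → E) (z : ℕ → F)
    (y : E) (w : F) (s : ℕ) : ℝ :=
  η (s + 1) / 2 * ‖x s - y‖ ^ 2 + q / 2 * ‖z s - w‖ ^ 2 +
    if s = 0 then a * ⟪A (x 0 - xp), z 0 - w⟫_ℝ + K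
    else ⟪A (x s - x (s - 1)), z s - w⟫_ℝ + η s / 2 * ‖x s - x (s - 1)‖ ^ 2

/-- The extrapolated point `ũ^{t+1}`; the extrapolation factor is `a` in the first step and `1`
later on. -/
noncomputable def extrapolation (a : ℝ) (xp : E) (x : ℕ → E) (t : ℕ) : E :=
  x t + (if t = 0 then a else 1) • (x t - if t = 0 then xp else x (t - 1))

/-- The primal estimate enters only through `hG` with an abstract gain `G`. Thus one telescoping
argument serves the optimality gap of one run and also the difference of two runs, which minimises
nothing. -/
theorem sum_add_slidingPotential_le (A : E →L[ℝ] F) {η : ℕ → ℝ} {q a K : ℝ} {T : ℕ} {xp : E}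
    {x : ℕ → E} {z : ℕ → F} {y : E} {w : F} {G : ℕ → ℝ} (hq : 0 < q) (hη : ∀ t, 1 ≤ t → 0 ≤ η t)
    (hA : ∀ t, 1 ≤ t → t ≤ T → ‖A‖ ^ 2 ≤ η t * q)
    (hK : ∀ w', a * ⟪A (x 0 - xp), w'⟫_ℝ ≤ K + q / 2 * ‖w'‖ ^ 2)
    (hz : ∀ t < T, q • (z (t + 1) - z t) = A (extrapolation a xp x t))
    (hG : ∀ t < T, G t + ⟪A (x (t + 1) - y), z (t + 1)⟫_ℝ + η (t + 2) / 2 * ‖x (t + 1) - y‖ ^ 2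
      + η (t + 1) / 2 * ‖x (t + 1) - x t‖ ^ 2 ≤ η (t + 1) / 2 * ‖x t - y‖ ^ 2) (s : ℕ) (hs : s ≤ T) :
    ∑ t ∈ Finset.range s, (G t + ⟪A (x (t + 1)), w⟫_ℝ - ⟪A y, z (t + 1)⟫_ℝ)
      + slidingPotential A η q a K xp x z y w s ≤ slidingPotential A η q a K xp x z y w 0 := by
  induction s with
  | zero => simp
  | succ s ih =>
    have ih := ih (by omega)
    rw [Finset.sum_range_succ]
    have h1 := hG s (by omega)
    have h2 := hz s (by omega)
    rcases Nat.eq_zero_or_pos s with rfl | hs0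
    · simp only [extrapolation, if_true] at h2
      have h3 := dual_step_le A (x₁ := x 1) (x := y) (z := w) h2 hK
      simp only [slidingPotential, Finset.range_zero, Finset.sum_empty, zero_add, if_true,
        Nat.one_ne_zero, if_false, Nat.sub_self] at h1 h3 ⊢
      linarith
    · have hs1 : s ≠ 0 := by omega
      simp only [extrapolation, hs1, if_false] at h2
      -- After the first step the role of `K` is played by the square of the last primal move, left
      -- over by the previous primal inequality; `‖A‖² ≤ η q` makes it large enough.
      have hK' : ∀ w', 1 * ⟪A (x s - x (s - 1)), w'⟫_ℝ
          ≤ η s / 2 * ‖x s - x (s - 1)‖ ^ 2 + q / 2 * ‖w'‖ ^ 2 := by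
        intro w'
        rw [one_mul]
        refine inner_le_add_half_mul_sq (mul_nonneg (div_nonneg (hη s hs0) (by norm_num))
          (sq_nonneg _)) hq ?_
        have h4 : ‖A (x s - x (s - 1))‖ ^ 2 ≤ ‖A‖ ^ 2 * ‖x s - x (s - 1)‖ ^ 2 := by
          rw [← mul_pow]
          exact pow_le_pow_left₀ (norm_nonneg _) (A.le_opNorm _) 2
        have h5 := mul_le_mul_of_nonneg_right (hA s hs0 (by omega)) (sq_nonneg ‖x s - x (s - 1)‖)
        linarith
      have h3 := dual_step_le A (x₁ := x (s + 1)) (x := y) (z := w) h2 hK'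
      simp only [slidingPotential, hs1, if_false, Nat.add_eq_zero_iff, one_ne_zero, and_false,
        Nat.add_sub_cancel, zero_add, if_true] at ih ⊢
      simp only [add_assoc, Nat.reduceAdd] at *
      linarith

/-- The cross term can be negative, but Young's inequality with `‖A‖² ≤ η q` absorbs it in the dual
square and the square of the last move. -/
theorem le_slidingPotential (A : E →L[ℝ] F) {η : ℕ → ℝ} {q a K : ℝ} {xp : E}
    {x : ℕ → E} {z : ℕ → F} {y : E} {w : F} {s : ℕ} (hs : s ≠ 0) (hq : 0 < q) (hη : 0 ≤ η s)
    (hA : ‖A‖ ^ 2 ≤ η s * q) :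
    η (s + 1) / 2 * ‖x s - y‖ ^ 2 ≤ slidingPotential A η q a K xp x z y w s := by
  have h : ⟪-A (x s - x (s - 1)), z s - w⟫_ℝ
      ≤ η s / 2 * ‖x s - x (s - 1)‖ ^ 2 + q / 2 * ‖z s - w‖ ^ 2 := by
    refine inner_le_add_half_mul_sq (by positivity) hq ?_
    have h4 : ‖-A (x s - x (s - 1))‖ ^ 2 ≤ ‖A‖ ^ 2 * ‖x s - x (s - 1)‖ ^ 2 := by
      rw [norm_neg, ← mul_pow]
      exact pow_le_pow_left₀ (norm_nonneg _) (A.le_opNorm _) 2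
    have h5 := mul_le_mul_of_nonneg_right hA (sq_nonneg ‖x s - x (s - 1)‖)
    linarith
  rw [inner_neg_left] at h
  simp only [slidingPotential, hs, if_false]
  linarith

variable [CompleteSpace E] [CompleteSpace F]

/-- The sequences `x`, `z` are produced by `T` steps of the inner loop with linear term `v`, prox
center `x 0`, and preceding point `xp`. -/
structure IsInnerRun (A : E →L[ℝ] F) (X : Set E) (φ : E → ℝ) (η : ℕ → ℝ) (p q a : ℝ) (T : ℕ)
    (v xp : E) (x : ℕ → E) (z : ℕ → F) : Prop where
  dual : ∀ t < T, q • (z (t + 1) - z t) = A (extrapolation a xp x t)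
  mem : ∀ t < T, x (t + 1) ∈ X
  primal : ∀ t < T, IsMinOn (fun y => φ y + ⟪v + A.adjoint (z (t + 1)), y⟫_ℝ
    + η (t + 1) / 2 * ‖x t - y‖ ^ 2 + p / 2 * ‖x 0 - y‖ ^ 2) X (x (t + 1))

variable {A : E →L[ℝ] F} {X : Set E} {φ : E → ℝ} {η : ℕ → ℝ} {μ p q a K : ℝ} {T : ℕ}
  {v v' xp : E} {x x' : ℕ → E} {z z' : ℕ → F}

/-- The modulus of the proximal objective at step `t + 1` is `η (t + 1) + p + μ`. The recursion for
`η` makes this the coefficient of the next step, which is what telescoping needs. -/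
theorem IsInnerRun.sum_gap_le (h : IsInnerRun A X φ η p q a T v xp x z)
    (hφ : StrongConvexOn X μ φ) (hq : 0 < q) (hη : ∀ t, 1 ≤ t → 0 ≤ η t)
    (hη' : ∀ t, η (t + 2) = η (t + 1) + p + μ)
    (hA : ∀ t, 1 ≤ t → t ≤ T → ‖A‖ ^ 2 ≤ η t * q)
    (hK : ∀ w', a * ⟪A (x 0 - xp), w'⟫_ℝ ≤ K + q / 2 * ‖w'‖ ^ 2) {y : E} (hy : y ∈ X) (w : F) :
    ∑ t ∈ Finset.range T, (φ (x (t + 1)) + ⟪v, x (t + 1)⟫_ℝ + ⟪A (x (t + 1)), w⟫_ℝ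
        + p / 2 * ‖x 0 - x (t + 1)‖ ^ 2 - (φ y + ⟪v, y⟫_ℝ + p / 2 * ‖x 0 - y‖ ^ 2)
        - ⟪A y, z (t + 1)⟫_ℝ)
      + slidingPotential A η q a K xp x z y w T ≤ slidingPotential A η q a K xp x z y w 0 := by
  have := sum_add_slidingPotential_le A (T := T) (y := y) (w := w)
    (G := fun t => φ (x (t + 1)) + ⟪v, x (t + 1)⟫_ℝ + p / 2 * ‖x 0 - x (t + 1)‖ ^ 2
      - (φ y + ⟪v, y⟫_ℝ + p / 2 * ‖x 0 - y‖ ^ 2)) hq hη hA hK h.dual ?_ T le_rfl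
  · refine le_trans (le_of_eq ?_) this
    congr 1
    refine Finset.sum_congr rfl fun t _ => ?_
    ring
  · intro t ht
    have h1 := prox_three_point hφ (h.mem t ht) hy (h.primal t ht)
    have h2 : ⟪A.adjoint (z (t + 1)), x (t + 1)⟫_ℝ - ⟪A.adjoint (z (t + 1)), y⟫_ℝ
        = ⟪A (x (t + 1) - y), z (t + 1)⟫_ℝ := by
      rw [← inner_sub_right, ContinuousLinearMap.adjoint_inner_left, real_inner_comm]
    rw [inner_add_left, inner_add_left] at h1
    rw [hη', norm_sub_rev (x (t + 1)) (x t)]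
    linarith

/-- Take the index `s` where `h` has its maximum `m`; since `T ≥ s`, the left side is at least `p s
m²`. If `p m ≤ G`, the parabola increases up to `m`, every summand is at most `G m - p m² / 2`, and
`3/2 p m ≤ G` follows. If `p m > G`, the top value `G² / (2 p)` of the parabola is too small. -/
theorem norm_le_two_thirds_of_forall_sum_le {h : ℕ → ℝ} {G p : ℝ} {T : ℕ} (hp : 0 < p) (hG : 0 ≤ G)
    (h0 : ∀ t, 0 ≤ h t)
    (hsum : ∀ s, 1 ≤ s → s ≤ T → p * (T + s) / 2 * h s ^ 2
      ≤ ∑ t ∈ Finset.Icc 1 s, (G * h t - p / 2 * h t ^ 2)) (t : ℕ) (ht : 1 ≤ t) (htT : t ≤ T) :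
    h t ≤ 2 / 3 * (G / p) := by
  obtain ⟨s, hs, hmax⟩ := Finset.exists_max_image (Finset.Icc 1 T) h ⟨t, by simp [ht, htT]⟩
  rw [Finset.mem_Icc] at hs
  refine (hmax t (by simp [ht, htT])).trans ?_
  have hs1 : (1 : ℝ) ≤ s := by exact_mod_cast hs.1
  have hsT : (s : ℝ) ≤ T := by exact_mod_cast hs.2
  have h1 := hsum s hs.1 hs.2
  set m := h s with hm
  have hm0 : 0 ≤ m := h0 s
  rw [show 2 / 3 * (G / p) = (2 * G / 3) / p by ring, le_div_iff₀ hp]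
  have hTm : p * s * m ^ 2 ≤ p * (T + s) / 2 * m ^ 2 := by
    apply mul_le_mul_of_nonneg_right _ (sq_nonneg _)
    nlinarith
  rcases le_or_gt (p * m) G with hle | hgt
  · have h2 : ∑ t ∈ Finset.Icc 1 s, (G * h t - p / 2 * h t ^ 2)
        ≤ ∑ t ∈ Finset.Icc 1 s, (G * m - p / 2 * m ^ 2) := by
      refine Finset.sum_le_sum fun t ht => ?_
      rw [Finset.mem_Icc] at ht
      have h3 : h t ≤ m := hmax t (Finset.mem_Icc.2 ⟨ht.1, ht.2.trans hs.2⟩)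
      have h4 := h0 t
      nlinarith [mul_nonneg (sub_nonneg.2 h3) (sub_nonneg.2 hle),
        mul_nonneg hp.le (sq_nonneg (m - h t))]
    rw [Finset.sum_const, Nat.card_Icc, Nat.add_sub_cancel, nsmul_eq_mul] at h2
    have h3 : s * (m * (m * p)) ≤ s * (m * (2 * G / 3)) := by nlinarith
    have h4 := le_of_mul_le_mul_left h3 (by linarith)
    rcases hm0.eq_or_lt with h5 | h5
    · rw [← h5]; linarith
    · exact le_of_mul_le_mul_left h4 h5
  · exfalso
    have h2 : ∑ t ∈ Finset.Icc 1 s, (G * h t - p / 2 * h t ^ 2)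
        ≤ ∑ t ∈ Finset.Icc 1 s, (G * G / (2 * p)) := by
      refine Finset.sum_le_sum fun t ht => ?_
      rw [le_div_iff₀ (by positivity)]
      nlinarith [sq_nonneg (G - p * h t)]
    rw [Finset.sum_const, Nat.card_Icc, Nat.add_sub_cancel, nsmul_eq_mul] at h2
    have h3 : p * s * m ^ 2 ≤ s * (G * G / (2 * p)) := hTm.trans (h1.trans h2)
    have h4 : s * (p * m ^ 2) ≤ s * (G * G / (2 * p)) := by linarith
    have h5 := le_of_mul_le_mul_left h4 (by linarith)
    rw [le_div_iff₀ (by positivity)] at h5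
    nlinarith

/-- The difference of the two runs satisfies the hypotheses of `sum_add_slidingPotential_le` with
comparison pair `(0, 0)` and initial potential zero. The bound does not grow with `T`, because `η`
already starts at `p T` and every step gains a further `p / 2` times the squared distance. -/
theorem IsInnerRun.norm_sub_le (h : IsInnerRun A X φ η p q a T v xp x z)
    (h' : IsInnerRun A X φ η p q a T v' xp x' z') (hx : x 0 = x' 0) (hz : z 0 = z' 0)
    (hφ : StrongConvexOn X μ φ) (hμ : 0 ≤ μ) (hp : 0 < p) (hq : 0 < q)
    (hη : ∀ t, η (t + 1) = (p + μ) * t + p * T) (hη0 : ∀ t, 1 ≤ t → 0 ≤ η t)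
    (hA : ∀ t, 1 ≤ t → t ≤ T → ‖A‖ ^ 2 ≤ η t * q) (t : ℕ) (ht1 : 1 ≤ t) (ht : t ≤ T) :
    ‖x t - x' t‖ ≤ 2 / 3 * (‖v - v'‖ / p) := by
  refine norm_le_two_thirds_of_forall_sum_le (h := fun t => ‖x t - x' t‖) hp (norm_nonneg _)
    (fun _ => norm_nonneg _) ?_ t ht1 ht
  intro s hs1 hsT
  have hη' : ∀ t, η (t + 2) = η (t + 1) + p + μ := by
    intro t; rw [hη t, hη (t + 1)]; push_cast; ring
  have key := sum_add_slidingPotential_le A (T := T) (x := fun t => x t - x' t)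
    (z := fun t => z t - z' t) (xp := 0) (a := a) (K := 0) (y := 0) (w := 0)
    (G := fun t => ⟪v - v', x (t + 1) - x' (t + 1)⟫_ℝ + (p + μ) / 2 * ‖x (t + 1) - x' (t + 1)‖ ^ 2)
    hq hη0 hA ?_ ?_ ?_ s hsT
  · have h1 := le_slidingPotential A (η := η) (q := q) (a := a) (K := 0) (xp := 0)
      (x := fun t => x t - x' t) (z := fun t => z t - z' t) (y := 0) (w := 0) (s := s)
      (by omega) hq (hη0 s hs1) (hA s hs1 hsT)
    have h2 : slidingPotential A η q a 0 0 (fun t => x t - x' t) (fun t => z t - z' t) 0 0 0 = 0 := by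
      simp [slidingPotential, hx, hz]
    rw [h2] at key
    have h3 : p * (T + s) / 2 * ‖x s - x' s‖ ^ 2 ≤ η (s + 1) / 2 * ‖x s - x' s - 0‖ ^ 2 := by
      rw [sub_zero, hη]
      apply mul_le_mul_of_nonneg_right _ (sq_nonneg _)
      have : 0 ≤ μ * s := by positivity
      linarith
    have h4 : -∑ t ∈ Finset.Icc 1 s, (‖v - v'‖ * ‖x t - x' t‖ - p / 2 * ‖x t - x' t‖ ^ 2)
        ≤ ∑ t ∈ Finset.range s, (⟪v - v', x (t + 1) - x' (t + 1)⟫_ℝ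
          + (p + μ) / 2 * ‖x (t + 1) - x' (t + 1)‖ ^ 2
          + ⟪A (x (t + 1) - x' (t + 1)), (0 : F)⟫_ℝ - ⟪A 0, z (t + 1) - z' (t + 1)⟫_ℝ) := by
      rw [Finset.range_eq_Ico, Finset.sum_Ico_add' (fun t => ⟪v - v', x t - x' t⟫_ℝ
          + (p + μ) / 2 * ‖x t - x' t‖ ^ 2
          + ⟪A (x t - x' t), (0 : F)⟫_ℝ - ⟪A 0, z t - z' t⟫_ℝ) 0 s 1, ← Finset.sum_neg_distrib]
      have : Finset.Ico (0 + 1) (s + 1) = Finset.Icc 1 s := by ext; simp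
      rw [this]
      refine Finset.sum_le_sum fun t _ => ?_
      have h5 := neg_le_of_abs_le (abs_real_inner_le_norm (v - v') (x t - x' t))
      simp only [inner_zero_right, map_zero, inner_zero_left, add_zero, sub_zero]
      have : 0 ≤ μ / 2 * ‖x t - x' t‖ ^ 2 := by positivity
      linarith
    linarith
  · intro w'
    simp only [hx, sub_self, map_zero, inner_zero_left, mul_zero]
    positivity
  · intro t ht
    have e1 := h.dual t ht
    have e2 := h'.dual t ht
    have : z (t + 1) - z' (t + 1) - (z t - z' t) = (z (t + 1) - z t) - (z' (t + 1) - z' t) := by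
      abel
    rw [this, smul_sub, e1, e2, ← map_sub]
    congr 1
    by_cases h0 : t = 0
    · subst h0
      simp only [extrapolation, if_true, hx]
      simp
    · simp only [extrapolation, h0, if_false]
      module
  · intro t ht
    -- Each minimiser is tested against that of the other run; in the sum the values of `φ` and the
    -- quadratics around the common centre `x 0` cancel.
    have e1 := prox_three_point hφ (h.mem t ht) (h'.mem t ht) (h.primal t ht)
    have e2 := prox_three_point hφ (h'.mem t ht) (h.mem t ht) (h'.primal t ht)
    rw [norm_sub_rev (x' (t + 1)) (x (t + 1)), ← hx] at e2
    rw [hη']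
    simp only [sub_zero]
    have h1 : ⟪v + A.adjoint (z (t + 1)), x (t + 1)⟫_ℝ - ⟪v + A.adjoint (z (t + 1)), x' (t + 1)⟫_ℝ
        + ⟪v' + A.adjoint (z' (t + 1)), x' (t + 1)⟫_ℝ - ⟪v' + A.adjoint (z' (t + 1)), x (t + 1)⟫_ℝ
        = ⟪v - v', x (t + 1) - x' (t + 1)⟫_ℝ
          + ⟪A (x (t + 1) - x' (t + 1)), z (t + 1) - z' (t + 1)⟫_ℝ := by
      rw [real_inner_comm (z (t + 1) - z' (t + 1)), ← ContinuousLinearMap.adjoint_inner_left]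
      simp only [inner_add_left, inner_sub_left, inner_sub_right, map_sub]
      ring
    have h2 : ‖x t - x' (t + 1)‖ ^ 2 + ‖x' t - x (t + 1)‖ ^ 2 - ‖x t - x (t + 1)‖ ^ 2
        - ‖x' t - x' (t + 1)‖ ^ 2 = ‖x t - x' t‖ ^ 2 + ‖x (t + 1) - x' (t + 1)‖ ^ 2
          - ‖x (t + 1) - x' (t + 1) - (x t - x' t)‖ ^ 2 := by
      simp only [norm_sub_sq_real, inner_sub_left, inner_sub_right]
      have c1 := real_inner_comm (x t) (x (t + 1))
      have c2 := real_inner_comm (x' t) (x (t + 1))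
      have c3 := real_inner_comm (x t) (x' (t + 1))
      have c4 := real_inner_comm (x' t) (x' (t + 1))
      linarith
    have h3 := congrArg (fun r => η (t + 1) / 2 * r) h2
    linarith

end InnerLoop

/-! ### Outer loop: the potentials of consecutive inner loops are matched. -/

section OuterLoop

variable {E F : Type*} [NormedAddCommGroup E] [InnerProductSpace ℝ E]
  [NormedAddCommGroup F] [InnerProductSpace ℝ F]

/-- The average of the iterates `x 1, …, x T`. -/
noncomputable def loopAverage (T : ℕ) (x : ℕ → E) : E :=
  ((T : ℝ))⁻¹ • ∑ t ∈ Finset.range T, x (t + 1)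

theorem ConvexOn.loopAverage_le {X : Set E} {f : E → ℝ} (hf : ConvexOn ℝ X f) {T : ℕ} (hT : 1 ≤ T)
    {x : ℕ → E} (hx : ∀ t < T, x (t + 1) ∈ X) :
    loopAverage T x ∈ X ∧ T * f (loopAverage T x) ≤ ∑ t ∈ Finset.range T, f (x (t + 1)) := by
  have hT0 : (0 : ℝ) < T := by exact_mod_cast hT
  have hsum : ∑ t ∈ Finset.range T, ((T : ℝ))⁻¹ = 1 := by
    rw [Finset.sum_const, Finset.card_range, nsmul_eq_mul, mul_inv_cancel₀ hT0.ne']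
  have hmem : ∀ t ∈ Finset.range T, x (t + 1) ∈ X := fun t ht => hx t (Finset.mem_range.1 ht)
  have e : loopAverage T x = ∑ t ∈ Finset.range T, ((T : ℝ))⁻¹ • x (t + 1) := by
    rw [loopAverage, Finset.smul_sum]
  constructor
  · rw [e]
    exact hf.1.sum_mem (fun _ _ => by positivity) hsum hmem
  · have := hf.map_sum_le (t := Finset.range T) (w := fun _ => ((T : ℝ))⁻¹)
      (p := fun t => x (t + 1)) (fun _ _ => by positivity) hsum hmem
    rw [← e, ← Finset.smul_sum, smul_eq_mul] at this
    have h2 := mul_le_mul_of_nonneg_left this hT0.le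
    rwa [← mul_assoc, mul_inv_cancel₀ hT0.ne', one_mul] at h2

variable [CompleteSpace E] [CompleteSpace F] {A : E →L[ℝ] F} {X : Set E} {φ : E → ℝ} {μ : ℝ}

/-- Jensen's inequality is applied to `φ` together with the linear term and the proximal quadratic,
so that this quadratic survives at the average, where it pays for the acceleration error. The
condition `A y = 0` removes the dual iterates. -/
theorem IsInnerRun.average_gap_le {η : ℕ → ℝ} {p q a K : ℝ} {T : ℕ} {v xp : E} {x : ℕ → E}
    {z : ℕ → F} (h : IsInnerRun A X φ η p q a T v xp x z) (hT : 1 ≤ T)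
    (hφ : StrongConvexOn X μ φ) (hμ : 0 ≤ μ) (hp : 0 ≤ p) (hq : 0 < q)
    (hη : ∀ t, 1 ≤ t → 0 ≤ η t)
    (hη' : ∀ t, η (t + 2) = η (t + 1) + p + μ)
    (hA : ∀ t, 1 ≤ t → t ≤ T → ‖A‖ ^ 2 ≤ η t * q)
    (hK : ∀ w', a * ⟪A (x 0 - xp), w'⟫_ℝ ≤ K + q / 2 * ‖w'‖ ^ 2) {y : E} (hy : y ∈ X)
    (hAy : A y = 0) (w : F) :
    T * (φ (loopAverage T x) + ⟪v, loopAverage T x⟫_ℝ + ⟪A (loopAverage T x), w⟫_ℝ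
        + p / 2 * ‖x 0 - loopAverage T x‖ ^ 2 - φ y - ⟪v, y⟫_ℝ)
      + slidingPotential A η q a K xp x z y w T
      ≤ slidingPotential A η q a K xp x z y w 0 + T * (p / 2 * ‖x 0 - y‖ ^ 2) := by
  have h1 := h.sum_gap_le hφ hq hη hη' hA hK hy w
  have hcv : ConvexOn ℝ X (fun y => φ y + ⟪v + A.adjoint w, y⟫_ℝ + 0 / 2 * ‖(0 : E) - y‖ ^ 2
      + p / 2 * ‖x 0 - y‖ ^ 2) := by
    have := strongConvexOn_add_quadratics (e := 0) (p := p) hφ (v + A.adjoint w) 0 (x 0)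
    exact UniformConvexOn.convexOn this (fun r => by simp only [Pi.zero_apply]; positivity)
  have h2 := (ConvexOn.loopAverage_le hcv hT h.mem).2
  have h3 : ∀ y, ⟪v + A.adjoint w, y⟫_ℝ = ⟪v, y⟫_ℝ + ⟪A y, w⟫_ℝ := by
    intro y
    rw [inner_add_left, ContinuousLinearMap.adjoint_inner_left, real_inner_comm (A y)]
  simp only [h3, zero_div, zero_mul, add_zero] at h2
  have h4 : ∑ t ∈ Finset.range T, (φ (x (t + 1)) + ⟪v, x (t + 1)⟫_ℝ + ⟪A (x (t + 1)), w⟫_ℝ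
        + p / 2 * ‖x 0 - x (t + 1)‖ ^ 2 - (φ y + ⟪v, y⟫_ℝ + p / 2 * ‖x 0 - y‖ ^ 2)
        - ⟪A y, z (t + 1)⟫_ℝ) = ∑ t ∈ Finset.range T, (φ (x (t + 1)) + (⟪v, x (t + 1)⟫_ℝ
        + ⟪A (x (t + 1)), w⟫_ℝ) + p / 2 * ‖x 0 - x (t + 1)‖ ^ 2)
        - T * (φ y + ⟪v, y⟫_ℝ + p / 2 * ‖x 0 - y‖ ^ 2) := by
    simp only [hAy, inner_zero_left, sub_zero]
    rw [Finset.sum_sub_distrib, Finset.sum_const, Finset.card_range, nsmul_eq_mul]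
    congr 1
    exact Finset.sum_congr rfl fun t _ => by ring
  rw [h4] at h1
  linarith

/-- `N` outer iterations with fixed linear terms `v k`. -/
structure IsOuterRun (A : E →L[ℝ] F) (X : Set E) (φ : E → ℝ) (μ : ℝ) (β p : ℕ → ℝ) (T : ℕ → ℕ)
    (Q : ℝ) (N : ℕ) (x0 : E) (v : ℕ → E) (x : ℕ → ℕ → E) (z : ℕ → ℕ → F) : Prop where
  x_init : ∀ t, x 0 t = x0
  z_init : ∀ t, z 0 t = 0
  x_start : ∀ k < N, x (k + 1) 0 = x k (T k)
  z_start : ∀ k < N, z (k + 1) 0 = z k (T k)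
  inner : ∀ k < N, IsInnerRun A X φ (fun t => (p (k + 1) + μ) * ((t : ℝ) - 1) + p (k + 1) * T (k + 1))
    (p (k + 1)) (Q * T (k + 1) / β (k + 1))
    (if k = 0 then 1 else β k * T (k + 1) / (β (k + 1) * T k)) (T (k + 1)) (v (k + 1))
    (x k (T k - 1)) (x (k + 1)) (z (k + 1))

/-- The conditions on the step sizes which make the potentials of consecutive outer iterations
match. -/
structure StepConditions (μ : ℝ) (β p : ℕ → ℝ) (T : ℕ → ℕ) (Q a : ℝ) (N : ℕ) : Prop where
  Q_pos : 0 < Q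
  μ_nonneg : 0 ≤ μ
  β_pos : ∀ k, 1 ≤ k → k ≤ N → 0 < β k
  p_pos : ∀ k, 1 ≤ k → k ≤ N → 0 < p k
  T_pos : ∀ k, 1 ≤ k → k ≤ N → 1 ≤ T k
  norm_sq_le : ∀ k, 1 ≤ k → k ≤ N → a ^ 2 * β k ≤ p k * T k ^ 2 * Q
  descent : ∀ k, 1 ≤ k → k < N → 2 * (β (k + 1) * p (k + 1)) ≤ β k * (2 * p k + μ)

variable {β p : ℕ → ℝ} {T : ℕ → ℕ} {Q : ℝ} {N : ℕ} {x0 : E} {v : ℕ → E} {x : ℕ → ℕ → E}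
  {z : ℕ → ℕ → F}

theorem StepConditions.eta_ge {a : ℝ} (hs : StepConditions μ β p T Q a N) {k : ℕ} (hk : 1 ≤ k)
    (hkN : k ≤ N) (t : ℕ) (ht : 1 ≤ t) : p k * T k ≤ (p k + μ) * ((t : ℝ) - 1) + p k * T k := by
  have h1 : (1 : ℝ) ≤ t := by exact_mod_cast ht
  have := hs.p_pos k hk hkN
  have := hs.μ_nonneg
  nlinarith [mul_nonneg (show 0 ≤ p k + μ by linarith) (sub_nonneg.2 h1)]

theorem StepConditions.eta_nonneg {a : ℝ} (hs : StepConditions μ β p T Q a N) {k : ℕ} (hk : 1 ≤ k)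
    (hkN : k ≤ N) (t : ℕ) (ht : 1 ≤ t) : 0 ≤ (p k + μ) * ((t : ℝ) - 1) + p k * T k :=
  (mul_nonneg (hs.p_pos k hk hkN).le (Nat.cast_nonneg _)).trans (hs.eta_ge hk hkN t ht)

theorem StepConditions.norm_sq_le_eta_mul {a : ℝ} (hs : StepConditions μ β p T Q a N) {k : ℕ}
    (hk : 1 ≤ k) (hkN : k ≤ N) (t : ℕ) (ht : 1 ≤ t) :
    a ^ 2 ≤ ((p k + μ) * ((t : ℝ) - 1) + p k * T k) * (Q * T k / β k) := by
  have hβ := hs.β_pos k hk hkN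
  have hQ := hs.Q_pos
  refine le_trans ?_ (mul_le_mul_of_nonneg_right (hs.eta_ge hk hkN t ht) (by positivity))
  rw [mul_div_assoc', le_div_iff₀ hβ]
  have := hs.norm_sq_le k hk hkN
  nlinarith

theorem IsOuterRun.sum_gap_add_potential_le (h : IsOuterRun A X φ μ β p T Q N x0 v x z)
    (hφ : StrongConvexOn X μ φ) (hs : StepConditions μ β p T Q ‖A‖ N) {y : E} (hy : y ∈ X)
    (hAy : A y = 0) (w : F) (n : ℕ) (hn : n < N) :
    ∑ k ∈ Finset.range (n + 1), β (k + 1) * (φ (loopAverage (T (k + 1)) (x (k + 1)))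
        + ⟪v (k + 1), loopAverage (T (k + 1)) (x (k + 1))⟫_ℝ
        + ⟪A (loopAverage (T (k + 1)) (x (k + 1))), w⟫_ℝ
        + p (k + 1) / 2 * ‖x k (T k) - loopAverage (T (k + 1)) (x (k + 1))‖ ^ 2
        - φ y - ⟪v (k + 1), y⟫_ℝ)
      + (β (n + 1) * (2 * p (n + 1) + μ) / 2 * ‖x (n + 1) (T (n + 1)) - y‖ ^ 2
        + Q / 2 * ‖z (n + 1) (T (n + 1)) - w‖ ^ 2
        + β (n + 1) / T (n + 1) * (⟪A (x (n + 1) (T (n + 1)) - x (n + 1) (T (n + 1) - 1)),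
            z (n + 1) (T (n + 1)) - w⟫_ℝ
          + ((p (n + 1) + μ) * ((T (n + 1) : ℝ) - 1) + p (n + 1) * T (n + 1)) / 2
            * ‖x (n + 1) (T (n + 1)) - x (n + 1) (T (n + 1) - 1)‖ ^ 2))
      ≤ β 1 * p 1 * ‖x0 - y‖ ^ 2 + Q / 2 * ‖w‖ ^ 2 := by
  have hQ := hs.Q_pos
  -- The inner estimate times `β / T`. Since `q = Q T / β`, the dual weight `Q / 2` no longer
  -- depends on `k`. The final primal weight is `β (2 p + μ) / 2` because `η (T + 1) = (2 p + μ) T`;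
  -- the initial one is `β p`, half from `η 1 = p T` and half from the proximal term at `y`.
  have block : ∀ k < N, ∀ K : ℝ,
      (∀ w', (if k = 0 then 1 else β k * T (k + 1) / (β (k + 1) * T k))
        * ⟪A (x (k + 1) 0 - x k (T k - 1)), w'⟫_ℝ
          ≤ K + (Q * T (k + 1) / β (k + 1)) / 2 * ‖w'‖ ^ 2) →
      β (k + 1) * (φ (loopAverage (T (k + 1)) (x (k + 1)))
        + ⟪v (k + 1), loopAverage (T (k + 1)) (x (k + 1))⟫_ℝ
        + ⟪A (loopAverage (T (k + 1)) (x (k + 1))), w⟫_ℝ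
        + p (k + 1) / 2 * ‖x k (T k) - loopAverage (T (k + 1)) (x (k + 1))‖ ^ 2
        - φ y - ⟪v (k + 1), y⟫_ℝ)
      + (β (k + 1) * (2 * p (k + 1) + μ) / 2 * ‖x (k + 1) (T (k + 1)) - y‖ ^ 2
        + Q / 2 * ‖z (k + 1) (T (k + 1)) - w‖ ^ 2
        + β (k + 1) / T (k + 1) * (⟪A (x (k + 1) (T (k + 1)) - x (k + 1) (T (k + 1) - 1)),
            z (k + 1) (T (k + 1)) - w⟫_ℝ
          + ((p (k + 1) + μ) * ((T (k + 1) : ℝ) - 1) + p (k + 1) * T (k + 1)) / 2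
            * ‖x (k + 1) (T (k + 1)) - x (k + 1) (T (k + 1) - 1)‖ ^ 2))
      ≤ β (k + 1) * p (k + 1) * ‖x k (T k) - y‖ ^ 2 + Q / 2 * ‖z k (T k) - w‖ ^ 2
        + β (k + 1) / T (k + 1) * ((if k = 0 then 1 else β k * T (k + 1) / (β (k + 1) * T k))
          * ⟪A (x k (T k) - x k (T k - 1)), z k (T k) - w⟫_ℝ + K) := by
    intro k hk K hK
    have hβ := hs.β_pos (k + 1) (by omega) (by omega)
    have hp := hs.p_pos (k + 1) (by omega) (by omega)
    have hT := hs.T_pos (k + 1) (by omega) (by omega)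
    have hT0 : (0 : ℝ) < T (k + 1) := by exact_mod_cast hT
    have h1 := (h.inner k hk).average_gap_le hT hφ hs.μ_nonneg hp.le (by positivity)
      (fun t ht => hs.eta_nonneg (by omega) (by omega) t ht)
      (fun t => by push_cast; ring)
      (fun t ht _ => hs.norm_sq_le_eta_mul (by omega) (by omega) t ht) hK hy hAy w
    have hTne : T (k + 1) ≠ 0 := by omega
    simp only [slidingPotential, hTne, if_false, if_true, h.x_start k hk, h.z_start k hk,
      zero_add] at h1
    have h2 := mul_le_mul_of_nonneg_left h1 (div_nonneg hβ.le hT0.le)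
    refine le_trans (le_of_eq ?_) (h2.trans (le_of_eq ?_))
    · push_cast
      field_simp
      ring
    · push_cast
      field_simp
      ring
  induction n with
  | zero =>
    rw [zero_add, Finset.sum_range_one]
    -- In the first iteration `K = 0` suffices: the start and the preceding point are both `x0`.
    have h1 := block 0 hn 0 (by
      intro w'
      have hβ := hs.β_pos 1 (by omega) (by omega)
      rw [h.x_start 0 hn, h.x_init, h.x_init]
      simp only [zero_add, sub_self, map_zero, inner_zero_left, mul_zero]
      positivity)
    refine h1.trans (le_of_eq ?_)
    simp [h.x_init, h.z_init]
  | succ n ih =>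
    have ih := ih (by omega)
    rw [Finset.sum_range_succ]
    have hβ := hs.β_pos (n + 1) (by omega) (by omega)
    have hβ' := hs.β_pos (n + 1 + 1) (by omega) (by omega)
    have hp := hs.p_pos (n + 1) (by omega) (by omega)
    have hT0 : (0 : ℝ) < T (n + 1) := by exact_mod_cast hs.T_pos (n + 1) (by omega) (by omega)
    have hT0' : (0 : ℝ) < T (n + 1 + 1) := by
      exact_mod_cast hs.T_pos (n + 1 + 1) (by omega) (by omega)
    have hTn : 1 ≤ T (n + 1) := hs.T_pos (n + 1) (by omega) (by omega)
    have hη := hs.eta_nonneg (k := n + 1) (by omega) (by omega) (T (n + 1)) hTn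
    have hηA := hs.norm_sq_le_eta_mul (k := n + 1) (by omega) (by omega) (T (n + 1)) hTn
    set e := x (n + 1) (T (n + 1)) - x (n + 1) (T (n + 1) - 1) with he
    set η := (p (n + 1) + μ) * ((T (n + 1) : ℝ) - 1) + p (n + 1) * T (n + 1) with hηdef
    -- With this extrapolation factor, `β / T` of the new iteration times `α` is `β / T` of the old
    -- one, so the cross terms of consecutive iterations agree.
    set α := β (n + 1) * T (n + 1 + 1) / (β (n + 1 + 1) * T (n + 1)) with hα
    have hα0 : 0 ≤ α := by positivity
    have h1 := block (n + 1) hn (α * (η / 2 * ‖e‖ ^ 2)) (by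
      intro w'
      rw [h.x_start (n + 1) hn, if_neg (by omega), ← he, ← hα, ← real_inner_smul_left]
      refine inner_le_add_half_mul_sq (by positivity) (by positivity) ?_
      rw [norm_smul, Real.norm_of_nonneg hα0]
      have h4 : ‖A e‖ ^ 2 ≤ ‖A‖ ^ 2 * ‖e‖ ^ 2 := by
        rw [← mul_pow]
        exact pow_le_pow_left₀ (norm_nonneg _) (A.le_opNorm _) 2
      have h5 : α * ‖A‖ ^ 2 ≤ η * (Q * T (n + 1 + 1) / β (n + 1 + 1)) := by
        refine (mul_le_mul_of_nonneg_left hηA hα0).trans (le_of_eq ?_)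
        rw [hα]
        field_simp
      calc (α * ‖A e‖) ^ 2 = α ^ 2 * ‖A e‖ ^ 2 := by ring
        _ ≤ α ^ 2 * (‖A‖ ^ 2 * ‖e‖ ^ 2) := mul_le_mul_of_nonneg_left h4 (sq_nonneg _)
        _ = α * ‖e‖ ^ 2 * (α * ‖A‖ ^ 2) := by ring
        _ ≤ α * ‖e‖ ^ 2 * (η * (Q * T (n + 1 + 1) / β (n + 1 + 1))) :=
          mul_le_mul_of_nonneg_left h5 (by positivity)
        _ = _ := by ring)
    rw [if_neg (by omega), ← he, ← hα] at h1
    have h2 : β (n + 1 + 1) / T (n + 1 + 1) * (α * ⟪A e, z (n + 1) (T (n + 1)) - w⟫_ℝ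
        + α * (η / 2 * ‖e‖ ^ 2)) = β (n + 1) / T (n + 1) *
          (⟪A e, z (n + 1) (T (n + 1)) - w⟫_ℝ + η / 2 * ‖e‖ ^ 2) := by
      rw [hα]
      field_simp
    rw [h2] at h1
    have h3 := mul_le_mul_of_nonneg_right (hs.descent (n + 1) (by omega) hn)
      (sq_nonneg ‖x (n + 1) (T (n + 1)) - y‖)
    linarith

/-- The last potential is nonnegative by `le_slidingPotential` and is dropped. The term `Q / 2 ‖w‖²`
is the dual distance from the start `z_0 = 0`. -/
theorem IsOuterRun.sum_gap_le (h : IsOuterRun A X φ μ β p T Q N x0 v x z)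
    (hφ : StrongConvexOn X μ φ) (hs : StepConditions μ β p T Q ‖A‖ N) (hN : 1 ≤ N) {y : E}
    (hy : y ∈ X) (hAy : A y = 0) (w : F) :
    ∑ k ∈ Finset.range N, β (k + 1) * (φ (loopAverage (T (k + 1)) (x (k + 1)))
        + ⟪v (k + 1), loopAverage (T (k + 1)) (x (k + 1))⟫_ℝ
        + ⟪A (loopAverage (T (k + 1)) (x (k + 1))), w⟫_ℝ
        + p (k + 1) / 2 * ‖x k (T k) - loopAverage (T (k + 1)) (x (k + 1))‖ ^ 2
        - φ y - ⟪v (k + 1), y⟫_ℝ) ≤ β 1 * p 1 * ‖x0 - y‖ ^ 2 + Q / 2 * ‖w‖ ^ 2 := by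
  obtain ⟨n, rfl⟩ : ∃ n, N = n + 1 := ⟨N - 1, by omega⟩
  have h1 := h.sum_gap_add_potential_le hφ hs hy hAy w n (by omega)
  have hβ := hs.β_pos (n + 1) (by omega) le_rfl
  have hp := hs.p_pos (n + 1) (by omega) le_rfl
  have hT := hs.T_pos (n + 1) (by omega) le_rfl
  have hT0 : (0 : ℝ) < T (n + 1) := by exact_mod_cast hT
  have hQ := hs.Q_pos
  have hμ := hs.μ_nonneg
  have h2 := le_slidingPotential A
    (η := fun t => (p (n + 1) + μ) * ((t : ℝ) - 1) + p (n + 1) * T (n + 1))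
    (q := Q * T (n + 1) / β (n + 1)) (a := 0) (K := 0) (xp := 0) (x := x (n + 1)) (z := z (n + 1))
    (y := y) (w := w) (s := T (n + 1)) (by omega) (by positivity)
    (hs.eta_nonneg (by omega) le_rfl _ hT) (hs.norm_sq_le_eta_mul (by omega) le_rfl _ hT)
  have hTne : T (n + 1) ≠ 0 := by omega
  simp only [slidingPotential, hTne, if_false] at h2
  have h3 := mul_le_mul_of_nonneg_left h2 (div_nonneg hβ.le hT0.le)
  have h4 : β (n + 1) / T (n + 1) * ((Q * T (n + 1) / β (n + 1)) / 2
      * ‖z (n + 1) (T (n + 1)) - w‖ ^ 2) = Q / 2 * ‖z (n + 1) (T (n + 1)) - w‖ ^ 2 := by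
    field_simp
  have h5 : 0 ≤ β (n + 1) * (2 * p (n + 1) + μ) / 2 * ‖x (n + 1) (T (n + 1)) - y‖ ^ 2 := by
    positivity
  simp only [mul_add] at h3 h1 ⊢
  linarith

end OuterLoop

/-! ### Accelerated gradient estimates for linearly, then geometrically growing weights. -/

section AcceleratedGradient

variable {E : Type*} [NormedAddCommGroup E] [InnerProductSpace ℝ E]

/-- `f` lies above its linearizations on `D`, and below them up to the quadratic term `L/2 ‖·‖²`;
`g` is its gradient. -/
structure IsConvexSmoothOn (D : Set E) (f : E → ℝ) (g : E → E) (L : ℝ) : Prop where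
  convexOn : ConvexOn ℝ D f
  le : ∀ u ∈ D, ∀ x ∈ D, f u + ⟪g u, x - u⟫_ℝ ≤ f x
  ge : ∀ u ∈ D, ∀ x ∈ D, f x ≤ f u + ⟪g u, x - u⟫_ℝ + L / 2 * ‖x - u‖ ^ 2

variable {X D : Set E} {f : E → ℝ} {g : E → E} {L : ℝ}

/-- Smoothness bounds `f y` from above and convexity bounds `f y'` from below, both by the
linearisation at `u`; the linear terms combine because `y` is the weighted mean of `y'` and `w`. The
query `u` may be any point of `D` and matters only through `e`. -/
theorem accelerated_step (hf : IsConvexSmoothOn D f g L) (hX : Convex ℝ X) (hXD : X ⊆ D)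
    {s β : ℝ} (hs : 0 ≤ s) (hβ : 0 < β) {y y' w u e : E} (hy' : y' ∈ X) (hw : w ∈ X) (hu : u ∈ D)
    (hy : (s + β) • y = s • y' + β • w) (he : (s + β) • (y - u) = e) :
    y ∈ X ∧ (s + β) * f y ≤ s * f y' + β * (f u + ⟪g u, w - u⟫_ℝ)
      + L / (2 * (s + β)) * ‖e‖ ^ 2 := by
  have hS : 0 < s + β := by linarith
  have hyX : y ∈ X := by
    have h1 : y = (s / (s + β)) • y' + (β / (s + β)) • w := by
      rw [div_eq_inv_mul, div_eq_inv_mul, mul_smul, mul_smul, ← smul_add, ← hy, inv_smul_smul₀ hS.ne']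
    rw [h1]
    exact hX hy' hw (by positivity) (by positivity) (by field_simp)
  refine ⟨hyX, ?_⟩
  have h1 := hf.ge u hu y (hXD hyX)
  have h2 := hf.le u hu y' (hXD hy')
  have h3 : (s + β) * ⟪g u, y - u⟫_ℝ = s * ⟪g u, y' - u⟫_ℝ + β * ⟪g u, w - u⟫_ℝ := by
    rw [← real_inner_smul_right, ← real_inner_smul_right, ← real_inner_smul_right,
      ← inner_add_right]
    congr 1
    rw [smul_sub, hy]
    module
  have h4 : (s + β) * (L / 2 * ‖y - u‖ ^ 2) = L / (2 * (s + β)) * ‖e‖ ^ 2 := by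
    rw [← he, norm_smul, Real.norm_of_nonneg hS.le]
    field_simp
  have h5 := mul_le_mul_of_nonneg_left h1 hS.le
  have h6 := mul_le_mul_of_nonneg_left h2 hs
  linarith

variable {xh xl u : ℕ → E} {n : ℕ}

/-- The query is the next weighted average with the still unknown `xh (j + 1)` replaced by the
proximal centre `xl j`. Hence average minus query is a multiple of `xh (j + 1) - xl j`. -/
theorem query_eq_of_increasing_weights
    (hu : ∀ j < n, (1 + (j : ℝ) / 2) • u (j + 1) = xl j + ((j : ℝ) / (j + 1)) • (xh j - xl (j - 1))
      + ((j : ℝ) / 2) • u j) (j : ℕ) (hj : j < n) :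
    (((j : ℝ) + 1) * (j + 2) / 2) • u (j + 1)
      = ∑ i ∈ Finset.range j, ((i : ℝ) + 1) • xh (i + 1) + ((j : ℝ) + 1) • xl j := by
  induction j with
  | zero =>
    have := hu 0 hj
    simp at this ⊢
    exact this
  | succ j ih =>
    have ih := ih (by omega)
    have h1 := congrArg (fun y => ((j + 1 : ℕ) + 1 : ℝ) • y) (hu (j + 1) hj)
    simp only [smul_add, smul_smul, Nat.add_sub_cancel] at h1
    push_cast at h1 ⊢
    rw [show ((j : ℝ) + 1 + 1) * (1 + ((j : ℝ) + 1) / 2) = ((j : ℝ) + 1 + 1) * (j + 1 + 2) / 2 by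
      ring, show ((j : ℝ) + 1 + 1) * (((j : ℝ) + 1) / (j + 1 + 1)) = j + 1 by field_simp,
      show ((j : ℝ) + 1 + 1) * (((j : ℝ) + 1) / 2) = ((j : ℝ) + 1) * (j + 2) / 2 by ring, ih] at h1
    rw [h1, Finset.sum_range_succ]
    module

/-- Iterated `accelerated_step`; the error coefficient is `L β² / (2 S)` with weight `β = i + 1` and
total weight `S = (i + 1) (i + 2) / 2`. -/
theorem accelerated_bound_of_increasing_weights (hf : IsConvexSmoothOn D f g L) (hX : Convex ℝ X)
    (hXD : X ⊆ D) (hxh : ∀ j < n, xh (j + 1) ∈ X) (huD : ∀ j < n, u (j + 1) ∈ D)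
    (hu : ∀ j < n, (1 + (j : ℝ) / 2) • u (j + 1) = xl j + ((j : ℝ) / (j + 1)) • (xh j - xl (j - 1))
      + ((j : ℝ) / 2) • u j) (j : ℕ) (hj : j < n) (y : E)
    (hy : (((j : ℝ) + 1) * (j + 2) / 2) • y
      = ∑ i ∈ Finset.range (j + 1), ((i : ℝ) + 1) • xh (i + 1)) :
    y ∈ X ∧ (((j : ℝ) + 1) * (j + 2) / 2) * f y ≤ ∑ i ∈ Finset.range (j + 1),
      (((i : ℝ) + 1) * (f (u (i + 1)) + ⟪g (u (i + 1)), xh (i + 1) - u (i + 1)⟫_ℝ)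
        + L * ((i + 1) / (i + 2)) * ‖xh (i + 1) - xl i‖ ^ 2) := by
  have he : ∀ (j : ℕ) (_ : j < n) (y : E), (((j : ℝ) + 1) * (j + 2) / 2) • y
      = ∑ i ∈ Finset.range (j + 1), ((i : ℝ) + 1) • xh (i + 1) →
      (((j : ℝ) + 1) * (j + 2) / 2) • (y - u (j + 1)) = ((j : ℝ) + 1) • (xh (j + 1) - xl j) := by
    intro j hj y hy
    rw [smul_sub, hy, query_eq_of_increasing_weights hu j hj, Finset.sum_range_succ]
    module
  have hq : ∀ (j : ℕ) (w : E), L / (2 * (((j : ℝ) + 1) * (j + 2) / 2)) * ‖((j : ℝ) + 1) • w‖ ^ 2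
      = L * ((j + 1) / (j + 2)) * ‖w‖ ^ 2 := by
    intro j w
    rw [norm_smul, Real.norm_of_nonneg (by positivity)]
    field_simp
  induction j generalizing y with
  | zero =>
    have h1 := accelerated_step hf hX hXD (s := 0) (β := 1) le_rfl one_pos (y := y) (y' := xh 1)
      (w := xh 1) (u := u 1) (e := xh 1 - xl 0) (hxh 0 hj) (hxh 0 hj) (huD 0 hj)
      (by simpa using hy) (by simpa using he 0 hj y hy)
    refine ⟨h1.1, ?_⟩
    have := h1.2
    simp at this ⊢
    linarith
  | succ j ih =>
    set y' : E := (((j : ℝ) + 1) * (j + 2) / 2)⁻¹ •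
      ∑ i ∈ Finset.range (j + 1), ((i : ℝ) + 1) • xh (i + 1) with hy'
    have hpos : (0 : ℝ) < ((j : ℝ) + 1) * (j + 2) / 2 := by positivity
    have hy'' : (((j : ℝ) + 1) * (j + 2) / 2) • y'
        = ∑ i ∈ Finset.range (j + 1), ((i : ℝ) + 1) • xh (i + 1) := smul_inv_smul₀ hpos.ne' _
    obtain ⟨hm, hle⟩ := ih (by omega) y' hy''
    have hS : ((j : ℝ) + 1) * (j + 2) / 2 + (j + 2) = ((j + 1 : ℕ) + 1 : ℝ) * ((j + 1 : ℕ) + 2) / 2 := by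
      push_cast; ring
    have h1 := accelerated_step hf hX hXD hpos.le (show (0 : ℝ) < j + 2 by positivity) (y := y) hm
      (hxh (j + 1) hj) (huD (j + 1) hj)
      (by
        rw [hS, hy, hy'', Finset.sum_range_succ _ (j + 1)]
        push_cast
        congr 2
        ring)
      (e := ((j + 1 : ℕ) + 1 : ℝ) • (xh (j + 1 + 1) - xl (j + 1)))
      (by rw [hS]; exact he (j + 1) hj y hy)
    refine ⟨h1.1, ?_⟩
    have h2 := h1.2
    rw [hS, hq] at h2
    rw [Finset.sum_range_succ _ (j + 1)]
    refine h2.trans ?_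
    have : ((j : ℝ) + 2) = ((j + 1 : ℕ) : ℝ) + 1 := by push_cast; ring
    rw [this] at hle ⊢
    linarith

variable {β : ℕ → ℝ} {τ : ℝ}

/-- The geometric recursion fits an accumulated weight `(n + 1) (1 + τ)` after the first phase,
whereas the weight is `(n + 1) (n + 2) / 2`. The surplus appears as a subtracted multiple of `u (n +
1)`, so queries need not be convex combinations. -/
theorem query_eq_of_geometric_weights (hτ : 0 < τ)
    (hu : ∀ j < n + 1, (1 + (j : ℝ) / 2) • u (j + 1)
      = xl j + ((j : ℝ) / (j + 1)) • (xh j - xl (j - 1)) + ((j : ℝ) / 2) • u j)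
    (hβ : ∀ j < n + 1, β (j + 1) = j + 1)
    (hβ' : ∀ i : ℕ, β (n + 1 + i) = (n + 1) * ((1 + τ) / τ) ^ i) {m : ℕ}
    (hu' : ∀ i < m, (1 + τ) • u (n + 1 + i + 1) = xl (n + 1 + i)
      + (τ / (1 + τ)) • (xh (n + 1 + i) - xl (n + i)) + τ • u (n + 1 + i)) (i : ℕ) (hi : i ≤ m) :
    ((n + 1) * (1 + τ) * ((1 + τ) / τ) ^ i) • u (n + 1 + i)
      = ∑ j ∈ Finset.range (n + i), β (j + 1) • xh (j + 1) + β (n + 1 + i) • xl (n + i)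
        - (((n : ℝ) + 1) * (n + 2) / 2 - (n + 1) * (1 + τ)) • u (n + 1) := by
  induction i with
  | zero =>
    have h1 := query_eq_of_increasing_weights hu n (by omega)
    have h2 : ∑ j ∈ Finset.range n, β (j + 1) • xh (j + 1)
        = ∑ j ∈ Finset.range n, ((j : ℝ) + 1) • xh (j + 1) :=
      Finset.sum_congr rfl fun j hj => by
        rw [hβ j (by have := Finset.mem_range.1 hj; omega)]
    simp only [add_zero, pow_zero, mul_one]
    rw [h2, hβ n (by omega), ← h1]
    module
  | succ i ih =>
    have ih := ih (by omega)
    have h1 := congrArg (fun y => β (n + 1 + (i + 1)) • y) (hu' i (by omega))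
    simp only [smul_add, smul_smul] at h1
    have e1 : β (n + 1 + (i + 1)) * (1 + τ) = (n + 1) * (1 + τ) * ((1 + τ) / τ) ^ (i + 1) := by
      rw [hβ']; ring
    have e2 : β (n + 1 + (i + 1)) * (τ / (1 + τ)) = β (n + 1 + i) := by
      rw [hβ', hβ', pow_succ]; field_simp
    have e3 : β (n + 1 + (i + 1)) * τ = (n + 1) * (1 + τ) * ((1 + τ) / τ) ^ i := by
      rw [hβ', pow_succ]; field_simp
    rw [e1, e2, e3, ih] at h1
    rw [show n + 1 + (i + 1) = n + 1 + i + 1 by ring, h1, show n + (i + 1) = n + i + 1 by ring,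
      Finset.sum_range_succ, show n + i + 1 = n + 1 + i by ring]
    module

/-- The auxiliary points `y` carry the average without the surplus weight, which is left on the
first-phase average `b`. They start at `b` and then follow `accelerated_step` exactly. The extra
vector in the error comes from `b - u (n + 1)`; it is fixed, while the weights dividing its square
grow. -/
theorem accelerated_bound_of_geometric_weights (hf : IsConvexSmoothOn D f g L) (hX : Convex ℝ X)
    (hXD : X ⊆ D) (hτ : 0 < τ) {m : ℕ}
    (hxh : ∀ j < n + 1 + m, xh (j + 1) ∈ X) (huD : ∀ j < n + 1 + m, u (j + 1) ∈ D)
    (hu : ∀ j < n + 1, (1 + (j : ℝ) / 2) • u (j + 1)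
      = xl j + ((j : ℝ) / (j + 1)) • (xh j - xl (j - 1)) + ((j : ℝ) / 2) • u j)
    (hβ : ∀ j < n + 1, β (j + 1) = j + 1)
    (hβ' : ∀ i : ℕ, β (n + 1 + i) = (n + 1) * ((1 + τ) / τ) ^ i)
    (hu' : ∀ i < m, (1 + τ) • u (n + 1 + i + 1) = xl (n + 1 + i)
      + (τ / (1 + τ)) • (xh (n + 1 + i) - xl (n + i)) + τ • u (n + 1 + i))
    {b : E} (hb : (((n : ℝ) + 1) * (n + 2) / 2) • b
      = ∑ i ∈ Finset.range (n + 1), β (i + 1) • xh (i + 1)) (hbX : b ∈ X)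
    (i : ℕ) (hi : i ≤ m) (y : E)
    (hy : ((n + 1) * (1 + τ) * ((1 + τ) / τ) ^ i) • y
      = ∑ j ∈ Finset.range (n + 1 + i), β (j + 1) • xh (j + 1)
        - (((n : ℝ) + 1) * (n + 2) / 2 - (n + 1) * (1 + τ)) • b) :
    y ∈ X ∧ ((n + 1) * (1 + τ) * ((1 + τ) / τ) ^ i) * f y ≤ (n + 1) * (1 + τ) * f b
      + ∑ j ∈ Finset.range i, (β (n + 1 + j + 1) * (f (u (n + 1 + j + 1))
          + ⟪g (u (n + 1 + j + 1)), xh (n + 1 + j + 1) - u (n + 1 + j + 1)⟫_ℝ)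
        + L / (2 * ((n + 1) * (1 + τ) * ((1 + τ) / τ) ^ (j + 1)))
          * ‖β (n + 1 + j + 1) • (xh (n + 1 + j + 1) - xl (n + 1 + j))
            - ((n + 1) - 2 * (n + 1) * (1 + τ) / (n + 2)) • (xh (n + 1) - xl n)‖ ^ 2) := by
  have hn : (0 : ℝ) < n + 1 := by positivity
  induction i generalizing y with
  | zero =>
    have hS : (0 : ℝ) < (n + 1) * (1 + τ) := by positivity
    have hyb : y = b := by
      simp only [pow_zero, mul_one, add_zero] at hy
      rw [← hb] at hy
      have : ((n + 1) * (1 + τ)) • y = ((n + 1) * (1 + τ)) • b := by rw [hy]; module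
      exact smul_right_injective E hS.ne' this
    rw [hyb]
    simpa using hbX
  | succ i ih =>
    set S : ℝ := (n + 1) * (1 + τ) * ((1 + τ) / τ) ^ i with hSdef
    have hSpos : 0 < S := by positivity
    set y' : E := S⁻¹ • (∑ j ∈ Finset.range (n + 1 + i), β (j + 1) • xh (j + 1)
        - (((n : ℝ) + 1) * (n + 2) / 2 - (n + 1) * (1 + τ)) • b) with hy'def
    have hy' : S • y' = ∑ j ∈ Finset.range (n + 1 + i), β (j + 1) • xh (j + 1)
        - (((n : ℝ) + 1) * (n + 2) / 2 - (n + 1) * (1 + τ)) • b := smul_inv_smul₀ hSpos.ne' _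
    obtain ⟨hm, hle⟩ := ih (by omega) y' hy'
    have hβi : β (n + 1 + i + 1) = (n + 1) * ((1 + τ) / τ) ^ (i + 1) := hβ' (i + 1)
    have hS1 : S + β (n + 1 + i + 1) = (n + 1) * (1 + τ) * ((1 + τ) / τ) ^ (i + 1) := by
      rw [hβi, hSdef, pow_succ]; field_simp; ring
    have hq := query_eq_of_geometric_weights hτ hu hβ hβ' hu' (i + 1) hi
    have hq0 := query_eq_of_increasing_weights hu n (by omega)
    have hd : (((n : ℝ) + 1) * (n + 2) / 2 - (n + 1) * (1 + τ)) • (b - u (n + 1))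
        = ((n + 1) - 2 * (n + 1) * (1 + τ) / (n + 2)) • (xh (n + 1) - xl n) := by
      have h1 : (((n : ℝ) + 1) * (n + 2) / 2) • (b - u (n + 1))
          = ((n : ℝ) + 1) • (xh (n + 1) - xl n) := by
        have h2 : ∑ i ∈ Finset.range (n + 1), β (i + 1) • xh (i + 1)
            = ∑ i ∈ Finset.range (n + 1), ((i : ℝ) + 1) • xh (i + 1) :=
          Finset.sum_congr rfl fun j hj => by
            rw [hβ j (Finset.mem_range.1 hj)]
        rw [smul_sub, hb, hq0, h2, Finset.sum_range_succ]
        module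
      have h3 : (((n : ℝ) + 1) * (n + 2) / 2 - (n + 1) * (1 + τ))
          = (1 - 2 * (1 + τ) / (n + 2)) * (((n : ℝ) + 1) * (n + 2) / 2) := by
        field_simp
      rw [h3, mul_smul, h1, smul_smul]
      congr 1
      field_simp
    have h1 := accelerated_step hf hX hXD hSpos.le (β := β (n + 1 + i + 1))
      (by rw [hβi]; positivity) (y := y) hm (hxh (n + 1 + i) (by omega)) (huD (n + 1 + i) (by omega))
      (e := β (n + 1 + i + 1) • (xh (n + 1 + i + 1) - xl (n + 1 + i))
            - ((n + 1) - 2 * (n + 1) * (1 + τ) / (n + 2)) • (xh (n + 1) - xl n))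
      (by
        rw [hS1, hy, hy', ← add_assoc, Finset.sum_range_succ]
        abel)
      (by
        rw [hS1, smul_sub, hy, ← add_assoc, Finset.sum_range_succ, ← hd]
        rw [show n + 1 + (i + 1) = n + 1 + i + 1 by ring, show n + (i + 1) = n + 1 + i by ring] at hq
        rw [hq]
        module)
    refine ⟨h1.1, ?_⟩
    have h2 := h1.2
    rw [hS1] at h2
    rw [Finset.sum_range_succ]
    linarith

theorem sum_pow_div_one_add_le (hτ : 0 < τ) (m : ℕ) :
    ∑ j ∈ Finset.range m, (τ / (1 + τ)) ^ (j + 1) ≤ τ := by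
  have : ∑ j ∈ Finset.range m, (τ / (1 + τ)) ^ (j + 1) = τ * (1 - (τ / (1 + τ)) ^ m) := by
    induction m with
    | zero => simp
    | succ m ih =>
      rw [Finset.sum_range_succ, ih, pow_succ]
      field_simp
      ring
  rw [this]
  have : 0 ≤ (τ / (1 + τ)) ^ m := by positivity
  nlinarith

/-- By `‖a - b‖² ≤ 2 ‖a‖² + 2 ‖b‖²`. The first half has the size that the proximal term of the
second phase can pay; the second half decays geometrically. -/
theorem overshoot_quadratic_le (hL : 0 ≤ L) (hτ : 0 < τ) {ω : ℝ} (hω : ω ^ 2 ≤ n + 1) (d e : E)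
    (j : ℕ) : L / (2 * ((n + 1) * (1 + τ) * ((1 + τ) / τ) ^ (j + 1)))
          * ‖((n + 1) * ((1 + τ) / τ) ^ (j + 1)) • d - ω • e‖ ^ 2
      ≤ L / (1 + τ) * ((n + 1) * ((1 + τ) / τ) ^ (j + 1)) * ‖d‖ ^ 2
        + L * ‖e‖ ^ 2 / (1 + τ) * (τ / (1 + τ)) ^ (j + 1) := by
  have h3 : (τ / (1 + τ)) ^ (j + 1) = (((1 + τ) / τ) ^ (j + 1))⁻¹ := by rw [← inv_pow, inv_div]
  rw [h3]
  have hr0 : 0 < ((1 + τ) / τ) ^ (j + 1) := by positivity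
  generalize ((1 + τ) / τ) ^ (j + 1) = r at hr0
  have h1 : ‖((n + 1) * r) • d - ω • e‖ ^ 2 ≤ 2 * (((n + 1) * r) ^ 2 * ‖d‖ ^ 2 + ω ^ 2 * ‖e‖ ^ 2) := by
    have h2 := parallelogram_law_with_norm ℝ (((n + 1) * r) • d) (ω • e)
    rw [norm_smul ((n + 1) * r), norm_smul ω, mul_pow, mul_pow,
      Real.norm_eq_abs, Real.norm_eq_abs, sq_abs, sq_abs] at h2
    linarith [sq_nonneg ‖((n + 1) * r) • d + ω • e‖]
  calc _ ≤ L / (2 * ((n + 1) * (1 + τ) * r))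
        * (2 * (((n + 1) * r) ^ 2 * ‖d‖ ^ 2 + ω ^ 2 * ‖e‖ ^ 2)) :=
      mul_le_mul_of_nonneg_left h1 (by positivity)
    _ = L / (1 + τ) * ((n + 1) * r) * ‖d‖ ^ 2
        + L * ‖e‖ ^ 2 / (1 + τ) * r⁻¹ * (ω ^ 2 / (n + 1)) := by
      field_simp
    _ ≤ _ := by
      have h5 : ω ^ 2 / (n + 1) ≤ 1 := by rw [div_le_one (by positivity)]; exact hω
      have h6 := mul_le_of_le_one_right (show 0 ≤ L * ‖e‖ ^ 2 / (1 + τ) * r⁻¹ by positivity) h5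
      linarith

/-- The accelerated gradient estimate over both phases. The query points need not be convex
combinations of feasible points in the second phase; only their membership in `D` is used. -/
theorem accelerated_bound_two_phases (hf : IsConvexSmoothOn D f g L) (hL : 0 ≤ L)
    (hX : Convex ℝ X) (hXD : X ⊆ D) (hτ : 0 < τ) (hn : 2 * τ ≤ n) (hn' : (n : ℝ) ≤ 2 * τ + 1) {m : ℕ}
    (hxh : ∀ j < n + 1 + m, xh (j + 1) ∈ X) (huD : ∀ j < n + 1 + m, u (j + 1) ∈ D)
    (hu : ∀ j < n + 1, (1 + (j : ℝ) / 2) • u (j + 1)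
      = xl j + ((j : ℝ) / (j + 1)) • (xh j - xl (j - 1)) + ((j : ℝ) / 2) • u j)
    (hβ : ∀ j < n + 1, β (j + 1) = j + 1)
    (hβ' : ∀ i : ℕ, β (n + 1 + i) = (n + 1) * ((1 + τ) / τ) ^ i)
    (hu' : ∀ i < m, (1 + τ) • u (n + 1 + i + 1) = xl (n + 1 + i)
      + (τ / (1 + τ)) • (xh (n + 1 + i) - xl (n + i)) + τ • u (n + 1 + i)) (y : E)
    (hy : (∑ j ∈ Finset.range (n + 1 + m), β (j + 1)) • y
      = ∑ j ∈ Finset.range (n + 1 + m), β (j + 1) • xh (j + 1)) :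
    (∑ j ∈ Finset.range (n + 1 + m), β (j + 1)) * f y ≤ ∑ j ∈ Finset.range (n + 1 + m),
      (β (j + 1) * (f (u (j + 1)) + ⟪g (u (j + 1)), xh (j + 1) - u (j + 1)⟫_ℝ)
        + (if j < n + 1 then 2 * L else L / (1 + τ) * β (j + 1)) * ‖xh (j + 1) - xl j‖ ^ 2) := by
  have hn0 : (0 : ℝ) < n + 1 := by positivity
  set b : E := (((n : ℝ) + 1) * (n + 2) / 2)⁻¹ •
    ∑ i ∈ Finset.range (n + 1), β (i + 1) • xh (i + 1) with hbdef
  have hb : (((n : ℝ) + 1) * (n + 2) / 2) • b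
      = ∑ i ∈ Finset.range (n + 1), β (i + 1) • xh (i + 1) := smul_inv_smul₀ (by positivity) _
  have hsum1 : ∑ i ∈ Finset.range (n + 1), β (i + 1) • xh (i + 1)
      = ∑ i ∈ Finset.range (n + 1), ((i : ℝ) + 1) • xh (i + 1) :=
    Finset.sum_congr rfl fun j hj => by rw [hβ j (Finset.mem_range.1 hj)]
  obtain ⟨hbX, hbf⟩ := accelerated_bound_of_increasing_weights hf hX hXD (n := n + 1)
    (fun j hj => hxh j (by omega)) (fun j hj => huD j (by omega)) hu n (by omega) b
    (by rw [hb, hsum1])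
  set S : ℝ := (n + 1) * (1 + τ) * ((1 + τ) / τ) ^ m with hS
  have hSpos : 0 < S := by positivity
  -- The surplus weight of the first phase; it is nonnegative because `n ≥ 2 τ`.
  set M : ℝ := ((n : ℝ) + 1) * (n + 2) / 2 - (n + 1) * (1 + τ) with hM
  have hM0 : 0 ≤ M := by rw [hM]; nlinarith
  set y' : E := S⁻¹ • (∑ j ∈ Finset.range (n + 1 + m), β (j + 1) • xh (j + 1) - M • b) with hy'def
  have hy' : S • y' = ∑ j ∈ Finset.range (n + 1 + m), β (j + 1) • xh (j + 1) - M • b :=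
    smul_inv_smul₀ hSpos.ne' _
  obtain ⟨hyX, hyf⟩ := accelerated_bound_of_geometric_weights hf hX hXD hτ hxh huD hu hβ hβ' hu' hb
    hbX m le_rfl y' hy'
  have hsumβ : ∀ i : ℕ, ∑ j ∈ Finset.range (n + 1 + i), β (j + 1)
      = (n + 1) * (1 + τ) * ((1 + τ) / τ) ^ i + M := by
    intro i
    induction i with
    | zero =>
      have h1 : ∑ j ∈ Finset.range (n + 1), β (j + 1) = ∑ j ∈ Finset.range (n + 1), ((j : ℝ) + 1) :=
        Finset.sum_congr rfl fun j hj => by rw [hβ j (Finset.mem_range.1 hj)]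
      have h2 : ∀ n : ℕ, ∑ j ∈ Finset.range (n + 1), ((j : ℝ) + 1) = ((n : ℝ) + 1) * (n + 2) / 2 := by
        intro n
        induction n with
        | zero => simp
        | succ n ih => rw [Finset.sum_range_succ, ih]; push_cast; ring
      rw [add_zero, h1, h2, hM]
      ring
    | succ i ih =>
      rw [← add_assoc, Finset.sum_range_succ, ih, show n + 1 + i + 1 = n + 1 + (i + 1) by ring, hβ',
        pow_succ]
      field_simp
      ring
  have hB := hsumβ m
  -- convexity: `y` is a convex combination of `y'` and `b`
  have hcv : (S + M) * f y ≤ S * f y' + M * f b := by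
    have hSM : 0 < S + M := by linarith
    rw [hB, ← hS] at hy
    have e : y = (S / (S + M)) • y' + (M / (S + M)) • b := by
        rw [div_eq_inv_mul, div_eq_inv_mul, mul_smul _ S, mul_smul _ M, ← smul_add, hy', sub_add_cancel, ← hy,
        inv_smul_smul₀ hSM.ne']
    have h1 := hf.convexOn.2 (hXD hyX) (hXD hbX) (show 0 ≤ S / (S + M) by positivity)
      (show 0 ≤ M / (S + M) by positivity) (by field_simp)
    rw [← e] at h1
    have h2 := mul_le_mul_of_nonneg_left h1 hSM.le
    refine h2.trans (le_of_eq ?_)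
    simp only [smul_eq_mul]
    field_simp
  -- The lower bound on `n` gives `ω ≥ 0`, the upper one `ω ≤ 1`. This is what the choice of `Δ`
  -- provides.
  set ω : ℝ := (n + 1) - 2 * (n + 1) * (1 + τ) / (n + 2) with hω
  have hω0 : 0 ≤ ω := by
    rw [hω, sub_nonneg, div_le_iff₀ (by positivity)]; nlinarith
  have hω1 : ω ≤ 1 := by
    rw [hω, sub_le_iff_le_add, ← sub_le_iff_le_add', le_div_iff₀ (by positivity)]; nlinarith
  set dn : ℝ := ‖xh (n + 1) - xl n‖ ^ 2 with hdn
  have hdn0 : 0 ≤ dn := by positivity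
  have hquad : ∀ j ∈ Finset.range m, L / (2 * ((n + 1) * (1 + τ) * ((1 + τ) / τ) ^ (j + 1)))
          * ‖β (n + 1 + j + 1) • (xh (n + 1 + j + 1) - xl (n + 1 + j)) - ω • (xh (n + 1) - xl n)‖ ^ 2
      ≤ L / (1 + τ) * β (n + 1 + j + 1) * ‖xh (n + 1 + j + 1) - xl (n + 1 + j)‖ ^ 2
        + L * dn / (1 + τ) * (τ / (1 + τ)) ^ (j + 1) := by
    intro j _
    rw [show β (n + 1 + j + 1) = (n + 1) * ((1 + τ) / τ) ^ (j + 1) from hβ' (j + 1)]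
    exact overshoot_quadratic_le hL hτ (by nlinarith) _ _ j
  have hquadsum : ∑ j ∈ Finset.range m, L * dn / (1 + τ) * (τ / (1 + τ)) ^ (j + 1) ≤ L * dn := by
    rw [← Finset.mul_sum]
    have h1 := mul_le_mul_of_nonneg_left (sum_pow_div_one_add_le hτ m)
      (show 0 ≤ L * dn / (1 + τ) by positivity)
    refine h1.trans ?_
    rw [div_mul_eq_mul_div, div_le_iff₀ (by positivity)]
    nlinarith [mul_nonneg hL hdn0]
  -- The first phase uses at most `L` of the available `2 * L`; the unused `L` at the index `n` pays
  -- for the overshoot of the whole second phase.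
  have hphase1 : ∑ i ∈ Finset.range (n + 1),
      (((i : ℝ) + 1) * (f (u (i + 1)) + ⟪g (u (i + 1)), xh (i + 1) - u (i + 1)⟫_ℝ)
        + L * ((i + 1) / (i + 2)) * ‖xh (i + 1) - xl i‖ ^ 2) + L * dn
      ≤ ∑ j ∈ Finset.range (n + 1),
      (β (j + 1) * (f (u (j + 1)) + ⟪g (u (j + 1)), xh (j + 1) - u (j + 1)⟫_ℝ)
        + (if j < n + 1 then 2 * L else L / (1 + τ) * β (j + 1)) * ‖xh (j + 1) - xl j‖ ^ 2) := by
    have hfrac : ∀ i : ℕ, L * (((i : ℝ) + 1) / (i + 2)) ≤ L := by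
      intro i
      have : ((i : ℝ) + 1) / (i + 2) ≤ 1 := by rw [div_le_one (by positivity)]; linarith
      nlinarith
    rw [Finset.sum_range_succ, Finset.sum_range_succ _ n]
    have h1 : ∑ i ∈ Finset.range n,
        (((i : ℝ) + 1) * (f (u (i + 1)) + ⟪g (u (i + 1)), xh (i + 1) - u (i + 1)⟫_ℝ)
          + L * ((i + 1) / (i + 2)) * ‖xh (i + 1) - xl i‖ ^ 2) ≤ ∑ j ∈ Finset.range n,
        (β (j + 1) * (f (u (j + 1)) + ⟪g (u (j + 1)), xh (j + 1) - u (j + 1)⟫_ℝ)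
          + (if j < n + 1 then 2 * L else L / (1 + τ) * β (j + 1)) * ‖xh (j + 1) - xl j‖ ^ 2) := by
      refine Finset.sum_le_sum fun i hi => ?_
      have hi := Finset.mem_range.1 hi
      rw [if_pos (by omega), hβ i (by omega)]
      have := mul_le_mul_of_nonneg_right (show L * (((i : ℝ) + 1) / (i + 2)) ≤ 2 * L by
        linarith [hfrac i]) (sq_nonneg ‖xh (i + 1) - xl i‖)
      linarith
    have h2 := mul_le_mul_of_nonneg_right (hfrac n) hdn0
    rw [if_pos (by omega), hβ n (by omega), ← hdn]
    linarith
  have hphase2 : ∑ j ∈ Finset.range m, (β (n + 1 + j + 1) * (f (u (n + 1 + j + 1))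
          + ⟪g (u (n + 1 + j + 1)), xh (n + 1 + j + 1) - u (n + 1 + j + 1)⟫_ℝ)
        + L / (2 * ((n + 1) * (1 + τ) * ((1 + τ) / τ) ^ (j + 1)))
          * ‖β (n + 1 + j + 1) • (xh (n + 1 + j + 1) - xl (n + 1 + j))
            - ω • (xh (n + 1) - xl n)‖ ^ 2)
      ≤ ∑ j ∈ Finset.range m, (β (n + 1 + j + 1) * (f (u (n + 1 + j + 1))
          + ⟪g (u (n + 1 + j + 1)), xh (n + 1 + j + 1) - u (n + 1 + j + 1)⟫_ℝ)
        + (if n + 1 + j < n + 1 then 2 * L else L / (1 + τ) * β (n + 1 + j + 1))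
          * ‖xh (n + 1 + j + 1) - xl (n + 1 + j)‖ ^ 2) + L * dn := by
    refine le_trans ?_ (add_le_add_right hquadsum _)
    rw [← Finset.sum_add_distrib]
    refine Finset.sum_le_sum fun j hj => ?_
    rw [if_neg (by omega)]
    linarith [hquad j hj]
  rw [Finset.sum_range_add (fun j => β (j + 1) * (f (u (j + 1))
    + ⟪g (u (j + 1)), xh (j + 1) - u (j + 1)⟫_ℝ)
    + (if j < n + 1 then 2 * L else L / (1 + τ) * β (j + 1)) * ‖xh (j + 1) - xl j‖ ^ 2), hB, ← hS]
  have hSb : (n + 1) * (1 + τ) * f b + M * f b = ((n : ℝ) + 1) * (n + 2) / 2 * f b := by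
    rw [hM]; ring
  linarith

end AcceleratedGradient

namespace SPDS

/-! ### The parameters satisfy the step conditions, and their weights match the rate. -/

section Parameters

variable {L μ R c a : ℝ} {N : ℕ}

theorem tauC_pos (hL : 0 < L) (hμ : 0 < μ) : 0 < tauC L μ := by
  unfold tauC; positivity

theorem mul_tauC_sq (hL : 0 < L) (hμ : 0 < μ) : μ * tauC L μ ^ 2 = 4 * L := by
  rw [tauC, mul_pow, Real.sq_sqrt (by positivity)]; field_simp; norm_num

theorem lamC_pos (hL : 0 < L) (hμ : 0 < μ) : 0 < lamC L μ := by
  have := tauC_pos hL hμ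
  unfold lamC; positivity

theorem lamC_lt_one (hL : 0 < L) (hμ : 0 < μ) : lamC L μ < 1 := by
  have := tauC_pos hL hμ
  rw [lamC, div_lt_one (by positivity)]; linarith

theorem inv_lamC (L μ : ℝ) : (lamC L μ)⁻¹ = (1 + tauC L μ) / tauC L μ := by
  rw [lamC, inv_div]

theorem le_DeltaC (L μ : ℝ) : 2 * tauC L μ + 1 ≤ DeltaC L μ := Nat.le_ceil _

theorem DeltaC_lt (hL : 0 < L) (hμ : 0 < μ) : (DeltaC L μ : ℝ) < 2 * tauC L μ + 2 := by
  have := Nat.ceil_lt_add_one (a := 2 * tauC L μ + 1) (by have := tauC_pos hL hμ; positivity)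
  rw [DeltaC]; linarith

/-- Counting iterations from zero, `n` is the last index of the first phase; its two bounds are
those required by `accelerated_bound_two_phases`. -/
theorem exists_DeltaC_eq (hL : 0 < L) (hμ : 0 < μ) :
    ∃ n : ℕ, DeltaC L μ = n + 1 ∧ 2 * tauC L μ ≤ n ∧ (n : ℝ) ≤ 2 * tauC L μ + 1 ∧ 1 ≤ n := by
  have h0 := tauC_pos hL hμ
  have h1 := le_DeltaC L μ
  have h2 := DeltaC_lt hL hμ
  have h3 : 1 < DeltaC L μ := by
    have : (1 : ℝ) < DeltaC L μ := by linarith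
    exact_mod_cast this
  refine ⟨DeltaC L μ - 1, by omega, ?_, ?_, by omega⟩ <;>
  · rw [Nat.cast_sub h3.le]; push_cast; linarith

theorem beforeDelta_iff (hμ : 0 < μ) (k : ℕ) : BeforeDelta L μ k ↔ k ≤ DeltaC L μ := by
  simp [BeforeDelta, hμ.ne']

theorem lamC_rpow_neg (hL : 0 < L) (hμ : 0 < μ) (i : ℕ) :
    lamC L μ ^ (-(i : ℝ)) = ((1 + tauC L μ) / tauC L μ) ^ i := by
  rw [Real.rpow_neg (lamC_pos hL hμ).le, Real.rpow_natCast, ← inv_pow, inv_lamC]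

theorem BeforeDelta.mono {j k : ℕ} (h : BeforeDelta L μ k) (hjk : j ≤ k) : BeforeDelta L μ j :=
  h.imp id hjk.trans

theorem betaK_of_before {k : ℕ} (h : BeforeDelta L μ k) : betaK L μ k = k := if_pos h

/-- The case `i = 0` belongs to the first phase: both formulas for the weights agree at `Δ`. -/
theorem betaK_DeltaC_add (hL : 0 < L) (hμ : 0 < μ) (i : ℕ) :
    betaK L μ (DeltaC L μ + i) = DeltaC L μ * ((1 + tauC L μ) / tauC L μ) ^ i := by
  rcases Nat.eq_zero_or_pos i with rfl | hi
  · rw [betaK_of_before ((beforeDelta_iff hμ _).2 (by omega))]; simp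
  · rw [betaK, if_neg (by rw [beforeDelta_iff hμ]; omega), ← lamC_rpow_neg hL hμ]
    push_cast
    rw [add_sub_cancel_left]

theorem pK_of_before {k : ℕ} (h : BeforeDelta L μ k) : pK L μ k = 4 * L / k := if_pos h

theorem pK_of_not_before {k : ℕ} (h : ¬ BeforeDelta L μ k) :
    pK L μ k = 2 * L / (1 + tauC L μ) := if_neg h

theorem not_before_iff (hμ0 : 0 ≤ μ) {k : ℕ} :
    ¬ BeforeDelta L μ k ↔ 0 < μ ∧ ∃ i, k = DeltaC L μ + (i + 1) := by
  rcases hμ0.eq_or_lt with h | h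
  · simp [BeforeDelta, h.symm]
  · rw [beforeDelta_iff h]
    constructor
    · intro hk; exact ⟨h, k - DeltaC L μ - 1, by omega⟩
    · rintro ⟨_, i, rfl⟩; omega

theorem betaK_pos (hL : 0 < L) (hμ : 0 ≤ μ) {k : ℕ} (hk : 1 ≤ k) : 0 < betaK L μ k := by
  by_cases h : BeforeDelta L μ k
  · rw [betaK_of_before h]; exact_mod_cast hk
  · obtain ⟨hμ', i, rfl⟩ := (not_before_iff hμ).1 h
    have := tauC_pos hL hμ'
    have := le_DeltaC L μ
    rw [betaK_DeltaC_add hL hμ']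
    have : (0 : ℝ) < DeltaC L μ := by linarith
    positivity

theorem pK_pos (hL : 0 < L) (hμ : 0 ≤ μ) {k : ℕ} (hk : 1 ≤ k) : 0 < pK L μ k := by
  have hk0 : (0 : ℝ) < k := by exact_mod_cast hk
  by_cases h : BeforeDelta L μ k
  · rw [pK_of_before h]; positivity
  · obtain ⟨hμ', -⟩ := (not_before_iff hμ).1 h
    have := tauC_pos hL hμ'
    rw [pK_of_not_before h]; positivity

theorem betaK_mul_pK_of_before {k : ℕ} (hk : 1 ≤ k) (h : BeforeDelta L μ k) :
    betaK L μ k * pK L μ k = 4 * L := by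
  have hk0 : (0 : ℝ) < k := by exact_mod_cast hk
  rw [betaK_of_before h, pK_of_before h]; field_simp

theorem before_one (hL : 0 < L) (hμ : 0 ≤ μ) : BeforeDelta L μ 1 := by
  rcases hμ.eq_or_lt with h | h
  · exact Or.inl h.symm
  · obtain ⟨n, hn, -⟩ := exists_DeltaC_eq hL h
    exact Or.inr (by omega)

theorem le_TK_of_before {k : ℕ} (h : BeforeDelta L μ k) : k * R * a / L ≤ TK L μ R a k := by
  rw [TK, if_pos h]; exact Nat.le_ceil _

theorem lamC_rpow_half_sq (hL : 0 < L) (hμ : 0 < μ) (i : ℕ) :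
    (lamC L μ ^ ((i : ℝ) / 2)) ^ 2 * ((1 + tauC L μ) / tauC L μ) ^ i = 1 := by
  have h0 := lamC_pos hL hμ
  rw [← Real.rpow_natCast, ← Real.rpow_mul h0.le, ← lamC_rpow_neg hL hμ, ← Real.rpow_add h0]
  push_cast
  rw [show (i : ℝ) / 2 * 2 + -i = 0 by ring, Real.rpow_zero]

theorem le_TK_DeltaC_add (hμ : 0 < μ) (i : ℕ) :
    2 * (1 + tauC L μ) * R * a / (L * lamC L μ ^ (((i + 1 : ℕ) : ℝ) / 2))
      ≤ TK L μ R a (DeltaC L μ + (i + 1)) := by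
  rw [TK, if_neg (by rw [beforeDelta_iff hμ]; omega)]
  refine le_trans (le_of_eq ?_) (Nat.le_ceil _)
  congr 4
  push_cast
  ring

theorem TK_pos (hL : 0 < L) (hμ : 0 ≤ μ) (hR : 0 < R) (ha : 0 < a) {k : ℕ} (hk : 1 ≤ k) :
    1 ≤ TK L μ R a k := by
  have hk0 : (0 : ℝ) < k := by exact_mod_cast hk
  suffices h : (0 : ℝ) < TK L μ R a k by exact_mod_cast h
  by_cases h : BeforeDelta L μ k
  · exact lt_of_lt_of_le (by positivity) (le_TK_of_before h)
  · obtain ⟨hμ', i, rfl⟩ := (not_before_iff hμ).1 h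
    have := tauC_pos hL hμ'
    have := lamC_pos hL hμ'
    exact lt_of_lt_of_le (by positivity) (le_TK_DeltaC_add hμ' i)

/-- In the first phase `β p = 4 L` is constant. With `μ τ² = 4 L`, the claim at the change of phase
is `τ Δ ≤ 2 τ² + Δ`, true since `Δ < 2 τ + 2`; later it is `τ (1 + τ) ≤ τ² + τ + 1`. -/
theorem descent_condition (hL : 0 < L) (hμ : 0 ≤ μ) {k : ℕ} (hk : 1 ≤ k) :
    2 * (betaK L μ (k + 1) * pK L μ (k + 1)) ≤ betaK L μ k * (2 * pK L μ k + μ) := by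
  have hk0 : (0 : ℝ) < k := by exact_mod_cast hk
  by_cases h1 : BeforeDelta L μ (k + 1)
  · have h0 : BeforeDelta L μ k := by
      rcases h1 with h | h
      · exact Or.inl h
      · exact Or.inr (by omega)
    have := mul_nonneg hk0.le hμ
    have h2 := betaK_mul_pK_of_before hk h0
    have h3 : betaK L μ k * μ = k * μ := by rw [betaK_of_before h0]
    rw [betaK_mul_pK_of_before (by omega) h1]
    linarith
  · obtain ⟨hμ', i, hi⟩ := (not_before_iff hμ).1 h1
    obtain rfl : k = DeltaC L μ + i := by omega
    have hτ := tauC_pos hL hμ'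
    have hsq := mul_tauC_sq hL hμ'
    have hΔ := le_DeltaC L μ
    have hΔ' := DeltaC_lt hL hμ'
    rw [pK_of_not_before h1, add_assoc, betaK_DeltaC_add hL hμ', betaK_DeltaC_add hL hμ']
    set τ := tauC L μ
    have hL4 : L = μ * τ ^ 2 / 4 := by linarith
    rcases Nat.eq_zero_or_pos i with rfl | hi0
    · have hD : (0 : ℝ) < DeltaC L μ := by linarith
      rw [add_zero, pK_of_before ((beforeDelta_iff hμ' _).2 le_rfl), zero_add, pow_one, pow_zero,
        mul_one]
      have e1 : 2 * (DeltaC L μ * ((1 + τ) / τ) * (2 * L / (1 + τ))) = μ * τ * DeltaC L μ := by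
        field_simp; linarith
      have e2 : (DeltaC L μ : ℝ) * (2 * (4 * L / DeltaC L μ) + μ) = μ * (2 * τ ^ 2 + DeltaC L μ) := by
        field_simp; linarith
      rw [e1, e2, mul_assoc]
      refine mul_le_mul_of_nonneg_left ?_ hμ
      rcases le_or_gt τ 1 with h | h <;> nlinarith
    · have hb : ¬ BeforeDelta L μ (DeltaC L μ + i) := by rw [beforeDelta_iff hμ']; omega
      rw [pK_of_not_before hb]
      have e1 : 2 * (DeltaC L μ * ((1 + τ) / τ) ^ (i + 1) * (2 * L / (1 + τ)))
          = DeltaC L μ * ((1 + τ) / τ) ^ i * (μ * τ) := by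
        rw [pow_succ]
        generalize ((1 + τ) / τ) ^ i = r
        field_simp
        linear_combination (-(DeltaC L μ : ℝ) * r) * hsq
      rw [e1]
      refine mul_le_mul_of_nonneg_left ?_ (by positivity)
      have e2 : 2 * (2 * L / (1 + τ)) + μ = μ * (τ ^ 2 + τ + 1) / (1 + τ) := by
        rw [hL4]; field_simp; ring
      rw [e2, le_div_iff₀ (by positivity)]
      nlinarith

/-- Rounding `T_k` up only helps. The unrounded value gives equality in the first phase and reduces
the claim to `Δ ≤ 2 (1 + τ)` in the second. -/
theorem norm_sq_condition (hL : 0 < L) (hμ : 0 ≤ μ) (hR : 0 < R) (ha : 0 < a) {k : ℕ} (hk : 1 ≤ k) :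
    a ^ 2 * betaK L μ k ≤ pK L μ k * TK L μ R a k ^ 2 * (L / (4 * R ^ 2)) := by
  have hk0 : (0 : ℝ) < k := by exact_mod_cast hk
  by_cases h : BeforeDelta L μ k
  · have h1 := pow_le_pow_left₀ (by positivity) (le_TK_of_before (R := R) (a := a) h) 2
    rw [betaK_of_before h, pK_of_before h]
    have h2 := mul_le_mul_of_nonneg_left h1 (show 0 ≤ 4 * L / k * (L / (4 * R ^ 2)) by positivity)
    refine (le_of_eq ?_).trans (h2.trans (le_of_eq (by ring)))
    field_simp
  · obtain ⟨hμ', i, rfl⟩ := (not_before_iff hμ).1 h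
    have hτ := tauC_pos hL hμ'
    have hlam := lamC_pos hL hμ'
    have hΔ' := DeltaC_lt hL hμ'
    have h1 := pow_le_pow_left₀ (by positivity) (le_TK_DeltaC_add (L := L) (R := R) (a := a) hμ' i) 2
    rw [betaK_DeltaC_add hL hμ', pK_of_not_before h]
    have hsq := lamC_rpow_half_sq hL hμ' (i + 1)
    set τ := tauC L μ
    have h2 := mul_le_mul_of_nonneg_left h1
      (show 0 ≤ 2 * L / (1 + τ) * (L / (4 * R ^ 2)) by positivity)
    set s := lamC L μ ^ (((i + 1 : ℕ) : ℝ) / 2) with hs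
    have hs0 : 0 < s := by positivity
    set r := ((1 + τ) / τ) ^ (i + 1) with hr
    have hr0 : 0 < r := by positivity
    have hr' : r = (s ^ 2)⁻¹ := (eq_inv_of_mul_eq_one_right hsq)
    have e : 2 * L / (1 + τ) * (L / (4 * R ^ 2)) * (2 * (1 + τ) * R * a / (L * s)) ^ 2
        = a ^ 2 * ((2 * τ + 2) * r) := by
      rw [hr']; field_simp; ring
    rw [e] at h2
    refine le_trans ?_ (h2.trans (le_of_eq (by ring)))
    exact mul_le_mul_of_nonneg_left (mul_le_mul_of_nonneg_right hΔ'.le hr0.le) (by positivity)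

theorem stepConditions_params (hL : 0 < L) (hμ : 0 ≤ μ) (hR : 0 < R) (ha : 0 < a) (c : ℝ) (N : ℕ) :
    StepConditions μ (params L μ R c a N).beta (params L μ R c a N).p (params L μ R c a N).T
      (L / (4 * R ^ 2)) a N where
  Q_pos := by positivity
  μ_nonneg := hμ
  β_pos _ hk _ := betaK_pos hL hμ hk
  p_pos _ hk _ := pK_pos hL hμ hk
  T_pos _ hk _ := TK_pos hL hμ hR ha hk
  norm_sq_le _ hk _ := norm_sq_condition hL hμ hR ha hk
  descent _ hk _ := descent_condition hL hμ hk

/-! ### The batch sizes and the rate -/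

theorem sum_range_succ_cast (n : ℕ) : ∑ j ∈ Finset.range n, ((j : ℝ) + 1) = (n : ℝ) * (n + 1) / 2 := by
  induction n with
  | zero => simp
  | succ n ih => rw [Finset.sum_range_succ, ih]; push_cast; ring

theorem sum_betaK_of_before (h : BeforeDelta L μ N) :
    ∑ j ∈ Finset.range N, betaK L μ (j + 1) = (N : ℝ) * (N + 1) / 2 := by
  rw [← sum_range_succ_cast]
  refine Finset.sum_congr rfl fun j hj => ?_
  have hj := Finset.mem_range.1 hj
  have : BeforeDelta L μ (j + 1) := by
    rcases h with h | h
    · exact Or.inl h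
    · exact Or.inr (by omega)
  rw [betaK_of_before this]
  push_cast
  ring

theorem sum_betaK_DeltaC_add (hL : 0 < L) (hμ : 0 < μ) (n : ℕ) :
    ∑ j ∈ Finset.range (DeltaC L μ + n), betaK L μ (j + 1)
      = (DeltaC L μ : ℝ) * (DeltaC L μ + 1) / 2
        + DeltaC L μ * (1 + tauC L μ) * (((1 + tauC L μ) / tauC L μ) ^ n - 1) := by
  have hτ := tauC_pos hL hμ
  induction n with
  | zero =>
    rw [add_zero, sum_betaK_of_before ((beforeDelta_iff hμ _).2 le_rfl)]; simp
  | succ n ih =>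
    rw [← add_assoc, Finset.sum_range_succ, ih, add_assoc (DeltaC L μ), betaK_DeltaC_add hL hμ, pow_succ]
    field_simp
    ring

theorem one_add_pow_ge (x : ℝ) (hx : 0 ≤ x) (n : ℕ) :
    1 + n * x + n * (n - 1) / 2 * x ^ 2 ≤ (1 + x) ^ n := by
  induction n with
  | zero => simp
  | succ n ih =>
    rw [pow_succ]
    have h1 := mul_le_mul_of_nonneg_right ih (show 0 ≤ 1 + x by linarith)
    refine le_trans ?_ h1
    push_cast
    have h2 : 0 ≤ (n : ℝ) * (n - 1) := by
      rcases Nat.eq_zero_or_pos n with rfl | h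
      · simp
      · have : (1 : ℝ) ≤ n := by exact_mod_cast h
        nlinarith
    have h3 : 0 ≤ (n : ℝ) * (n - 1) * x ^ 3 := by positivity
    nlinarith

/-- In the second phase the total weight grows faster than quadratically. -/
theorem sum_betaK_ge (hL : 0 < L) (hμ : 0 < μ) (n : ℕ) :
    (DeltaC L μ : ℝ) ^ 2 + 2 * n * DeltaC L μ + 2 * n ^ 2 + 4 / 3 * n ^ 3 / DeltaC L μ
      ≤ 2 * ∑ j ∈ Finset.range (DeltaC L μ + n), betaK L μ (j + 1) := by
  have hτ := tauC_pos hL hμ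
  have hΔ := le_DeltaC L μ
  have hD : (1 : ℝ) < DeltaC L μ := by linarith
  -- Since `2 τ ≤ Δ`, the ratio of the weights is at least `1 + 2 / Δ`. The second-order binomial
  -- term yields the cubic term of the sum, which the noise estimate needs for `n > Δ`.
  have hβ : ∀ i : ℕ, (DeltaC L μ : ℝ) + 2 * i + 2 * (i * (i - 1)) / DeltaC L μ
      ≤ betaK L μ (DeltaC L μ + i) := by
    intro i
    rw [betaK_DeltaC_add hL hμ]
    have h1 : 1 + 2 / (DeltaC L μ : ℝ) ≤ (1 + tauC L μ) / tauC L μ := by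
      rw [add_div, div_self hτ.ne', add_comm (1 / _)]
      gcongr 1 + ?_
      rw [div_le_div_iff₀ (by linarith) hτ]
      linarith
    have h2 := one_add_pow_ge (2 / (DeltaC L μ : ℝ)) (by positivity) i
    have h3 := pow_le_pow_left₀ (by positivity) h1 i
    have h4 := mul_le_mul_of_nonneg_left (h2.trans h3) (show (0 : ℝ) ≤ DeltaC L μ by linarith)
    refine le_trans (le_of_eq ?_) h4
    field_simp
  induction n with
  | zero =>
    rw [add_zero, sum_betaK_of_before ((beforeDelta_iff hμ _).2 le_rfl)]
    simp
    nlinarith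
  | succ n ih =>
    rw [← add_assoc, Finset.sum_range_succ, mul_add, add_assoc (DeltaC L μ)]
    have h1 := hβ (n + 1)
    have h2 : (DeltaC L μ : ℝ) ^ 2 + 2 * (n + 1 : ℕ) * DeltaC L μ + 2 * (n + 1 : ℕ) ^ 2
        + 4 / 3 * (n + 1 : ℕ) ^ 3 / DeltaC L μ
        ≤ (DeltaC L μ : ℝ) ^ 2 + 2 * n * DeltaC L μ + 2 * n ^ 2 + 4 / 3 * n ^ 3 / DeltaC L μ
          + 2 * ((DeltaC L μ : ℝ) + 2 * (n + 1 : ℕ)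
            + 2 * ((n + 1 : ℕ) * ((n + 1 : ℕ) - 1)) / DeltaC L μ) := by
      push_cast
      have hn : (0 : ℝ) ≤ n := by positivity
      have h3 : 4 / 3 * ((n : ℝ) + 1) ^ 3 / DeltaC L μ = 4 / 3 * n ^ 3 / DeltaC L μ
          + 2 * (2 * ((n + 1) * (n + 1 - 1)) / DeltaC L μ) + 4 / 3 / DeltaC L μ := by
        field_simp
        ring
      have h4 : 4 / 3 / (DeltaC L μ : ℝ) ≤ 4 / 3 := by
        rw [div_le_iff₀ (by linarith)]; linarith
      rw [h3]
      nlinarith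
    linarith

theorem sq_le_two_mul_sum_betaK (hL : 0 < L) (hμ : 0 ≤ μ) :
    (N : ℝ) ^ 2 ≤ 2 * ∑ j ∈ Finset.range N, betaK L μ (j + 1) := by
  rcases Nat.eq_zero_or_pos N with rfl | hN
  · simp
  by_cases h : BeforeDelta L μ N
  · rw [sum_betaK_of_before h]
    have : (0 : ℝ) ≤ N := by positivity
    nlinarith
  · obtain ⟨hμ', i, rfl⟩ := (not_before_iff hμ).1 h
    have h1 := sum_betaK_ge hL hμ' (i + 1)
    have h2 : (0 : ℝ) ≤ 4 / 3 * (i + 1 : ℕ) ^ 3 / DeltaC L μ := by positivity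
    rw [Nat.cast_add]
    nlinarith [sq_nonneg ((i + 1 : ℕ) : ℝ)]

/-- The product is at least `Δ (1 + τ)`. The value `2` instead of `1` leaves room for the noise,
whose total is bounded by `4/3` in these units. -/
theorem two_le_sum_betaK_mul_pow (hL : 0 < L) (hμ : 0 < μ) (n : ℕ) :
    2 ≤ (∑ j ∈ Finset.range (DeltaC L μ + n), betaK L μ (j + 1))
      * lamC L μ ^ (((DeltaC L μ + n : ℕ) : ℝ) - DeltaC L μ) := by
  have hτ := tauC_pos hL hμ
  have hΔ := le_DeltaC L μ
  obtain ⟨n', hn', -, -, hn1⟩ := exists_DeltaC_eq hL hμ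
  have hΔ2 : (2 : ℝ) ≤ DeltaC L μ := by rw [hn']; exact_mod_cast (by omega : 2 ≤ n' + 1)
  have hlam := lamC_pos hL hμ
  rw [sum_betaK_DeltaC_add hL hμ, Nat.cast_add, add_sub_cancel_left, Real.rpow_natCast]
  have h1 : ((1 + tauC L μ) / tauC L μ) ^ n * lamC L μ ^ n = 1 := by
    rw [← mul_pow, ← inv_lamC, inv_mul_cancel₀ hlam.ne', one_pow]
  have h2 : 0 ≤ lamC L μ ^ n := by positivity
  have h3 : 0 ≤ (DeltaC L μ : ℝ) * (DeltaC L μ + 1) / 2 - DeltaC L μ * (1 + tauC L μ) := by nlinarith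
  calc (2 : ℝ) ≤ DeltaC L μ * (1 + tauC L μ) := by nlinarith
    _ = DeltaC L μ * (1 + tauC L μ) * (((1 + tauC L μ) / tauC L μ) ^ n * lamC L μ ^ n) := by
      rw [h1, mul_one]
    _ ≤ _ := by nlinarith [mul_nonneg h3 h2]

theorem le_sum_betaK_mul_rate (hμ : 0 ≤ μ) (hN : 1 ≤ N) {y : ℝ}
    (h1 : y * N ^ 2 ≤ 2 * ∑ j ∈ Finset.range N, betaK L μ (j + 1))
    (h2 : 0 < μ → y ≤ (∑ j ∈ Finset.range N, betaK L μ (j + 1))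
      * lamC L μ ^ ((N : ℝ) - DeltaC L μ)) :
    y ≤ (∑ j ∈ Finset.range N, betaK L μ (j + 1)) * rate L μ N := by
  have hN0 : (0 : ℝ) < N := by exact_mod_cast hN
  have h3 : y ≤ (∑ j ∈ Finset.range N, betaK L μ (j + 1)) * (2 / (N : ℝ) ^ 2) := by
    rw [mul_div_assoc', le_div_iff₀ (by positivity)]; linarith
  rcases hμ.eq_or_lt with h | h
  · rw [rate, if_pos h.symm]; exact h3
  · rw [rate, if_neg h.ne']
    rcases min_choice (2 / (N : ℝ) ^ 2) (lamC L μ ^ ((N : ℝ) - DeltaC L μ)) with e | e <;> rw [e]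
    · exact h3
    · exact h2 h

theorem one_le_sum_betaK_mul_rate (hL : 0 < L) (hμ : 0 ≤ μ) (hN : 1 ≤ N) :
    1 ≤ (∑ j ∈ Finset.range N, betaK L μ (j + 1)) * rate L μ N := by
  have hsq := sq_le_two_mul_sum_betaK (N := N) hL hμ
  refine le_sum_betaK_mul_rate hμ hN (by linarith) fun hμ' => ?_
  by_cases h : BeforeDelta L μ N
  · have h1 : 1 ≤ lamC L μ ^ ((N : ℝ) - DeltaC L μ) := by
      refine Real.one_le_rpow_of_pos_of_le_one_of_nonpos (lamC_pos hL hμ') (lamC_lt_one hL hμ').le ?_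
      rw [beforeDelta_iff hμ'] at h
      rw [sub_nonpos]; exact_mod_cast h
    have h2 : 1 ≤ ∑ j ∈ Finset.range N, betaK L μ (j + 1) := by
      rw [sum_betaK_of_before h]
      have : (1 : ℝ) ≤ N := by exact_mod_cast hN
      nlinarith
    nlinarith
  · obtain ⟨_, i, rfl⟩ := (not_before_iff hμ).1 h
    linarith [two_le_sum_betaK_mul_pow hL hμ' (i + 1)]

theorem minNDelta_of_before (h : BeforeDelta L μ N) : minNDelta L μ N = N := by
  unfold minNDelta
  split_ifs with h0
  · rfl
  · exact min_eq_left (h.resolve_left h0)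

theorem minNDelta_DeltaC_add (hμ : 0 < μ) (n : ℕ) : minNDelta L μ (DeltaC L μ + n) = DeltaC L μ := by
  rw [minNDelta, if_neg hμ.ne', min_eq_right (by omega)]

theorem minNDelta_pos (hL : 0 < L) (hμ : 0 ≤ μ) (hN : 1 ≤ N) : 1 ≤ minNDelta L μ N := by
  unfold minNDelta
  split_ifs with h
  · exact hN
  · obtain ⟨n, hn, -⟩ := exists_DeltaC_eq hL (hμ.lt_of_ne (Ne.symm h))
    exact le_min hN (by omega)

theorem le_cK_of_before {k : ℕ} (h : BeforeDelta L μ k) :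
    minNDelta L μ N * betaK L μ k * c / (pK L μ k * L) ≤ cK L μ c N k := by
  rw [cK, if_pos h]; exact Nat.le_ceil _

theorem le_cK_DeltaC_add (hμ : 0 < μ) (i n : ℕ) :
    (1 + tauC L μ) ^ 2 * DeltaC L μ * c
        / (L ^ 2 * lamC L μ ^ (((i + 1 : ℕ) : ℝ) / 2 + (n : ℝ) / 2))
      ≤ cK L μ c (DeltaC L μ + n) (DeltaC L μ + (i + 1)) := by
  rw [cK, if_neg (by rw [beforeDelta_iff hμ]; omega)]
  refine le_trans (le_of_eq ?_) (Nat.le_ceil _)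
  congr 3
  push_cast
  ring

theorem cK_pos (hL : 0 < L) (hμ : 0 ≤ μ) (hc : 0 < c) (hN : 1 ≤ N) {k : ℕ} (hk : 1 ≤ k) :
    1 ≤ cK L μ c N k := by
  have hk0 : (0 : ℝ) < k := by exact_mod_cast hk
  have hN0 : (0 : ℝ) < N := by exact_mod_cast hN
  suffices h : (0 : ℝ) < cK L μ c N k by exact_mod_cast h
  by_cases h : BeforeDelta L μ k
  · have h1 : (0 : ℝ) < minNDelta L μ N := by exact_mod_cast minNDelta_pos hL hμ hN
    have h2 := betaK_pos hL hμ hk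
    have h3 := pK_pos hL hμ hk
    exact lt_of_lt_of_le (by positivity) (le_cK_of_before h)
  · obtain ⟨hμ', i, rfl⟩ := (not_before_iff hμ).1 h
    have := tauC_pos hL hμ'
    have := lamC_pos hL hμ'
    have := le_DeltaC L μ
    have : (0 : ℝ) < DeltaC L μ := by linarith
    rw [cK, if_neg h]
    exact lt_of_lt_of_le (by positivity) (Nat.le_ceil _)

/-- The batch sizes give all iterations of the first phase the same bound on their noise, one share
in `min {N, Δ}`. -/
theorem noise_term_le_of_before (hL : 0 < L) (hμ : 0 ≤ μ) (hc : 0 < c) (hN : 1 ≤ N) {k : ℕ}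
    (hk : 1 ≤ k) (h : BeforeDelta L μ k) :
    betaK L μ k * (2 / 3 / (pK L μ k * cK L μ c N k)) ≤ 2 / 3 * (L / c) / minNDelta L μ N := by
  have h1 : (0 : ℝ) < minNDelta L μ N := by exact_mod_cast minNDelta_pos hL hμ hN
  have h2 := betaK_pos hL hμ hk
  have h3 := pK_pos hL hμ hk
  have h4 := le_cK_of_before (N := N) (c := c) h
  have h5 : (0 : ℝ) < cK L μ c N k := by exact_mod_cast cK_pos hL hμ hc hN hk
  rw [div_le_iff₀ (by positivity)] at h4
  have h6 : 2 / 3 * (L / c) / minNDelta L μ N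
      = 2 / 3 * (cK L μ c N k * (pK L μ k * L)) / (c * pK L μ k * minNDelta L μ N * cK L μ c N k) := by
    field_simp
  rw [h6, le_div_iff₀ (by positivity)]
  refine le_trans (le_of_eq ?_) (mul_le_mul_of_nonneg_left h4 (by norm_num))
  field_simp

/-- In the second phase the weights grow like `λ⁻¹` and the batch sizes like `λ^(-1/2)` per
iteration, so the bounds increase geometrically towards the last iteration. -/
theorem noise_term_le_of_after (hL : 0 < L) (hμ : 0 < μ) (hc : 0 < c) {i n : ℕ} (hi : i < n) :
    betaK L μ (DeltaC L μ + (i + 1)) * (2 / 3 / (pK L μ (DeltaC L μ + (i + 1))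
        * cK L μ c (DeltaC L μ + n) (DeltaC L μ + (i + 1))))
      ≤ 2 / 3 * (L / c) / (2 * (1 + tauC L μ)) * (lamC L μ ^ (1 / 2 : ℝ)) ^ (n - 1 - i) := by
  have hτ := tauC_pos hL hμ
  have hlam := lamC_pos hL hμ
  have hD : (0 : ℝ) < DeltaC L μ := by linarith [le_DeltaC L μ]
  have h1 := le_cK_DeltaC_add (L := L) (c := c) hμ i n
  have hb : ¬ BeforeDelta L μ (DeltaC L μ + (i + 1)) := by rw [beforeDelta_iff hμ]; omega
  rw [pK_of_not_before hb, betaK_DeltaC_add hL hμ]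
  have hpos : (0 : ℝ) < (1 + tauC L μ) ^ 2 * DeltaC L μ * c
        / (L ^ 2 * lamC L μ ^ (((i + 1 : ℕ) : ℝ) / 2 + (n : ℝ) / 2)) := by positivity
  have hsq := lamC_rpow_half_sq hL hμ (i + 1)
  set r := ((1 + tauC L μ) / tauC L μ) ^ (i + 1) with hr
  set s := lamC L μ ^ (((i + 1 : ℕ) : ℝ) / 2) with hs
  have hs0 : 0 < s := by positivity
  have hr' : r = (s ^ 2)⁻¹ := (eq_inv_of_mul_eq_one_right hsq)
  have hpow : (lamC L μ ^ (1 / 2 : ℝ)) ^ (n - 1 - i) = lamC L μ ^ ((n : ℝ) / 2) / s := by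
    rw [hs, ← Real.rpow_sub hlam, ← Real.rpow_natCast, ← Real.rpow_mul hlam.le]
    congr 1
    rw [Nat.cast_sub (by omega), Nat.cast_sub (by omega)]
    push_cast
    ring
  rw [Real.rpow_add hlam, ← hs] at h1 hpos
  rw [hpow, hr']
  have hln : 0 < lamC L μ ^ ((n : ℝ) / 2) := by positivity
  generalize lamC L μ ^ ((n : ℝ) / 2) = w at *
  calc _ ≤ DeltaC L μ * (s ^ 2)⁻¹ * (2 / 3 / (2 * L / (1 + tauC L μ)
        * ((1 + tauC L μ) ^ 2 * DeltaC L μ * c / (L ^ 2 * (s * w))))) := by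
        gcongr
    _ = _ := by
        field_simp

/-- A geometric sum, at most `1 / (1 - √λ) ≤ 2 / (1 - λ) = 2 (1 + τ)`. -/
theorem sum_rpow_half_lamC_pow_le (hL : 0 < L) (hμ : 0 < μ) (n : ℕ) :
    ∑ j ∈ Finset.range n, (lamC L μ ^ (1 / 2 : ℝ)) ^ (n - 1 - j) ≤ 2 * (1 + tauC L μ) := by
  have hτ := tauC_pos hL hμ
  have hlam := lamC_pos hL hμ
  set t := lamC L μ ^ (1 / 2 : ℝ) with ht
  have ht0 : 0 < t := by positivity
  have htsq : t ^ 2 = lamC L μ := by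
    rw [ht, ← Real.rpow_natCast, ← Real.rpow_mul hlam.le]; norm_num
  have ht1 : t < 1 := by
    have := lamC_lt_one hL hμ
    nlinarith
  have hgeom : (1 - t) * ∑ j ∈ Finset.range n, t ^ (n - 1 - j) ≤ 1 := by
    rw [Finset.sum_range_reflect (fun j => t ^ j) n, mul_neg_geom_sum]
    linarith [pow_pos ht0 n]
  have h1 : (1 - t) * (2 * (1 + tauC L μ)) = 2 * (1 - t) * (1 + tauC L μ) := by ring
  have h2 : (1 - lamC L μ) * (1 + tauC L μ) = 1 := by unfold lamC; field_simp; ring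
  have h3 : 1 - lamC L μ ≤ 2 * (1 - t) := by rw [← htsq]; nlinarith
  have h4 : 1 ≤ (1 - t) * (2 * (1 + tauC L μ)) := by
    rw [h1]; exact h2.symm.le.trans (mul_le_mul_of_nonneg_right h3 (by positivity))
  exact le_of_mul_le_mul_left (hgeom.trans h4) (by linarith)

/-- In units of `L / c` the first phase contributes at most `2/3` and the second at most `2/3 x`,
where `x ≤ min {1, n / Δ}` by the two bounds on the geometric sum. Since the rate is a minimum, the
total must be compared both with `Σ β / N²` and with `Σ β λ^n`. -/
theorem noise_weight_le (hL : 0 < L) (hμ : 0 ≤ μ) (hc : 0 < c) (hN : 1 ≤ N) :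
    ∑ j ∈ Finset.range N, betaK L μ (j + 1) * (2 / 3 / (pK L μ (j + 1) * cK L μ c N (j + 1)))
      ≤ (∑ j ∈ Finset.range N, betaK L μ (j + 1)) * rate L μ N * (L / c) := by
  have hLc : 0 < L / c := by positivity
  by_cases h : BeforeDelta L μ N
  · have hm := minNDelta_of_before h
    have hN0 : (0 : ℝ) < N := by exact_mod_cast hN
    calc _ ≤ ∑ j ∈ Finset.range N, 2 / 3 * (L / c) / minNDelta L μ N := by
          refine Finset.sum_le_sum fun j hj => noise_term_le_of_before hL hμ hc hN (by omega) ?_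
          have hj := Finset.mem_range.1 hj
          rcases h with h | h
          · exact Or.inl h
          · exact Or.inr (by omega)
      _ = 2 / 3 * (L / c) := by
          rw [Finset.sum_const, Finset.card_range, nsmul_eq_mul, hm]; field_simp
      _ ≤ _ := by nlinarith [one_le_sum_betaK_mul_rate hL hμ hN]
  · obtain ⟨hμ', i, rfl⟩ := (not_before_iff hμ).1 h
    generalize hn : i + 1 = n at *
    have hτ := tauC_pos hL hμ'
    have hlam := lamC_pos hL hμ'
    have hΔ := le_DeltaC L μ
    have hΔ' := DeltaC_lt hL hμ'
    have hD : (0 : ℝ) < DeltaC L μ := by linarith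
    have hn0 : (0 : ℝ) ≤ n := by positivity
    have hm : (minNDelta L μ (DeltaC L μ + n) : ℝ) = DeltaC L μ := by
      rw [minNDelta_DeltaC_add hμ']
    set t := lamC L μ ^ (1 / 2 : ℝ) with ht
    have ht0 : 0 < t := by positivity
    have ht1 : t ≤ 1 := Real.rpow_le_one hlam.le (lamC_lt_one hL hμ').le (by norm_num)
    have hsum_le_card : ∑ j ∈ Finset.range n, t ^ (n - 1 - j) ≤ n := by
      refine (Finset.sum_le_sum fun j _ => pow_le_one₀ ht0.le ht1).trans ?_
      simp
    have hsum_le : ∑ j ∈ Finset.range n, t ^ (n - 1 - j) ≤ 2 * (1 + tauC L μ) :=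
      sum_rpow_half_lamC_pow_le hL hμ' n
    have key : ∑ j ∈ Finset.range (DeltaC L μ + n), betaK L μ (j + 1)
        * (2 / 3 / (pK L μ (j + 1) * cK L μ c (DeltaC L μ + n) (j + 1)))
        ≤ 2 / 3 * (1 + (∑ j ∈ Finset.range n, t ^ (n - 1 - j)) / (2 * (1 + tauC L μ))) * (L / c) := by
      rw [Finset.sum_range_add]
      have h1 : ∑ j ∈ Finset.range (DeltaC L μ), betaK L μ (j + 1)
          * (2 / 3 / (pK L μ (j + 1) * cK L μ c (DeltaC L μ + n) (j + 1))) ≤ 2 / 3 * (L / c) := by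
        calc _ ≤ ∑ j ∈ Finset.range (DeltaC L μ), 2 / 3 * (L / c) / DeltaC L μ := by
              refine Finset.sum_le_sum fun j hj => ?_
              rw [← hm]
              exact noise_term_le_of_before hL hμ hc hN (by omega)
                ((beforeDelta_iff hμ' _).2 (by have := Finset.mem_range.1 hj; omega))
          _ = _ := by rw [Finset.sum_const, Finset.card_range, nsmul_eq_mul]; field_simp
      have h2 : ∑ j ∈ Finset.range n, betaK L μ (DeltaC L μ + j + 1)
          * (2 / 3 / (pK L μ (DeltaC L μ + j + 1) * cK L μ c (DeltaC L μ + n) (DeltaC L μ + j + 1)))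
          ≤ ∑ j ∈ Finset.range n, 2 / 3 * (L / c) / (2 * (1 + tauC L μ)) * t ^ (n - 1 - j) :=
        Finset.sum_le_sum fun j hj => noise_term_le_of_after hL hμ' hc (Finset.mem_range.1 hj)
      rw [← Finset.mul_sum] at h2
      refine (add_le_add h1 h2).trans (le_of_eq ?_)
      ring
    refine key.trans (mul_le_mul_of_nonneg_right ?_ hLc.le)
    have hx1 : (∑ j ∈ Finset.range n, t ^ (n - 1 - j)) / (2 * (1 + tauC L μ)) ≤ 1 := by
      rw [div_le_one (by positivity)]; exact hsum_le
    have hx2 : (∑ j ∈ Finset.range n, t ^ (n - 1 - j)) / (2 * (1 + tauC L μ)) ≤ n / DeltaC L μ := by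
      gcongr
      linarith
    refine le_sum_betaK_mul_rate hμ hN ?_ fun _ => ?_
    · refine le_trans ?_ (sum_betaK_ge hL hμ' n)
      have hB : (4 : ℝ) / 3 * n ^ 3 / DeltaC L μ * DeltaC L μ = 4 / 3 * n ^ 3 := by field_simp
      set q := (4 : ℝ) / 3 * n ^ 3 / DeltaC L μ
      set D : ℝ := ((DeltaC L μ : ℕ) : ℝ)
      rw [Nat.cast_add]
      -- For `n ≤ D` use `x ≤ n / D`: the claim becomes `2/3 (D + n)³ ≤ D³ + 2 n D² + 2 n² D + 4/3
      -- n³`, where the mixed coefficients agree. For `n > D` use `x ≤ 1` and the cubic term `q ≥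
      -- 4/3 n²`.
      rcases le_or_gt (n : ℝ) D with hle | hgt
      · have h1 : 2 / 3 * (1 + (∑ j ∈ Finset.range n, t ^ (n - 1 - j)) / (2 * (1 + tauC L μ)))
            * (D + n) ^ 2 ≤ 2 / 3 * (1 + n / D) * (D + n) ^ 2 := by gcongr
        refine h1.trans ?_
        have h2 : 2 / 3 * (1 + n / D) * (D + n) ^ 2 = 2 / 3 * (D + n) ^ 3 / D := by field_simp
        rw [h2, div_le_iff₀ hD]
        nlinarith [pow_pos hD 3, pow_nonneg hn0 3]
      · have h1 : 2 / 3 * (1 + (∑ j ∈ Finset.range n, t ^ (n - 1 - j)) / (2 * (1 + tauC L μ)))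
            * (D + n) ^ 2 ≤ 2 / 3 * (1 + 1) * (D + n) ^ 2 := by gcongr
        refine h1.trans ?_
        have h2 : 4 / 3 * (n : ℝ) ^ 2 ≤ q := by
          refine le_of_mul_le_mul_right ?_ hD
          rw [hB]
          nlinarith [mul_nonneg (sq_nonneg (n : ℝ)) (sub_nonneg.2 hgt.le)]
        nlinarith
    · linarith [two_le_sum_betaK_mul_pow hL hμ' n]

end Parameters

/-! ### The decentralised problem as one problem on stacked vectors. -/

section ProblemFacts

variable {m d : ℕ}

/-- The smooth part of the objective. -/
def Problem.smooth (P : Problem m d) (x : Stack (Fin m) d) : ℝ := ∑ i, P.ft i (x i)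

/-- The gradient of the smooth part of the objective. -/
def Problem.grad (P : Problem m d) (x : Stack (Fin m) d) : Stack (Fin m) d :=
  WithLp.toLp 2 fun i => P.gradft i (x i)

/-- The strongly convex part of the objective. -/
def Problem.reg (P : Problem m d) (x : Stack (Fin m) d) : ℝ := ∑ i, P.μ * P.ν i (x i)

/-- The domain of the oracle. -/
def Problem.domain (P : Problem m d) : Set (Stack (Fin m) d) := {x | ∀ i, x i ∈ P.D i}

variable (P : Problem m d)

theorem Problem.f_eq (x : Stack (Fin m) d) : P.f x = P.smooth x + P.reg x :=
  Finset.sum_add_distrib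

theorem Problem.feasible_subset_domain : P.feasible ⊆ P.domain := fun _ hx i => P.X_subset_D i (hx i)

theorem convex_setOf_forall_mem {s : Fin m → Set (Vec d)} (hs : ∀ i, Convex ℝ (s i)) :
    Convex ℝ {x : Stack (Fin m) d | ∀ i, x i ∈ s i} :=
  fun _ hx _ hy _ _ ha hb hab i => hs i (hx i) (hy i) ha hb hab

theorem Problem.convex_feasible : Convex ℝ P.feasible := convex_setOf_forall_mem P.convex_X

theorem Problem.convex_domain : Convex ℝ P.domain := convex_setOf_forall_mem P.convex_D

theorem continuous_block (i : Fin m) : Continuous fun x : Stack (Fin m) d => x i :=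
  PiLp.continuous_apply 2 _ i

theorem Problem.isClosed_feasible : IsClosed P.feasible := by
  have : P.feasible = ⋂ i, (fun x : Stack (Fin m) d => x i) ⁻¹' P.X i := by
    ext x; simp [Problem.feasible]
  rw [this]
  exact isClosed_iInter fun i => (P.isClosed_X i).preimage (continuous_block i)

theorem stack_norm_sq (x : Stack (Fin m) d) : ‖x‖ ^ 2 = ∑ i, ‖x i‖ ^ 2 :=
  PiLp.norm_sq_eq_of_L2 _ x

theorem stack_inner {κ : Type*} [Fintype κ] (x y : Stack κ d) : ⟪x, y⟫_ℝ = ∑ i, ⟪x i, y i⟫_ℝ :=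
  PiLp.inner_apply x y

theorem Problem.isConvexSmoothOn : IsConvexSmoothOn P.domain P.smooth P.grad P.L where
  convexOn := by
    refine ⟨P.convex_domain, fun x hx y hy a b ha hb hab => ?_⟩
    simp only [Problem.smooth, smul_eq_mul, Finset.mul_sum]
    rw [← Finset.sum_add_distrib]
    exact Finset.sum_le_sum fun i _ => (P.convexOn_ft i).2 (hx i) (hy i) ha hb hab
  le u hu x hx := by
    rw [stack_inner, Problem.smooth, Problem.smooth, ← Finset.sum_add_distrib]
    exact Finset.sum_le_sum fun i _ =>
      (P.convexOn_ft i).add_inner_le (P.hasGradient_ft i) (hu i) (hx i)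
  ge u hu x hx := by
    rw [stack_inner, stack_norm_sq, Problem.smooth, Problem.smooth, Finset.mul_sum,
      ← Finset.sum_add_distrib, ← Finset.sum_add_distrib]
    exact Finset.sum_le_sum fun i _ =>
      le_add_inner_add_sq (P.convex_D i) (P.hasGradient_ft i) (P.lipschitz_gradft i) (hu i) (hx i)

theorem Problem.norm_grad_sub_le {x y : Stack (Fin m) d} (hx : x ∈ P.domain) (hy : y ∈ P.domain) :
    ‖P.grad x - P.grad y‖ ≤ P.L * ‖x - y‖ := by
  refine le_of_sq_le_sq ?_ (mul_nonneg P.L_pos.le (norm_nonneg _))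
  rw [mul_pow, stack_norm_sq, stack_norm_sq, Finset.mul_sum]
  refine Finset.sum_le_sum fun i _ => ?_
  rw [← mul_pow]
  exact pow_le_pow_left₀ (norm_nonneg _) (P.lipschitz_gradft i _ (hx i) _ (hy i)) 2

theorem Problem.strongConvexOn_block (i : Fin m) :
    StrongConvexOn (P.X i) P.μ fun w => P.μ * P.ν i w := by
  refine ⟨P.convex_X i, fun x hx y hy a b ha hb hab => ?_⟩
  have h := mul_le_mul_of_nonneg_left ((P.strongConvexOn_ν i).2 hx hy ha hb hab) P.μ_nonneg
  simp only [smul_eq_mul] at h ⊢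
  linarith

theorem Problem.strongConvexOn_reg : StrongConvexOn P.feasible P.μ P.reg := by
  refine ⟨P.convex_feasible, fun x hx y hy a b ha hb hab => ?_⟩
  simp only [Problem.reg, smul_eq_mul, stack_norm_sq]
  simp only [Finset.mul_sum]
  rw [← Finset.sum_add_distrib, ← Finset.sum_sub_distrib]
  refine Finset.sum_le_sum fun i _ => ?_
  have := (P.strongConvexOn_block i).2 (hx i) (hy i) ha hb hab
  simp only [smul_eq_mul] at this
  exact this.trans (le_of_eq (by simp))

theorem Problem.convexOn_reg : ConvexOn ℝ P.feasible P.reg :=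
  strongConvexOn_zero.1 (P.strongConvexOn_reg.mono P.μ_nonneg)

theorem Problem.lsc_reg : LowerSemicontinuousOn P.reg P.feasible := by
  have h : ∀ i, LowerSemicontinuousOn (fun x : Stack (Fin m) d => P.μ * P.ν i (x i)) P.feasible := by
    intro i
    have h1 : LowerSemicontinuousOn (fun x : Stack (Fin m) d => P.ν i (x i)) P.feasible :=
      (P.lsc_ν i).comp (continuous_block i).continuousOn fun x hx => hx i
    have h2 : Continuous fun r : ℝ => P.μ * r := by fun_prop
    intro x hx
    exact h2.continuousAt.comp_lowerSemicontinuousWithinAt (h1 x hx)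
      (fun a b hab => mul_le_mul_of_nonneg_left hab P.μ_nonneg)
  exact lowerSemicontinuousOn_sum fun i _ => h i

theorem Problem.continuousOn_smooth : ContinuousOn P.smooth P.domain :=
  continuousOn_finsetSum _ fun i _ =>
    ContinuousOn.comp (t := P.D i) (fun x hx => (P.hasGradient_ft i x hx).hasFDerivWithinAt.continuousWithinAt)
      (continuous_block i).continuousOn fun _ hx => hx i

theorem Problem.lsc_f : LowerSemicontinuousOn P.f P.feasible := by
  have : P.f = fun x => P.smooth x + P.reg x := funext P.f_eq
  rw [this]
  exact ((P.continuousOn_smooth.mono P.feasible_subset_domain).lowerSemicontinuousOn).add P.lsc_reg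

theorem netOp_adjoint_apply {ι κ : Type*} [Fintype ι] [Fintype κ] (K : Matrix ι κ ℝ)
    (z : Stack ι d) (i : κ) : (netOp K).adjoint z i = ∑ a, K a i • z a := by
  have h : (netOp K).adjoint z = netOp K.transpose z := by
    refine ext_inner_right ℝ fun y => ?_
    rw [ContinuousLinearMap.adjoint_inner_left, stack_inner, stack_inner]
    simp only [netOp_apply, inner_sum, sum_inner, inner_smul_left, inner_smul_right,
      Matrix.transpose_apply]
    exact Finset.sum_comm
  rw [h, netOp_apply]
  rfl

theorem netOp_single {ι κ : Type*} [Fintype ι] [Fintype κ] [DecidableEq κ] (K : Matrix ι κ ℝ)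
    (j : κ) (w : Vec d) (a : ι) :
    netOp K (WithLp.toLp 2 (Pi.single j w) : Stack κ d) a = K a j • w := by
  rw [netOp_apply]
  rw [Finset.sum_eq_single j]
  · simp
  · intro b _ hb
    simp [Pi.single_eq_of_ne hb]
  · simp

/-- A connected graph with two or more vertices has an edge, and an edge gives a nonzero entry of
`K`. Positivity guarantees that every `T_k` is at least `1`. -/
theorem norm_netOp_pos (hm : 2 ≤ m) (hd : 1 ≤ d) {G : SimpleGraph (Fin m)} (hG : G.Connected)
    {ι : Type*} [Fintype ι] {K : Matrix ι (Fin m) ℝ} (hK : IsNetworkMatrix G K) :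
    0 < ‖netOp (d := d) K‖ := by
  classical
  have hne : ∃ a j, K a j ≠ 0 := by
    have : Nontrivial (Fin m) := Fin.nontrivial_iff_two_le.2 hm
    obtain ⟨w, hw⟩ := hG.preconnected.exists_adj_of_nontrivial (⟨0, by omega⟩ : Fin m)
    cases hK with
    | laplacian e h =>
      refine ⟨e.symm ⟨0, by omega⟩, w, ?_⟩
      rw [h, Equiv.apply_symm_apply]
      have : (⟨0, by omega⟩ : Fin m) ≠ w := hw.ne
      simp [SimpleGraph.lapMatrix, SimpleGraph.degMatrix, Matrix.diagonal_apply_ne _ this, hw]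
    | incidence e tail head he h =>
      refine ⟨e.symm ⟨s(_, w), hw⟩, head (e.symm ⟨s(_, w), hw⟩), ?_⟩
      rw [h, if_pos rfl]
      exact one_ne_zero
  obtain ⟨a, j, haj⟩ := hne
  rw [norm_pos_iff]
  intro h0
  have h1 := netOp_single K j (EuclideanSpace.single (⟨0, hd⟩ : Fin d) (1 : ℝ)) a
  rw [h0] at h1
  have h2 := congrArg norm h1
  rw [norm_smul] at h2
  simp at h2
  exact haj (abs_eq_zero.1 h2.symm)

variable {P} {ι : Type*} [Fintype ι] {K : Matrix ι (Fin m) ℝ} {xs : Stack (Fin m) d} {zs : Stack ι d}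

/-- The multiplier `zs + netOp K xs` would otherwise increase the Lagrangian. -/
theorem IsSaddlePoint.netOp_eq_zero (h : IsSaddlePoint P K xs zs) : netOp K xs = 0 := by
  have h1 := h.max (zs + netOp K xs)
  rw [inner_add_right, real_inner_self_eq_norm_sq] at h1
  have h2 : ‖netOp K xs‖ ^ 2 ≤ 0 := by linarith
  simpa using le_antisymm h2 (sq_nonneg _)

theorem IsSaddlePoint.le_add_inner (h : IsSaddlePoint P K xs zs) {x : Stack (Fin m) d}
    (hx : x ∈ P.feasible) : P.f xs ≤ P.f x + ⟪netOp K x, zs⟫_ℝ := by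
  simpa [h.netOp_eq_zero] using h.min x hx

end ProblemFacts

theorem sum_Icc_one {M : Type*} [AddCommMonoid M] (f : ℕ → M) (n : ℕ) :
    ∑ k ∈ Finset.Icc 1 n, f k = ∑ k ∈ Finset.range n, f (k + 1) := by
  induction n with
  | zero => simp
  | succ n ih => rw [Finset.sum_Icc_succ_top (by omega), ih, Finset.sum_range_succ]

theorem smul_sub_eq_neg_of_isMinOn {E : Type*} [NormedAddCommGroup E] [InnerProductSpace ℝ E]
    {g b w : E} {q : ℝ} (hq : 0 < q)
    (h : IsMinOn (fun y => ⟪g, y⟫_ℝ + q / 2 * ‖y - b‖ ^ 2) Set.univ w) : q • (w - b) = -g := by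
  have key : ∀ y, ⟪g, y⟫_ℝ + q / 2 * ‖y - b‖ ^ 2
      = 1 / (2 * q) * ‖q • (y - b) + g‖ ^ 2 + (⟪g, b⟫_ℝ - 1 / (2 * q) * ‖g‖ ^ 2) := by
    intro y
    rw [norm_add_sq_real, norm_smul, inner_smul_left, inner_sub_left, real_inner_comm y g,
      real_inner_comm b g]
    simp only [Real.norm_eq_abs, mul_pow, sq_abs, RCLike.conj_to_real]
    field_simp
    ring
  have h1 : ⟪g, w⟫_ℝ + q / 2 * ‖w - b‖ ^ 2 ≤
      ⟪g, b - q⁻¹ • g⟫_ℝ + q / 2 * ‖b - q⁻¹ • g - b‖ ^ 2 := h (Set.mem_univ (b - q⁻¹ • g))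
  rw [key, key (b - q⁻¹ • g), sub_sub_cancel_left, smul_neg, smul_inv_smul₀ hq.ne',
    neg_add_cancel] at h1
  have h2 : ‖q • (w - b) + g‖ ^ 2 ≤ 0 := by
    have h3 : 1 / (2 * q) * ‖q • (w - b) + g‖ ^ 2 ≤ 0 := by simpa using h1
    by_contra! h4
    have : 0 < 1 / (2 * q) * ‖q • (w - b) + g‖ ^ 2 := by positivity
    linarith
  have h3 : ‖q • (w - b) + g‖ = 0 := by simpa using le_antisymm h2 (sq_nonneg _)
  exact eq_neg_of_add_eq_zero_left (norm_eq_zero.1 h3)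

/-! ### Estimates for a fixed realisation of the samples. -/

section Pathwise

variable {m d : ℕ} {ι Ω : Type*} [Fintype ι] {P : Problem m d} {K : Matrix ι (Fin m) ℝ}
  {S : Fin m → Type*} [∀ i, MeasurableSpace (S i)] {O : Oracle P S} {ξ : ℕ → ℕ → Ω → (∀ i, S i)}
  {R c a : ℝ} {N : ℕ} {x0 : Stack (Fin m) d} {x : ℕ → ℕ → Ω → Stack (Fin m) d}
  {z : ℕ → ℕ → Ω → Stack ι d} {u : ℕ → Ω → Stack (Fin m) d}

/-- The mini-batch estimators of all the agents. -/
noncomputable def stackedEstimator (O : Oracle P S) (ξ : ℕ → ℕ → Ω → (∀ i, S i)) (par : Params)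
    (u : ℕ → Ω → Stack (Fin m) d) (k : ℕ) (ω : Ω) : Stack (Fin m) d :=
  WithLp.toLp 2 (miniBatch O ξ par u k ω)

theorem xHat_succ (par : Params) (x : ℕ → ℕ → Ω → Stack (Fin m) d) (k : ℕ) (ω : Ω) :
    xHat par x (k + 1) ω = loopAverage (par.T (k + 1)) (fun t => x (k + 1) t ω) := by
  rw [xHat, if_neg (Nat.succ_ne_zero k), loopAverage, sum_Icc_one]

/-- The primal objective is a sum over the agents and the feasible set a product, so the agents'
separate minimisations amount to one joint minimisation. -/
theorem IsRun.isInnerRun (hR : 0 < R) (ha : 0 < a)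
    (h : IsRun P K O ξ (params P.L P.μ R c a N) N x0 x z u) (ω : Ω) {k : ℕ} (hk : k < N) :
    IsInnerRun (netOp K) P.feasible P.reg (fun t => (pK P.L P.μ (k + 1) + P.μ) * ((t : ℝ) - 1)
      + pK P.L P.μ (k + 1) * TK P.L P.μ R a (k + 1)) (pK P.L P.μ (k + 1))
      (P.L / (4 * R ^ 2) * TK P.L P.μ R a (k + 1) / betaK P.L P.μ (k + 1))
      (if k = 0 then 1 else betaK P.L P.μ k * TK P.L P.μ R a (k + 1)
        / (betaK P.L P.μ (k + 1) * TK P.L P.μ R a k)) (TK P.L P.μ R a (k + 1))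
      (stackedEstimator O ξ (params P.L P.μ R c a N) u (k + 1) ω)
      (x k (TK P.L P.μ R a k - 1) ω) (fun t => x (k + 1) t ω) (fun t => z (k + 1) t ω) where
  dual t ht := by
    have hβ := betaK_pos P.L_pos P.μ_nonneg (k := k + 1) (by omega)
    have hT : (0 : ℝ) < TK P.L P.μ R a (k + 1) := by
      exact_mod_cast TK_pos P.L_pos P.μ_nonneg hR ha (by omega : 1 ≤ k + 1)
    have hL := P.L_pos
    have hq : (params P.L P.μ R c a N).q (k + 1) (t + 1)
        = P.L / (4 * R ^ 2) * TK P.L P.μ R a (k + 1) / betaK P.L P.μ (k + 1) := by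
      simp only [params]; field_simp
    have hux : uTilde (params P.L P.μ R c a N) x (k + 1) (t + 1) ω
        = extrapolation (if k = 0 then 1 else betaK P.L P.μ k * TK P.L P.μ R a (k + 1)
          / (betaK P.L P.μ (k + 1) * TK P.L P.μ R a k)) (x k (TK P.L P.μ R a k - 1) ω)
          (fun t => x (k + 1) t ω) t := by
      unfold uTilde extrapolation xPrev
      rcases Nat.eq_zero_or_pos t with rfl | ht0
      · rcases Nat.eq_zero_or_pos k with rfl | hk0
        · simp [params]
        · have : 2 ≤ k + 1 := by omega
          simp [params, this, hk0.ne']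
      · have h1 : t + 1 - 2 = t - 1 := by omega
        simp [params, ht0.ne', h1]
    rw [← hux]
    refine PiLp.ext fun b => ?_
    have h1 := h.z_step (k + 1) (by omega) (by omega) (t + 1) (by omega) ht ω b
    rw [hq] at h1
    have h2 := smul_sub_eq_neg_of_isMinOn (by positivity) h1
    rw [neg_neg] at h2
    rw [netOp_apply, ← h2]
    rfl
  mem t ht := fun i => h.x_mem (k + 1) (by omega) (by omega) (t + 1) (by omega) ht ω i
  primal t ht := by
    intro y hy
    simp only [Set.mem_ofPred_eq, Problem.reg, stack_inner, stack_norm_sq, Finset.mul_sum]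
    rw [← Finset.sum_add_distrib, ← Finset.sum_add_distrib, ← Finset.sum_add_distrib,
      ← Finset.sum_add_distrib, ← Finset.sum_add_distrib, ← Finset.sum_add_distrib]
    refine Finset.sum_le_sum fun i _ => ?_
    have h1 := h.x_step (k + 1) (by omega) (by omega) (t + 1) (by omega) ht ω i (hy i)
    simp only [PiLp.add_apply, netOp_adjoint_apply]
    exact h1

theorem IsRun.isOuterRun (hR : 0 < R) (ha : 0 < a)
    (h : IsRun P K O ξ (params P.L P.μ R c a N) N x0 x z u) (ω : Ω) :
    IsOuterRun (netOp K) P.feasible P.reg P.μ (betaK P.L P.μ) (pK P.L P.μ) (TK P.L P.μ R a)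
      (P.L / (4 * R ^ 2)) N x0 (fun k => stackedEstimator O ξ (params P.L P.μ R c a N) u k ω)
      (fun k t => x k t ω) (fun k t => z k t ω) where
  x_init t := h.x_init t ω
  z_init t := h.z_init t ω
  x_start k hk := h.x_start (k + 1) (by omega) (by omega) ω
  z_start k hk := h.z_start (k + 1) (by omega) (by omega) ω
  inner _ hk := h.isInnerRun hR ha ω hk

theorem IsRun.last_mem (hR : 0 < R) (ha : 0 < a) (hx0 : x0 ∈ P.feasible)
    (h : IsRun P K O ξ (params P.L P.μ R c a N) N x0 x z u) (ω : Ω) {k : ℕ} (hk : k ≤ N) :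
    x k (TK P.L P.μ R a k) ω ∈ P.feasible := by
  rcases Nat.eq_zero_or_pos k with rfl | hk0
  · rw [h.x_init]; exact hx0
  · exact h.x_mem k hk0 hk _ (TK_pos P.L_pos P.μ_nonneg hR ha hk0) le_rfl ω

theorem IsRun.xHat_mem (hR : 0 < R) (ha : 0 < a)
    (h : IsRun P K O ξ (params P.L P.μ R c a N) N x0 x z u) (ω : Ω) {k : ℕ} (hk : k < N) :
    xHat (params P.L P.μ R c a N) x (k + 1) ω ∈ P.feasible := by
  rw [xHat_succ]
  exact ((convexOn_const (0 : ℝ) P.convex_feasible).loopAverage_le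
    (TK_pos P.L_pos P.μ_nonneg hR ha (by omega)) (h.isInnerRun hR ha ω hk).mem).1

theorem IsRun.query_recursion
    (h : IsRun P K O ξ (params P.L P.μ R c a N) N x0 x z u) (ω : Ω) {j : ℕ} (hj : j < N)
    (htau : 0 ≤ tauK P.L P.μ (j + 1)) :
    (1 + tauK P.L P.μ (j + 1)) • u (j + 1) ω = x j (TK P.L P.μ R a j) ω
      + lamK P.L P.μ (j + 1) • (xHat (params P.L P.μ R c a N) x j ω
        - x (j - 1) (TK P.L P.μ R a (j - 1)) ω) + tauK P.L P.μ (j + 1) • u j ω := by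
  rw [h.u_step (j + 1) (by omega) (by omega) ω]
  have : (1 : ℝ) + tauK P.L P.μ (j + 1) ≠ 0 := by positivity
  exact smul_inv_smul₀ this _

theorem IsRun.query_recursion_of_before
    (h : IsRun P K O ξ (params P.L P.μ R c a N) N x0 x z u) (ω : Ω) {j : ℕ} (hj : j < N)
    (hb : BeforeDelta P.L P.μ (j + 1)) :
    (1 + (j : ℝ) / 2) • u (j + 1) ω = x j (TK P.L P.μ R a j) ω
      + ((j : ℝ) / (j + 1)) • (xHat (params P.L P.μ R c a N) x j ω
        - x (j - 1) (TK P.L P.μ R a (j - 1)) ω) + ((j : ℝ) / 2) • u j ω := by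
  have htau : tauK P.L P.μ (j + 1) = (j : ℝ) / 2 := by
    rw [tauK, if_pos hb]; push_cast; ring
  have hlam : lamK P.L P.μ (j + 1) = (j : ℝ) / (j + 1) := by
    rw [lamK, if_pos hb]; push_cast; ring
  have := h.query_recursion ω hj (by rw [htau]; positivity)
  rwa [htau, hlam] at this

/-- For `μ = 0` only the first phase occurs, and the query is a convex combination of feasible
points. For `μ > 0` it may overshoot in the second phase, which is why membership is part of a run.
-/
theorem IsRun.query_mem_domain (hR : 0 < R) (ha : 0 < a) (hx0 : x0 ∈ P.feasible)
    (h : IsRun P K O ξ (params P.L P.μ R c a N) N x0 x z u) (ω : Ω) {j : ℕ} (hj : j < N) :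
    u (j + 1) ω ∈ P.domain := by
  rcases P.μ_nonneg.eq_or_lt with hμ | hμ
  · have h1 := query_eq_of_increasing_weights
      (xh := fun k => xHat (params P.L P.μ R c a N) x k ω)
      (xl := fun k => x k (TK P.L P.μ R a k) ω) (u := fun k => u k ω) (n := N)
      (fun j hj => h.query_recursion_of_before ω hj (Or.inl hμ.symm)) j hj
    refine P.feasible_subset_domain ?_
    have hpos : (0 : ℝ) < ((j : ℝ) + 1) * (j + 2) / 2 := by positivity
    have h2 := (P.convex_feasible).sum_mem (t := Finset.range (j + 1))
      (w := fun i => (((j : ℝ) + 1) * (j + 2) / 2)⁻¹ * (i + 1))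
      (z := fun i => if i < j then xHat (params P.L P.μ R c a N) x (i + 1) ω
        else x j (TK P.L P.μ R a j) ω) (fun i _ => by positivity)
      (by rw [← Finset.mul_sum, sum_range_succ_cast]; push_cast; field_simp; ring)
      (fun i hi => by
        split_ifs with hij
        · exact h.xHat_mem hR ha ω (by omega)
        · exact h.last_mem hR ha hx0 ω hj.le)
    have h3 : u (j + 1) ω = (((j : ℝ) + 1) * (j + 2) / 2)⁻¹ • ((((j : ℝ) + 1) * (j + 2) / 2)
        • u (j + 1) ω) := (inv_smul_smul₀ hpos.ne' _).symm
    rw [h3, h1]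
    convert h2 using 1
    rw [Finset.sum_range_succ, if_neg (lt_irrefl j), smul_add, Finset.smul_sum, smul_smul]
    congr 1
    refine Finset.sum_congr rfl fun i hi => ?_
    rw [if_pos (Finset.mem_range.1 hi), smul_smul]
  · exact h.query_mem hμ (j + 1) (by omega) (by omega) ω

theorem sum_smul_xBar (h : 0 < ∑ k ∈ Finset.range N, betaK P.L P.μ (k + 1)) (ω : Ω) :
    (∑ k ∈ Finset.range N, betaK P.L P.μ (k + 1)) • xBar (params P.L P.μ R c a N) x N ω
      = ∑ k ∈ Finset.range N, betaK P.L P.μ (k + 1)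
        • xHat (params P.L P.μ R c a N) x (k + 1) ω := by
  rw [xBar, sum_Icc_one, sum_Icc_one]
  exact smul_inv_smul₀ h.ne' _

theorem sum_betaK_pos {L μ : ℝ} (hL : 0 < L) (hμ : 0 ≤ μ) (hN : 1 ≤ N) :
    0 < ∑ k ∈ Finset.range N, betaK L μ (k + 1) :=
  Finset.sum_pos (fun k _ => betaK_pos hL hμ (by omega)) ⟨0, Finset.mem_range.2 hN⟩

/-- The factor `β p / 2` equals `2 L` in the first phase and `L β / (1 + τ)` in the second, the
coefficients of `accelerated_bound_two_phases`. -/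
theorem IsRun.smooth_xBar_le (hR : 0 < R) (ha : 0 < a) (hN : 1 ≤ N) (hx0 : x0 ∈ P.feasible)
    (h : IsRun P K O ξ (params P.L P.μ R c a N) N x0 x z u) (ω : Ω) :
    (∑ k ∈ Finset.range N, betaK P.L P.μ (k + 1))
        * P.smooth (xBar (params P.L P.μ R c a N) x N ω)
      ≤ ∑ k ∈ Finset.range N, (betaK P.L P.μ (k + 1) * (P.smooth (u (k + 1) ω)
          + ⟪P.grad (u (k + 1) ω), xHat (params P.L P.μ R c a N) x (k + 1) ω - u (k + 1) ω⟫_ℝ)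
        + betaK P.L P.μ (k + 1) * pK P.L P.μ (k + 1) / 2
          * ‖xHat (params P.L P.μ R c a N) x (k + 1) ω - x k (TK P.L P.μ R a k) ω‖ ^ 2) := by
  have hL := P.L_pos
  have hy := sum_smul_xBar (P := P) (R := R) (c := c) (a := a) (x := x)
    (sum_betaK_pos hL P.μ_nonneg hN) ω
  by_cases hb : BeforeDelta P.L P.μ N
  · have hβ : ∀ j ∈ Finset.range N, betaK P.L P.μ (j + 1) = (j : ℝ) + 1 := fun j hj => by
      rw [betaK_of_before (hb.mono (Finset.mem_range.1 hj))]; push_cast; rfl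
    have hcast : ((N - 1 : ℕ) : ℝ) = (N : ℝ) - 1 := by rw [Nat.cast_sub hN]; simp
    have hB : ∑ k ∈ Finset.range N, betaK P.L P.μ (k + 1)
        = (((N - 1 : ℕ) : ℝ) + 1) * ((N - 1 : ℕ) + 2) / 2 := by
      rw [sum_betaK_of_before hb, hcast]; ring
    rw [hB] at hy ⊢
    rw [Finset.sum_congr rfl fun j hj => by rw [hβ j hj]] at hy
    have h1 := (accelerated_bound_of_increasing_weights P.isConvexSmoothOn P.convex_feasible
      P.feasible_subset_domain (xh := fun k => xHat (params P.L P.μ R c a N) x k ω)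
      (xl := fun k => x k (TK P.L P.μ R a k) ω) (u := fun k => u k ω) (n := N)
      (fun j hj => h.xHat_mem hR ha ω hj) (fun j hj => h.query_mem_domain hR ha hx0 ω hj)
      (fun j hj => h.query_recursion_of_before ω hj (hb.mono hj)) (N - 1) (by omega) _
      (by rw [Nat.sub_add_cancel hN]; exact hy)).2
    rw [Nat.sub_add_cancel hN] at h1
    refine h1.trans (Finset.sum_le_sum fun j hj => ?_)
    rw [betaK_mul_pK_of_before (by omega) (hb.mono (Finset.mem_range.1 hj)), hβ j hj]
    gcongr
    rw [mul_div_assoc]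
    have : ((j : ℝ) + 1) / (j + 2) ≤ 1 := by rw [div_le_one (by positivity)]; linarith
    nlinarith
  · obtain ⟨hμ, i, hi⟩ := (not_before_iff P.μ_nonneg).1 hb
    obtain ⟨n, hn, hn1, hn2, -⟩ := exists_DeltaC_eq hL hμ
    have hτ := tauC_pos hL hμ
    have hNn : N = n + 1 + (i + 1) := by omega
    have hdelta : (DeltaC P.L P.μ : ℝ) = n + 1 := by rw [hn]; push_cast; rfl
    have hbj : ∀ j < n + 1, BeforeDelta P.L P.μ (j + 1) := fun j hj =>
      (beforeDelta_iff hμ _).2 (by omega)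
    have hnb : ∀ j, ¬ BeforeDelta P.L P.μ (n + 1 + j + 1) := fun j => by
      rw [beforeDelta_iff hμ]; omega
    have h1 := accelerated_bound_two_phases P.isConvexSmoothOn hL.le P.convex_feasible
      P.feasible_subset_domain hτ hn1 hn2 (xh := fun k => xHat (params P.L P.μ R c a N) x k ω)
      (xl := fun k => x k (TK P.L P.μ R a k) ω) (u := fun k => u k ω) (m := i + 1)
      (β := betaK P.L P.μ)
      (fun j hj => h.xHat_mem hR ha ω (by omega))
      (fun j hj => h.query_mem_domain hR ha hx0 ω (by omega))
      (fun j hj => h.query_recursion_of_before ω (by omega) (hbj j hj))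
      (fun j hj => by rw [betaK_of_before (hbj j hj)]; push_cast; rfl)
      (fun j => by rw [← hn, betaK_DeltaC_add hL hμ, hdelta])
      (fun j hj => by
        have htau : tauK P.L P.μ (n + 1 + j + 1) = tauC P.L P.μ := if_neg (hnb j)
        have hlam : lamK P.L P.μ (n + 1 + j + 1) = tauC P.L P.μ / (1 + tauC P.L P.μ) :=
          if_neg (hnb j)
        have h2 := h.query_recursion ω (j := n + 1 + j) (by omega) (by rw [htau]; exact hτ.le)
        rw [htau, hlam, show n + 1 + j - 1 = n + j by omega] at h2
        exact h2)
      (xBar (params P.L P.μ R c a N) x N ω) (by rw [← hNn]; exact hy)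
    rw [← hNn] at h1
    refine h1.trans (Finset.sum_le_sum fun j hj => ?_)
    gcongr
    split_ifs with hj'
    · rw [betaK_mul_pK_of_before (by omega) (hbj j hj')]; linarith
    · rw [pK_of_not_before (by rw [beforeDelta_iff hμ]; omega)]
      exact le_of_eq (by ring)

theorem IsRun.xBar_mem (hR : 0 < R) (ha : 0 < a) (hN : 1 ≤ N)
    (h : IsRun P K O ξ (params P.L P.μ R c a N) N x0 x z u) (ω : Ω) {φ : Stack (Fin m) d → ℝ}
    (hφ : ConvexOn ℝ P.feasible φ) :
    xBar (params P.L P.μ R c a N) x N ω ∈ P.feasible ∧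
    (∑ k ∈ Finset.range N, betaK P.L P.μ (k + 1)) * φ (xBar (params P.L P.μ R c a N) x N ω)
      ≤ ∑ k ∈ Finset.range N, betaK P.L P.μ (k + 1)
        * φ (xHat (params P.L P.μ R c a N) x (k + 1) ω) := by
  have hB := sum_betaK_pos (N := N) P.L_pos P.μ_nonneg hN
  have hw : ∀ k ∈ Finset.range N, 0 ≤ betaK P.L P.μ (k + 1) := fun k _ =>
    (betaK_pos P.L_pos P.μ_nonneg (by omega)).le
  have hmem : ∀ k ∈ Finset.range N, xHat (params P.L P.μ R c a N) x (k + 1) ω ∈ P.feasible :=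
    fun k hk => h.xHat_mem hR ha ω (Finset.mem_range.1 hk)
  have he : xBar (params P.L P.μ R c a N) x N ω = (Finset.range N).centerMass
      (fun k => betaK P.L P.μ (k + 1)) fun k => xHat (params P.L P.μ R c a N) x (k + 1) ω := by
    rw [xBar, sum_Icc_one, sum_Icc_one, Finset.centerMass]
    rfl
  rw [he]
  refine ⟨hφ.1.centerMass_mem hw hB hmem, ?_⟩
  have h1 : φ ((Finset.range N).centerMass
      (fun k => betaK P.L P.μ (k + 1)) fun k => xHat (params P.L P.μ R c a N) x (k + 1) ω)
      ≤ (∑ k ∈ Finset.range N, betaK P.L P.μ (k + 1))⁻¹ * ∑ k ∈ Finset.range N,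
        betaK P.L P.μ (k + 1) * φ (xHat (params P.L P.μ R c a N) x (k + 1) ω) :=
    hφ.map_centerMass_le hw hB hmem
  rwa [inv_mul_eq_div, le_div_iff₀ hB, mul_comm] at h1

/-- In the sum of the outer-loop and the acceleration estimates the terms `‖x̂_k - x_{k-1}‖²`
cancel. The estimator error is kept exactly as a linear term; `4 L` is `β_1 p_1` and `L / (8 R²)` is
`Q / 2`. -/
theorem IsRun.gap_le (hR : 0 < R) (hN : 1 ≤ N) (hx0 : x0 ∈ P.feasible)
    (hA : 0 < ‖netOp (d := d) K‖)
    (h : IsRun P K O ξ (params P.L P.μ R c ‖netOp (d := d) K‖ N) N x0 x z u)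
    {y : Stack (Fin m) d} (hy : y ∈ P.feasible) (hAy : netOp K y = 0) (ω : Ω) (w : Stack ι d) :
    (∑ k ∈ Finset.range N, betaK P.L P.μ (k + 1))
      * (P.f (xBar (params P.L P.μ R c ‖netOp (d := d) K‖ N) x N ω) - P.f y
        + ⟪netOp K (xBar (params P.L P.μ R c ‖netOp (d := d) K‖ N) x N ω), w⟫_ℝ)
      ≤ 4 * P.L * ‖x0 - y‖ ^ 2 + P.L / (8 * R ^ 2) * ‖w‖ ^ 2
        - ∑ k ∈ Finset.range N, betaK P.L P.μ (k + 1)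
          * ⟪stackedEstimator O ξ (params P.L P.μ R c ‖netOp (d := d) K‖ N) u (k + 1) ω
              - P.grad (u (k + 1) ω),
            xHat (params P.L P.μ R c ‖netOp (d := d) K‖ N) x (k + 1) ω - y⟫_ℝ := by
  have hL := P.L_pos
  have hB := sum_betaK_pos (N := N) P.L_pos P.μ_nonneg hN
  have h1 := (h.isOuterRun hR hA ω).sum_gap_le P.strongConvexOn_reg
    (stepConditions_params hL P.μ_nonneg hR hA c N) hN hy hAy w
  rw [betaK_mul_pK_of_before le_rfl (before_one hL P.μ_nonneg)] at h1
  have h2 := h.smooth_xBar_le hR hA hN hx0 ω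
  have h3 := (h.xBar_mem hR hA hN ω
    P.convexOn_reg).2
  have h4 := sum_smul_xBar (P := P) (R := R) (c := c) (a := ‖netOp (d := d) K‖) (x := x) hB ω
  have h5 : (∑ k ∈ Finset.range N, betaK P.L P.μ (k + 1))
      * ⟪netOp K (xBar (params P.L P.μ R c ‖netOp (d := d) K‖ N) x N ω), w⟫_ℝ
      = ∑ k ∈ Finset.range N, betaK P.L P.μ (k + 1)
        * ⟪netOp K (xHat (params P.L P.μ R c ‖netOp (d := d) K‖ N) x (k + 1) ω), w⟫_ℝ := by
    rw [← real_inner_smul_left, ← map_smul, h4, map_sum, sum_inner]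
    exact Finset.sum_congr rfl fun k _ => by rw [map_smul, real_inner_smul_left]
  have h6 : ∀ k ∈ Finset.range N, betaK P.L P.μ (k + 1) * (P.smooth (u (k + 1) ω)
        + ⟪P.grad (u (k + 1) ω), y - u (k + 1) ω⟫_ℝ) ≤ betaK P.L P.μ (k + 1) * P.smooth y :=
    fun k hk => mul_le_mul_of_nonneg_left (P.isConvexSmoothOn.le _
      (h.query_mem_domain hR hA hx0 ω (Finset.mem_range.1 hk)) _ (P.feasible_subset_domain hy))
      (betaK_pos hL P.μ_nonneg (by omega)).le
  have h7 := Finset.sum_le_sum h6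
  rw [← Finset.sum_mul] at h7
  have h8 : (∑ k ∈ Finset.range N, betaK P.L P.μ (k + 1)) * P.reg y
      = ∑ k ∈ Finset.range N, betaK P.L P.μ (k + 1) * P.reg y := Finset.sum_mul _ _ _
  have h9 : P.L / (4 * R ^ 2) / 2 = P.L / (8 * R ^ 2) := by field_simp; norm_num
  rw [h9] at h1
  rw [P.f_eq, P.f_eq, mul_add, mul_sub, mul_add, mul_add, h5, h8]
  have hxh : ∀ k, loopAverage (TK P.L P.μ R ‖netOp (d := d) K‖ (k + 1)) (fun t => x (k + 1) t ω)
      = xHat (params P.L P.μ R c ‖netOp (d := d) K‖ N) x (k + 1) ω := fun k => 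
        (xHat_succ (params P.L P.μ R c ‖netOp (d := d) K‖ N) x k ω).symm
  simp only [hxh] at h1
  refine le_trans (add_le_add_left (sub_le_sub (add_le_add h2 h3) (add_le_add_left h7 _)) _) ?_
  refine le_trans ?_ (sub_le_sub_right h1 _)
  rw [← Finset.sum_add_distrib, ← Finset.sum_add_distrib, ← Finset.sum_sub_distrib,
    ← Finset.sum_add_distrib, ← Finset.sum_sub_distrib]
  refine Finset.sum_le_sum fun k _ => le_of_eq ?_
  rw [norm_sub_rev (xHat _ x (k + 1) ω)]
  simp only [inner_sub_left, inner_sub_right]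
  ring

end Pathwise

end SPDS

/-! ### The proximal map, and the inner loop as an explicit function of its inputs. -/

section ProximalMap

variable {E : Type*} [NormedAddCommGroup E] [InnerProductSpace ℝ E]

theorem add_quadratics_eq_add_sq {e p : ℝ} (hs : e + p ≠ 0) (g a b y : E) :
    ⟪g, y⟫_ℝ + e / 2 * ‖a - y‖ ^ 2 + p / 2 * ‖b - y‖ ^ 2
      = (e + p) / 2 * ‖y - (e + p)⁻¹ • (e • a + p • b - g)‖ ^ 2
        + (e / 2 * ‖a‖ ^ 2 + p / 2 * ‖b‖ ^ 2
          - (e + p) / 2 * ‖(e + p)⁻¹ • (e • a + p • b - g)‖ ^ 2) := by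
  have h : (e + p) * ⟪y, (e + p)⁻¹ • (e • a + p • b - g)⟫_ℝ = e * ⟪a, y⟫_ℝ + p * ⟪b, y⟫_ℝ - ⟪g, y⟫_ℝ := by
    rw [real_inner_smul_right, mul_inv_cancel_left₀ hs, real_inner_comm, inner_sub_left,
      inner_add_left, real_inner_smul_left, real_inner_smul_left]
  rw [norm_sub_sq_real y, norm_sub_sq_real a, norm_sub_sq_real b]
  linear_combination h

/-- Completing the square leaves one quadratic whose centre is affine in all inputs. Regularity of a
step thus reduces to that of `proxPoint`. -/
theorem isMinOn_add_quadratics_iff {X : Set E} {φ : E → ℝ} {e p : ℝ} (hs : e + p ≠ 0)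
    {g a b w : E} :
    IsMinOn (fun y => φ y + ⟪g, y⟫_ℝ + e / 2 * ‖a - y‖ ^ 2 + p / 2 * ‖b - y‖ ^ 2) X w
      ↔ IsMinOn (fun y => φ y + (e + p) / 2 * ‖y - (e + p)⁻¹ • (e • a + p • b - g)‖ ^ 2) X w := by
  have h := add_quadratics_eq_add_sq hs g a b
  simp only [isMinOn_iff]
  refine forall₂_congr fun y _ => ?_
  have h1 := h y
  have h2 := h w
  constructor <;> intro h3 <;> linarith

/-- The set and the function of a proximal step. -/
structure IsProxable (X : Set E) (φ : E → ℝ) : Prop where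
  isClosed : IsClosed X
  nonempty : X.Nonempty
  convexOn : ConvexOn ℝ X φ
  lsc : LowerSemicontinuousOn φ X

open Classical in
/-- The minimizer of `φ + s/2 ‖· - c‖²` over `X`. -/
noncomputable def proxPoint (X : Set E) (φ : E → ℝ) (s : ℝ) (c : E) : E :=
  if h : ∃ w ∈ X, IsMinOn (fun y => φ y + s / 2 * ‖y - c‖ ^ 2) X w then h.choose else c

variable [FiniteDimensional ℝ E] {X : Set E} {φ : E → ℝ} {s : ℝ}

theorem IsProxable.proxPoint_spec (h : IsProxable X φ) (hs : 0 < s) (c : E) :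
    proxPoint X φ s c ∈ X
      ∧ IsMinOn (fun y => φ y + s / 2 * ‖y - c‖ ^ 2) X (proxPoint X φ s c) := by
  have he := exists_isMinOn_add_sq h.isClosed h.nonempty h.convexOn h.lsc hs c
  rw [proxPoint, dif_pos he]
  exact he.choose_spec

theorem IsProxable.lipschitzWith_proxPoint (h : IsProxable X φ) (hs : 0 < s) :
    LipschitzWith 1 (proxPoint X φ s) :=
  LipschitzWith.of_dist_le_mul fun c c' => by
    rw [dist_eq_norm, dist_eq_norm, NNReal.coe_one, one_mul]
    obtain ⟨h1, h2⟩ := h.proxPoint_spec hs c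
    obtain ⟨h3, h4⟩ := h.proxPoint_spec hs c'
    exact prox_nonexpansive hs h.convexOn h1 h3 h2 h4

theorem IsProxable.eq_proxPoint (h : IsProxable X φ) (hs : 0 < s) {c w : E} (hw : w ∈ X)
    (hmin : IsMinOn (fun y => φ y + s / 2 * ‖y - c‖ ^ 2) X w) : w = proxPoint X φ s c := by
  obtain ⟨h1, h2⟩ := h.proxPoint_spec hs c
  have := prox_nonexpansive hs h.convexOn hw h1 hmin h2
  rw [sub_self, norm_zero] at this
  exact sub_eq_zero.1 (norm_le_zero_iff.1 this)

end ProximalMap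

theorem LipschitzWith.memLp_comp_of_isFiniteMeasure {E : Type*} [NormedAddCommGroup E]
    {Ω : Type*} {_ : MeasurableSpace Ω}
    {Pr : Measure Ω} [IsFiniteMeasure Pr] {f : E → E} {C : NNReal} (hf : LipschitzWith C f)
    {g : Ω → E} {r : ENNReal} (hg : MemLp g r Pr) : MemLp (fun ω => f (g ω)) r Pr := by
  have h0 : MemLp (fun _ : Ω => ‖f 0‖) r Pr := memLp_const _
  have h1 : MemLp (fun ω => (C : ℝ) * ‖g ω‖) r Pr := hg.norm.const_mul _
  refine (h0.add h1).mono (hf.continuous.comp_aestronglyMeasurable hg.1)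
    (Filter.Eventually.of_forall fun ω => ?_)
  have h2 := hf.dist_le_mul (g ω) 0
  rw [dist_eq_norm, dist_eq_norm, sub_zero] at h2
  have h3 := norm_le_norm_add_norm_sub' (f (g ω)) (f 0)
  rw [Pi.add_apply, Real.norm_of_nonneg (by positivity)]
  linarith

section SlidingState

variable {E F : Type*} [NormedAddCommGroup E] [InnerProductSpace ℝ E]
  [NormedAddCommGroup F] [InnerProductSpace ℝ F] [FiniteDimensional ℝ E] [CompleteSpace F]

/-- The state `(x (t - 1), x t, z t)` of the inner loop as a function of its inputs. -/
noncomputable def slidingState (A : E →L[ℝ] F) (X : Set E) (φ : E → ℝ) (η : ℕ → ℝ) (p q a : ℝ)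
    (v xp x0 : E) (z0 : F) : ℕ → E × E × F
  | 0 => (xp, x0, z0)
  | t + 1 =>
    ((slidingState A X φ η p q a v xp x0 z0 t).2.1,
      proxPoint X φ (η (t + 1) + p) ((η (t + 1) + p)⁻¹ •
        (η (t + 1) • (slidingState A X φ η p q a v xp x0 z0 t).2.1 + p • x0
          - (v + A.adjoint ((slidingState A X φ η p q a v xp x0 z0 t).2.2
            + q⁻¹ • A ((slidingState A X φ η p q a v xp x0 z0 t).2.1 + (if t = 0 then a else 1) •
              ((slidingState A X φ η p q a v xp x0 z0 t).2.1
                - (slidingState A X φ η p q a v xp x0 z0 t).1)))))),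
      (slidingState A X φ η p q a v xp x0 z0 t).2.2
        + q⁻¹ • A ((slidingState A X φ η p q a v xp x0 z0 t).2.1 + (if t = 0 then a else 1) •
          ((slidingState A X φ η p q a v xp x0 z0 t).2.1
            - (slidingState A X φ η p q a v xp x0 z0 t).1)))

variable {A : E →L[ℝ] F} {X : Set E} {φ : E → ℝ} {η : ℕ → ℝ} {p q a : ℝ} {T : ℕ}

theorem slidingState_fst (v xp x0 : E) (z0 : F) (t : ℕ) :
    (slidingState A X φ η p q a v xp x0 z0 t).1
      = if t = 0 then xp else (slidingState A X φ η p q a v xp x0 z0 (t - 1)).2.1 := by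
  cases t <;> simp [slidingState]

/-- Provides inner runs for arbitrary linear terms, in particular the comparison run with the exact
gradient. -/
theorem isInnerRun_slidingState (h : IsProxable X φ) (hp : 0 < p) (hq : q ≠ 0)
    (hη : ∀ t, 0 ≤ η (t + 1)) (v xp x0 : E) (z0 : F) :
    IsInnerRun A X φ η p q a T v xp
      (fun t => (slidingState A X φ η p q a v xp x0 z0 t).2.1)
      (fun t => (slidingState A X φ η p q a v xp x0 z0 t).2.2) where
  dual t _ := by
    simp only [slidingState, extrapolation, add_sub_cancel_left, smul_inv_smul₀ hq]
    rw [slidingState_fst v xp x0 z0 t]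
  mem t _ := (h.proxPoint_spec (add_pos_of_nonneg_of_pos (hη t) hp) _).1
  primal t _ := by
    have hs := add_pos_of_nonneg_of_pos (hη t) hp
    rw [isMinOn_add_quadratics_iff hs.ne']
    exact (h.proxPoint_spec hs _).2

/-- A run is prescribed only by minimality conditions. Uniqueness of proximal points identifies it
with the explicit recursion, from which measurability and integrability can be read off. -/
theorem IsInnerRun.eq_slidingState (h : IsProxable X φ) (hp : 0 < p) (hq : q ≠ 0)
    (hη : ∀ t, 0 ≤ η (t + 1)) {v xp : E} {x : ℕ → E} {z : ℕ → F}
    (hr : IsInnerRun A X φ η p q a T v xp x z) (t : ℕ) (ht : t ≤ T) :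
    x t = (slidingState A X φ η p q a v xp (x 0) (z 0) t).2.1
      ∧ z t = (slidingState A X φ η p q a v xp (x 0) (z 0) t).2.2 := by
  induction t using Nat.strong_induction_on with
  | _ t ih =>
    cases t with
    | zero => exact ⟨rfl, rfl⟩
    | succ t =>
      obtain ⟨h1, h2⟩ := ih t (by omega) (by omega)
      have hs := add_pos_of_nonneg_of_pos (hη t) hp
      have h3 : (slidingState A X φ η p q a v xp (x 0) (z 0) t).1 = if t = 0 then xp else x (t - 1) := by
        rw [slidingState_fst]
        split_ifs with h0
        · rfl
        · exact (ih (t - 1) (by omega) (by omega)).1.symm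
      have hz : z (t + 1) = z t + q⁻¹ • A (extrapolation a xp x t) := by
        rw [← hr.dual t ht, inv_smul_smul₀ hq, add_sub_cancel]
      have hx := h.eq_proxPoint hs (hr.mem t ht)
        ((isMinOn_add_quadratics_iff hs.ne').1 (hr.primal t ht))
      simp only [slidingState, h3, ← h1, ← h2]
      rw [hz] at hx
      exact ⟨hx, hz⟩

section Measurability

variable [MeasurableSpace E] [BorelSpace E] [SecondCountableTopology E]
  [MeasurableSpace F] [BorelSpace F] [SecondCountableTopology F]

theorem measurable_slidingState {Ω : Type*} {_ : MeasurableSpace Ω} (h : IsProxable X φ)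
    (hp : 0 < p) (hη : ∀ t, 0 ≤ η (t + 1)) {v xp x0 : Ω → E} {z0 : Ω → F} (hv : Measurable v)
    (hxp : Measurable xp) (hx0 : Measurable x0) (hz0 : Measurable z0) (t : ℕ) :
    Measurable fun ω => slidingState A X φ η p q a (v ω) (xp ω) (x0 ω) (z0 ω) t := by
  induction t with
  | zero => exact hxp.prodMk (hx0.prodMk hz0)
  | succ t ih =>
    have h1 := ih.fst
    have h2 := ih.snd.fst
    have h3 := ih.snd.snd
    have hz : Measurable fun ω => (slidingState A X φ η p q a (v ω) (xp ω) (x0 ω) (z0 ω) t).2.2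
        + q⁻¹ • A ((slidingState A X φ η p q a (v ω) (xp ω) (x0 ω) (z0 ω) t).2.1
          + (if t = 0 then a else 1) •
            ((slidingState A X φ η p q a (v ω) (xp ω) (x0 ω) (z0 ω) t).2.1
              - (slidingState A X φ η p q a (v ω) (xp ω) (x0 ω) (z0 ω) t).1)) :=
      h3.add ((A.continuous.measurable.comp (h2.add ((h2.sub h1).const_smul _))).const_smul _)
    refine h2.prodMk (Measurable.prodMk ?_ hz)
    refine (h.lipschitzWith_proxPoint
      (add_pos_of_nonneg_of_pos (hη t) hp)).continuous.measurable.comp ?_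
    exact (((h2.const_smul _).add (hx0.const_smul _)).sub
      (hv.add (A.adjoint.continuous.measurable.comp hz))).const_smul _

end Measurability

theorem memLp_slidingState {Ω : Type*} {_ : MeasurableSpace Ω} {Pr : Measure Ω}
    [IsFiniteMeasure Pr] {r : ENNReal} (h : IsProxable X φ) (hp : 0 < p) (hη : ∀ t, 0 ≤ η (t + 1))
    {v xp x0 : Ω → E} {z0 : Ω → F} (hv : MemLp v r Pr)
    (hxp : MemLp xp r Pr) (hx0 : MemLp x0 r Pr) (hz0 : MemLp z0 r Pr) (t : ℕ) :
    MemLp (fun ω => (slidingState A X φ η p q a (v ω) (xp ω) (x0 ω) (z0 ω) t).1) r Pr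
      ∧ MemLp (fun ω => (slidingState A X φ η p q a (v ω) (xp ω) (x0 ω) (z0 ω) t).2.1) r Pr
      ∧ MemLp (fun ω => (slidingState A X φ η p q a (v ω) (xp ω) (x0 ω) (z0 ω) t).2.2) r Pr := by
  induction t with
  | zero => exact ⟨hxp, hx0, hz0⟩
  | succ t ih =>
    obtain ⟨h1, h2, h3⟩ := ih
    have hz : MemLp (fun ω => (slidingState A X φ η p q a (v ω) (xp ω) (x0 ω) (z0 ω) t).2.2
        + q⁻¹ • A ((slidingState A X φ η p q a (v ω) (xp ω) (x0 ω) (z0 ω) t).2.1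
          + (if t = 0 then a else 1) •
            ((slidingState A X φ η p q a (v ω) (xp ω) (x0 ω) (z0 ω) t).2.1
              - (slidingState A X φ η p q a (v ω) (xp ω) (x0 ω) (z0 ω) t).1))) r Pr :=
      h3.add ((A.comp_memLp' (h2.add ((h2.sub h1).const_smul _))).const_smul _)
    refine ⟨h2, ?_, hz⟩
    exact (h.lipschitzWith_proxPoint
      (add_pos_of_nonneg_of_pos (hη t) hp)).memLp_comp_of_isFiniteMeasure
        ((((h2.const_smul _).add (hx0.const_smul _)).sub
          (hv.add (A.adjoint.comp_memLp' hz))).const_smul _)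

end SlidingState

/-! ### Independence: freezing one of two independent variables. -/

section Independence

variable {Ω α β κ : Type*} {mΩ : MeasurableSpace Ω} {mα : MeasurableSpace α}
  [mβ : MeasurableSpace β] {Pr : Measure Ω} {V : Ω → α} {W : Ω → β}
  {f : α → β → ℝ}

theorem ProbabilityTheory.IndepFun.lintegral_comp_eq [IsProbabilityMeasure Pr] (h : IndepFun V W Pr) (hV : Measurable V)
    (hW : Measurable W) {g : α → β → ENNReal} (hg : Measurable (Function.uncurry g)) :
    ∫⁻ ω, g (V ω) (W ω) ∂Pr = ∫⁻ ω, ∫⁻ ω', g (V ω) (W ω') ∂Pr ∂Pr := by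
  have h1 := (indepFun_iff_map_prod_eq_prod_map_map hV.aemeasurable hW.aemeasurable).1 h
  have : IsProbabilityMeasure (Pr.map V) := Measure.isProbabilityMeasure_map hV.aemeasurable
  have : IsProbabilityMeasure (Pr.map W) := Measure.isProbabilityMeasure_map hW.aemeasurable
  calc ∫⁻ ω, g (V ω) (W ω) ∂Pr
      = ∫⁻ q, Function.uncurry g q ∂(Pr.map fun ω => (V ω, W ω)) :=
        (lintegral_map hg (hV.prodMk hW)).symm
    _ = ∫⁻ v, ∫⁻ w, g v w ∂(Pr.map W) ∂(Pr.map V) := by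
        rw [h1, lintegral_prod _ hg.aemeasurable]; rfl
    _ = ∫⁻ ω, ∫⁻ w, g (V ω) w ∂(Pr.map W) ∂Pr :=
        lintegral_map (f := fun v => ∫⁻ w, g v w ∂(Pr.map W)) hg.lintegral_prod_right' hV
    _ = _ := lintegral_congr fun ω => lintegral_map (hg.comp measurable_prodMk_left) hW

/-- Tonelli's theorem for the product law. As `f ≥ 0`, joint integrability is a conclusion here; the
next statement, on vanishing integrals, has to assume it. -/
theorem ProbabilityTheory.IndepFun.integral_le_of_forall_integral_le [IsProbabilityMeasure Pr] (h : IndepFun V W Pr)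
    (hV : Measurable V) (hW : Measurable W) (hf : Measurable (Function.uncurry f))
    (hf0 : ∀ v w, 0 ≤ f v w) {B : ℝ} (hB : 0 ≤ B)
    (hint : ∀ ω, Integrable (fun ω' => f (V ω) (W ω')) Pr)
    (hle : ∀ ω, ∫ ω', f (V ω) (W ω') ∂Pr ≤ B) :
    Integrable (fun ω => f (V ω) (W ω)) Pr ∧ ∫ ω, f (V ω) (W ω) ∂Pr ≤ B := by
  have hm : Measurable fun ω => f (V ω) (W ω) := hf.comp (hV.prodMk hW)
  have h1 : ∫⁻ ω, ENNReal.ofReal (f (V ω) (W ω)) ∂Pr ≤ ENNReal.ofReal B := by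
    rw [h.lintegral_comp_eq hV hW (g := fun v w => ENNReal.ofReal (f v w)) hf.ennreal_ofReal]
    refine (lintegral_mono (g := fun _ => ENNReal.ofReal B) fun ω => ?_).trans (by simp)
    rw [← ofReal_integral_eq_lintegral_ofReal (hint ω) (Filter.Eventually.of_forall fun _ => hf0 _ _)]
    exact ENNReal.ofReal_le_ofReal (hle ω)
  have h2 : Integrable (fun ω => f (V ω) (W ω)) Pr := by
    refine ⟨hm.aestronglyMeasurable, ?_⟩
    rw [hasFiniteIntegral_iff_ofReal (Filter.Eventually.of_forall fun _ => hf0 _ _)]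
    exact h1.trans_lt ENNReal.ofReal_lt_top
  refine ⟨h2, ?_⟩
  rw [← ofReal_integral_eq_lintegral_ofReal h2 (Filter.Eventually.of_forall fun _ => hf0 _ _)] at h1
  exact (ENNReal.ofReal_le_ofReal_iff hB).1 h1

theorem ProbabilityTheory.IndepFun.integral_eq_zero_of_forall [IsProbabilityMeasure Pr] (h : IndepFun V W Pr)
    (hV : Measurable V) (hW : Measurable W) (hf : Measurable (Function.uncurry f))
    (hint : Integrable (fun ω => f (V ω) (W ω)) Pr)
    (h0 : ∀ ω, ∫ ω', f (V ω) (W ω') ∂Pr = 0) : ∫ ω, f (V ω) (W ω) ∂Pr = 0 := by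
  have h1 := (indepFun_iff_map_prod_eq_prod_map_map hV.aemeasurable hW.aemeasurable).1 h
  have : IsProbabilityMeasure (Pr.map V) := Measure.isProbabilityMeasure_map hV.aemeasurable
  have : IsProbabilityMeasure (Pr.map W) := Measure.isProbabilityMeasure_map hW.aemeasurable
  have hVW : Measurable fun ω => (V ω, W ω) := hV.prodMk hW
  have hint' : Integrable (Function.uncurry f) ((Pr.map V).prod (Pr.map W)) := by
    rw [← h1]
    exact (integrable_map_measure hf.aestronglyMeasurable hVW.aemeasurable).2 hint
  calc ∫ ω, f (V ω) (W ω) ∂Pr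
      = ∫ q, Function.uncurry f q ∂(Pr.map fun ω => (V ω, W ω)) :=
        (integral_map hVW.aemeasurable hf.aestronglyMeasurable).symm
    _ = ∫ v, ∫ w, f v w ∂(Pr.map W) ∂(Pr.map V) := by
        rw [h1, integral_prod _ hint']; rfl
    _ = ∫ ω, ∫ w, f (V ω) w ∂(Pr.map W) ∂Pr :=
        integral_map (f := fun v => ∫ w, f v w ∂(Pr.map W)) hV.aemeasurable
          (hf.stronglyMeasurable.integral_prod_right').aestronglyMeasurable
    _ = ∫ ω, ∫ ω', f (V ω) (W ω') ∂Pr ∂Pr := integral_congr_ae (Filter.Eventually.of_forall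
        fun ω => integral_map hW.aemeasurable (hf.comp measurable_prodMk_left).aestronglyMeasurable)
    _ = 0 := by simp [h0]

/-- The information carried by the variables with index in `s`. -/
abbrev history {Ω β κ : Type*} [mβ : MeasurableSpace β] (ξ : κ → Ω → β) (s : Set κ) :
    MeasurableSpace Ω := ⨆ k ∈ s, mβ.comap (ξ k)

theorem history_le {ξ : κ → Ω → β} (hξ : ∀ k, Measurable (ξ k)) (s : Set κ) :
    history ξ s ≤ mΩ := iSup₂_le fun k _ => (hξ k).comap_le

theorem history_mono (ξ : κ → Ω → β) {s t : Set κ} (hst : s ⊆ t) : history ξ s ≤ history ξ t :=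
  biSup_mono hst

theorem measurable_history (ξ : κ → Ω → β) {s : Set κ} {k : κ} (hk : k ∈ s) :
    Measurable[history ξ s] (ξ k) := by
  rw [measurable_iff_comap_le]
  exact le_iSup₂_of_le k hk le_rfl

theorem ProbabilityTheory.iIndepFun.indepFun_of_measurable_history {ξ : κ → Ω → β}
    (h : iIndepFun ξ Pr) (hξ : ∀ k, Measurable (ξ k)) {s : Set κ} {k : κ} (hk : k ∉ s)
    (hV : Measurable[history ξ s] V) : IndepFun V (ξ k) Pr := by
  have h1 : Indep (⨆ i ∈ s, mβ.comap (ξ i)) (⨆ i ∈ ({k} : Set κ), mβ.comap (ξ i)) Pr :=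
    indep_iSup_of_disjoint (fun i => (hξ i).comap_le) h (Set.disjoint_singleton_right.2 hk)
  rw [iSup_singleton] at h1
  exact indep_of_indep_of_le_left h1 hV.comap_le

theorem MeasureTheory.MemLp.integrable_inner_two {E : Type*} [NormedAddCommGroup E]
    [InnerProductSpace ℝ E] {X Y : Ω → E} (hX : MemLp X 2 Pr) (hY : MemLp Y 2 Pr) :
    Integrable (fun ω => ⟪X ω, Y ω⟫_ℝ) Pr := by
  have h1 := (memLp_two_iff_integrable_sq_norm hX.1).1 hX
  have h2 := (memLp_two_iff_integrable_sq_norm hY.1).1 hY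
  refine (h1.add h2).mono (hX.1.inner hY.1) (Filter.Eventually.of_forall fun ω => ?_)
  change _ ≤ ‖‖X ω‖ ^ 2 + ‖Y ω‖ ^ 2‖
  rw [Real.norm_of_nonneg (show 0 ≤ ‖X ω‖ ^ 2 + ‖Y ω‖ ^ 2 by positivity)]
  have h3 := norm_inner_le_norm (𝕜 := ℝ) (X ω) (Y ω)
  nlinarith [sq_nonneg (‖X ω‖ - ‖Y ω‖)]

end Independence

namespace SPDS

/-! ### The error of the oracle and of a batch. -/

section Noise

variable {m d : ℕ} {P : Problem m d} {S : Fin m → Type*} [∀ i, MeasurableSpace (S i)]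

/-- The error of the oracle at `u` for the joint sample `s`. -/
noncomputable def Oracle.noise (O : Oracle P S) (u : Stack (Fin m) d) (s : ∀ i, S i) :
    Stack (Fin m) d :=
  WithLp.toLp 2 fun i => O.G i (u i) (s i) - ∫ s', O.G i (u i) s' ∂O.law i

/-- The error is centred at this mean and not at `gradft`, which carries no measurability
assumption; on the domain the two agree. -/
theorem Oracle.measurable_mean (O : Oracle P S) (i : Fin m) :
    Measurable fun x : Vec d => ∫ s, O.G i x s ∂O.law i := by
  have := O.isProb i
  exact (StronglyMeasurable.integral_prod_right (f := O.G i)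
    (O.measurable_G i).stronglyMeasurable).measurable

theorem Oracle.measurable_noise (O : Oracle P S) :
    Measurable fun q : Stack (Fin m) d × (∀ i, S i) => O.noise q.1 q.2 := by
  refine (WithLp.measurable_toLp 2 _).comp (measurable_pi_lambda _ fun i => ?_)
  have h1 : Measurable fun q : Stack (Fin m) d × (∀ i, S i) => q.1 i :=
    (continuous_block i).measurable.comp measurable_fst
  have h2 : Measurable fun q : Stack (Fin m) d × (∀ i, S i) => q.2 i :=
    (measurable_pi_apply i).comp measurable_snd
  exact ((O.measurable_G i).comp (h1.prodMk h2)).sub ((O.measurable_mean i).comp h1)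

/-- The mean of the oracle's answers at `u`. -/
noncomputable def Oracle.mean (O : Oracle P S) (u : Stack (Fin m) d) : Stack (Fin m) d :=
  WithLp.toLp 2 fun i => ∫ s, O.G i (u i) s ∂O.law i

theorem Oracle.measurable_stack_mean (O : Oracle P S) : Measurable O.mean :=
  (WithLp.measurable_toLp 2 _).comp (measurable_pi_lambda _ fun i =>
    (O.measurable_mean i).comp (continuous_block i).measurable)

theorem Oracle.mean_eq_grad (O : Oracle P S) {u : Stack (Fin m) d} (hu : u ∈ P.domain) :
    O.mean u = P.grad u := by
  unfold Oracle.mean Problem.grad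
  congr 1
  funext i
  exact O.unbiased i _ (hu i)

variable {O : Oracle P S} {Ω : Type*} [mΩ : MeasurableSpace Ω] {Pr : Measure Ω}
  {ξ : ℕ → ℕ → Ω → (∀ i, S i)}

theorem IsSampling.integrable_comp (h : IsSampling O Pr ξ) (k j : ℕ) (i : Fin m) {E : Type*}
    [NormedAddCommGroup E] {f : S i → E} (hf : AEStronglyMeasurable f (O.law i)) :
    Integrable (fun ω => f (ξ k j ω i)) Pr ↔ Integrable f (O.law i) := by
  have hm : Measurable fun ω => ξ k j ω i := (measurable_pi_apply i).comp (h.measurable k j)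
  rw [← h.law_eq k j i] at hf ⊢
  exact (integrable_map_measure hf hm.aemeasurable).symm

theorem IsSampling.integral_comp (h : IsSampling O Pr ξ) (k j : ℕ) (i : Fin m) {E : Type*}
    [NormedAddCommGroup E] [NormedSpace ℝ E] {f : S i → E}
    (hf : AEStronglyMeasurable f (O.law i)) :
    ∫ ω, f (ξ k j ω i) ∂Pr = ∫ s, f s ∂O.law i := by
  have hm : Measurable fun ω => ξ k j ω i := (measurable_pi_apply i).comp (h.measurable k j)
  rw [← h.law_eq k j i] at hf ⊢
  exact (integral_map hm.aemeasurable hf).symm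

theorem Oracle.measurable_G_right (O : Oracle P S) (i : Fin m) (x : Vec d) :
    Measurable (O.G i x) := (O.measurable_G i).comp measurable_prodMk_left

theorem IsSampling.integral_norm_noise_sq (h : IsSampling O Pr ξ) (k j : ℕ)
    {u : Stack (Fin m) d} (hu : u ∈ P.domain) :
    Integrable (fun ω => ‖O.noise u (ξ k j ω)‖ ^ 2) Pr
      ∧ ∫ ω, ‖O.noise u (ξ k j ω)‖ ^ 2 ∂Pr ≤ O.σ ^ 2 := by
  have he : ∀ s, ‖O.noise u s‖ ^ 2 = ∑ i, ‖O.G i (u i) (s i) - P.gradft i (u i)‖ ^ 2 := by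
    intro s
    rw [stack_norm_sq]
    refine Finset.sum_congr rfl fun i _ => ?_
    rw [← O.unbiased i _ (hu i)]
    rfl
  have hm : ∀ i, AEStronglyMeasurable (fun s => ‖O.G i (u i) s - P.gradft i (u i)‖ ^ 2) (O.law i) :=
    fun i => (((O.measurable_G_right i _).sub_const _).norm.pow_const 2).aestronglyMeasurable
  have hI : ∀ i, Integrable (fun ω => ‖O.G i (u i) (ξ k j ω i) - P.gradft i (u i)‖ ^ 2) Pr := fun i =>
    (h.integrable_comp k j i (hm i)).2 (O.integrable_sq i _ (hu i))
  simp only [he]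
  refine ⟨integrable_finsetSum _ fun i _ => hI i, ?_⟩
  rw [integral_finsetSum _ fun i _ => hI i]
  refine (le_of_eq ?_).trans (O.variance_le u hu)
  exact Finset.sum_congr rfl fun i _ => h.integral_comp k j i (hm i)

variable [IsProbabilityMeasure Pr]

theorem IsSampling.integral_inner_noise (h : IsSampling O Pr ξ) (k j : ℕ) {u : Stack (Fin m) d}
    (hu : u ∈ P.domain) (y : Stack (Fin m) d) : ∫ ω, ⟪O.noise u (ξ k j ω), y⟫_ℝ ∂Pr = 0 := by
  simp only [stack_inner, Oracle.noise]
  have hG : ∀ i, Integrable (fun ω => O.G i (u i) (ξ k j ω i)) Pr := fun i =>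
    (h.integrable_comp k j i (O.measurable_G_right i _).aestronglyMeasurable).2
      (O.integrable_G i _ (hu i))
  have hI : ∀ i, Integrable (fun ω => O.G i (u i) (ξ k j ω i) - ∫ s', O.G i (u i) s' ∂O.law i) Pr :=
    fun i => (hG i).sub (integrable_const _)
  rw [integral_finsetSum _ fun i _ => (hI i).inner_const _]
  refine Finset.sum_eq_zero fun i _ => ?_
  simp only [real_inner_comm (y i)]
  rw [integral_inner (hI i), integral_sub (hG i) (integrable_const _),
    h.integral_comp k j i (O.measurable_G_right i _).aestronglyMeasurable]
  simp

/-- The joint samples, indexed by pairs. -/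
abbrev samples (ξ : ℕ → ℕ → Ω → (∀ i, S i)) (kj : ℕ × ℕ) : Ω → (∀ i, S i) := ξ kj.1 kj.2

variable {U Y : Ω → Stack (Fin m) d} {s : Set (ℕ × ℕ)}

theorem IsSampling.memLp_noise (h : IsSampling O Pr ξ) {k j : ℕ} (hk : (k, j) ∉ s)
    (hU : Measurable[history (samples ξ) s] U) (hUD : ∀ ω, U ω ∈ P.domain) :
    MemLp (fun ω => O.noise (U ω) (ξ k j ω)) 2 Pr
      ∧ ∫ ω, ‖O.noise (U ω) (ξ k j ω)‖ ^ 2 ∂Pr ≤ O.σ ^ 2 := by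
  have hle := history_le (ξ := samples ξ) (fun kj => h.measurable kj.1 kj.2) s
  have hU' : Measurable U := hU.mono hle le_rfl
  have hind : IndepFun U (ξ k j) Pr :=
    h.indep.indepFun_of_measurable_history (fun kj => h.measurable kj.1 kj.2) hk hU
  have h1 := hind.integral_le_of_forall_integral_le hU' (h.measurable k j)
    (f := fun u s => ‖O.noise u s‖ ^ 2) (O.measurable_noise.norm.pow_const 2)
    (fun _ _ => sq_nonneg _) (sq_nonneg O.σ) (fun ω => (h.integral_norm_noise_sq k j (hUD ω)).1)
    (fun ω => (h.integral_norm_noise_sq k j (hUD ω)).2)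
  have hm : Measurable fun ω => O.noise (U ω) (ξ k j ω) :=
    O.measurable_noise.comp (hU'.prodMk (h.measurable k j))
  exact ⟨(memLp_two_iff_integrable_sq_norm hm.aestronglyMeasurable).2 h1.1, h1.2⟩

theorem IsSampling.integral_inner_noise_eq_zero (h : IsSampling O Pr ξ) {k j : ℕ}
    (hk : (k, j) ∉ s) (hU : Measurable[history (samples ξ) s] U) (hUD : ∀ ω, U ω ∈ P.domain)
    (hY : Measurable[history (samples ξ) s] Y) (hY2 : MemLp Y 2 Pr) :
    ∫ ω, ⟪O.noise (U ω) (ξ k j ω), Y ω⟫_ℝ ∂Pr = 0 := by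
  have hle := history_le (ξ := samples ξ) (fun kj => h.measurable kj.1 kj.2) s
  have hUY : Measurable[history (samples ξ) s] fun ω => (U ω, Y ω) := hU.prodMk hY
  have hind : IndepFun (fun ω => (U ω, Y ω)) (ξ k j) Pr :=
    h.indep.indepFun_of_measurable_history (fun kj => h.measurable kj.1 kj.2) hk hUY
  refine hind.integral_eq_zero_of_forall (hUY.mono hle le_rfl) (h.measurable k j)
    (f := fun (q : Stack (Fin m) d × Stack (Fin m) d) s => ⟪O.noise q.1 s, q.2⟫_ℝ) ?_ ?_ fun ω => ?_
  · have h1 : Measurable fun q : (Stack (Fin m) d × Stack (Fin m) d) × (∀ i, S i) =>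
        O.noise q.1.1 q.2 :=
      O.measurable_noise.comp ((measurable_fst.comp measurable_fst).prodMk measurable_snd)
    exact h1.inner (measurable_snd.comp measurable_fst)
  · exact (h.memLp_noise hk hU hUD).1.integrable_inner_two hY2
  · exact h.integral_inner_noise k j (hUD ω) (Y ω)

/-- Second moments add: the query and the sum so far are measurable for the history enlarged by the
earlier samples of the same batch, so the next error is orthogonal to that sum. -/
theorem IsSampling.memLp_sum_noise (h : IsSampling O Pr ξ) {k : ℕ} (hk : ∀ j, (k, j) ∉ s)
    (hU : Measurable[history (samples ξ) s] U) (hUD : ∀ ω, U ω ∈ P.domain) (n : ℕ) :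
    MemLp (fun ω => ∑ j ∈ Finset.range n, O.noise (U ω) (ξ k j ω)) 2 Pr
      ∧ ∫ ω, ‖∑ j ∈ Finset.range n, O.noise (U ω) (ξ k j ω)‖ ^ 2 ∂Pr ≤ n * O.σ ^ 2 := by
  induction n with
  | zero => simp
  | succ n ih =>
    obtain ⟨h1, h2⟩ := ih
    obtain ⟨h3, h4⟩ := h.memLp_noise (hk n) hU hUD
    have hmem : MemLp (fun ω => ∑ j ∈ Finset.range (n + 1), O.noise (U ω) (ξ k j ω)) 2 Pr := by
      simp only [Finset.sum_range_succ]
      exact h1.add h3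
    refine ⟨hmem, ?_⟩
    have hs : s ⊆ s ∪ {kj | kj.1 = k ∧ kj.2 < n} := Set.subset_union_left
    have hU' := hU.mono (history_mono (samples ξ) hs) le_rfl
    have hsum : Measurable[history (samples ξ) (s ∪ {kj | kj.1 = k ∧ kj.2 < n})]
        fun ω => ∑ j ∈ Finset.range n, O.noise (U ω) (ξ k j ω) := by
      refine Finset.measurable_sum _ fun j hj => O.measurable_noise.comp (hU'.prodMk ?_)
      exact measurable_history (samples ξ) (k := (k, j)) (Or.inr ⟨rfl, Finset.mem_range.1 hj⟩)
    have h5 := h.integral_inner_noise_eq_zero (k := k) (j := n)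
      (s := s ∪ {kj | kj.1 = k ∧ kj.2 < n}) (by
        rintro (h | ⟨-, h⟩)
        · exact hk n h
        · exact lt_irrefl n h) hU' hUD hsum h1
    have h6 : ∀ ω, ‖∑ j ∈ Finset.range (n + 1), O.noise (U ω) (ξ k j ω)‖ ^ 2
        = ‖∑ j ∈ Finset.range n, O.noise (U ω) (ξ k j ω)‖ ^ 2
          + 2 * ⟪O.noise (U ω) (ξ k n ω), ∑ j ∈ Finset.range n, O.noise (U ω) (ξ k j ω)⟫_ℝ
          + ‖O.noise (U ω) (ξ k n ω)‖ ^ 2 := by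
      intro ω
      rw [Finset.sum_range_succ, norm_add_sq_real, real_inner_comm]
    have i1 := (memLp_two_iff_integrable_sq_norm h1.1).1 h1
    have i2 := (h3.integrable_inner_two h1).const_mul 2
    have i3 := (memLp_two_iff_integrable_sq_norm h3.1).1 h3
    have i12 : Integrable (fun ω => ‖∑ j ∈ Finset.range n, O.noise (U ω) (ξ k j ω)‖ ^ 2
        + 2 * ⟪O.noise (U ω) (ξ k n ω), ∑ j ∈ Finset.range n, O.noise (U ω) (ξ k j ω)⟫_ℝ) Pr :=
      i1.add i2
    simp only [h6]
    rw [integral_add i12 i3, integral_add i1 i2, integral_const_mul, h5]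
    push_cast
    linarith

theorem IsSampling.integral_inner_sum_noise_eq_zero (h : IsSampling O Pr ξ) {k : ℕ}
    (hk : ∀ j, (k, j) ∉ s) (hU : Measurable[history (samples ξ) s] U)
    (hUD : ∀ ω, U ω ∈ P.domain) (hY : Measurable[history (samples ξ) s] Y) (hY2 : MemLp Y 2 Pr)
    (n : ℕ) : ∫ ω, ⟪∑ j ∈ Finset.range n, O.noise (U ω) (ξ k j ω), Y ω⟫_ℝ ∂Pr = 0 := by
  simp only [sum_inner]
  rw [integral_finsetSum _ fun j _ => (h.memLp_noise (hk j) hU hUD).1.integrable_inner_two hY2]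
  exact Finset.sum_eq_zero fun j _ => h.integral_inner_noise_eq_zero (hk j) hU hUD hY hY2

end Noise

end SPDS

theorem norm_loopAverage_sub_le {E : Type*} [NormedAddCommGroup E] [InnerProductSpace ℝ E] {T : ℕ}
    (hT : 1 ≤ T) {x x' : ℕ → E} {B : ℝ} (h : ∀ t, 1 ≤ t → t ≤ T → ‖x t - x' t‖ ≤ B) :
    ‖loopAverage T x - loopAverage T x'‖ ≤ B := by
  have hT0 : (0 : ℝ) < T := by exact_mod_cast hT
  rw [loopAverage, loopAverage, ← smul_sub, ← Finset.sum_sub_distrib, norm_smul, norm_inv,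
    Real.norm_of_nonneg hT0.le, inv_mul_le_iff₀ hT0]
  refine (norm_sum_le_of_le _ fun t ht => h (t + 1) (by omega)
    (by have := Finset.mem_range.1 ht; omega)).trans ?_
  simp

namespace SPDS

/-! ### Closure properties of the iterates under linear operations and inner loops. -/

section Iterates

variable {m d : ℕ} {ι Ω : Type*} [Fintype ι] {P : Problem m d} {K : Matrix ι (Fin m) ℝ}
  {S : Fin m → Type*} [∀ i, MeasurableSpace (S i)] {O : Oracle P S} {ξ : ℕ → ℕ → Ω → (∀ i, S i)}
  {R c a : ℝ} {N : ℕ} {x0 : Stack (Fin m) d} {x : ℕ → ℕ → Ω → Stack (Fin m) d}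
  {z : ℕ → ℕ → Ω → Stack ι d} {u : ℕ → Ω → Stack (Fin m) d}

theorem Problem.isProxable (P : Problem m d) (hx0 : x0 ∈ P.feasible) :
    IsProxable P.feasible P.reg where
  isClosed := P.isClosed_feasible
  nonempty := ⟨x0, hx0⟩
  convexOn := P.convexOn_reg
  lsc := P.lsc_reg

/-- The state of the inner loop of iteration `k + 1` as a function of its inputs. -/
noncomputable abbrev innerState (P : Problem m d) (K : Matrix ι (Fin m) ℝ) (R a : ℝ) (k : ℕ)
    (v xp x0 : Stack (Fin m) d) (z0 : Stack ι d) (t : ℕ) :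
    Stack (Fin m) d × Stack (Fin m) d × Stack ι d :=
  slidingState (netOp K) P.feasible P.reg
    (fun t => (pK P.L P.μ (k + 1) + P.μ) * ((t : ℝ) - 1)
      + pK P.L P.μ (k + 1) * TK P.L P.μ R a (k + 1)) (pK P.L P.μ (k + 1))
    (P.L / (4 * R ^ 2) * TK P.L P.μ R a (k + 1) / betaK P.L P.μ (k + 1))
    (if k = 0 then 1 else betaK P.L P.μ k * TK P.L P.μ R a (k + 1)
      / (betaK P.L P.μ (k + 1) * TK P.L P.μ R a k)) v xp x0 z0 t

theorem eta_succ_nonneg (P : Problem m d) (R a : ℝ) (k t : ℕ) :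
    0 ≤ (pK P.L P.μ (k + 1) + P.μ) * (((t + 1 : ℕ) : ℝ) - 1)
      + pK P.L P.μ (k + 1) * TK P.L P.μ R a (k + 1) := by
  have hp := pK_pos P.L_pos P.μ_nonneg (k := k + 1) (by omega)
  have hμ := P.μ_nonneg
  push_cast
  rw [add_sub_cancel_right]
  positivity

theorem dual_step_pos (P : Problem m d) (hR : 0 < R) (ha : 0 < a) (k : ℕ) :
    0 < P.L / (4 * R ^ 2) * TK P.L P.μ R a (k + 1) / betaK P.L P.μ (k + 1) := by
  have hβ := betaK_pos P.L_pos P.μ_nonneg (k := k + 1) (by omega)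
  have hT : (0 : ℝ) < TK P.L P.μ R a (k + 1) := by
    exact_mod_cast TK_pos P.L_pos P.μ_nonneg hR ha (by omega : 1 ≤ k + 1)
  have hL := P.L_pos
  positivity

theorem IsRun.eq_innerState (hR : 0 < R) (ha : 0 < a) (hx0 : x0 ∈ P.feasible)
    (h : IsRun P K O ξ (params P.L P.μ R c a N) N x0 x z u) (ω : Ω) {k : ℕ} (hk : k < N) {t : ℕ}
    (ht : t ≤ TK P.L P.μ R a (k + 1)) :
    x (k + 1) t ω = (innerState P K R a k
        (stackedEstimator O ξ (params P.L P.μ R c a N) u (k + 1) ω) (x k (TK P.L P.μ R a k - 1) ω)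
        (x k (TK P.L P.μ R a k) ω) (z k (TK P.L P.μ R a k) ω) t).2.1
      ∧ z (k + 1) t ω = (innerState P K R a k
        (stackedEstimator O ξ (params P.L P.μ R c a N) u (k + 1) ω) (x k (TK P.L P.μ R a k - 1) ω)
        (x k (TK P.L P.μ R a k) ω) (z k (TK P.L P.μ R a k) ω) t).2.2 := by
  have h1 := (h.isInnerRun hR ha ω hk).eq_slidingState (P.isProxable hx0)
    (pK_pos P.L_pos P.μ_nonneg (by omega)) (dual_step_pos P hR ha k).ne'
    (eta_succ_nonneg P R a k) t ht
  have hx := h.x_start (k + 1) (by omega) hk ω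
  have hz := h.z_start (k + 1) (by omega) hk ω
  rw [Nat.add_sub_cancel] at hx hz
  rw [hx, hz] at h1
  exact h1

/-- A class of random vectors that is closed under linear combinations. -/
structure IsLinearClass (Q : (Ω → Stack (Fin m) d) → Prop) : Prop where
  const : ∀ w, Q fun _ => w
  add : ∀ f g, Q f → Q g → Q fun ω => f ω + g ω
  smul : ∀ (r : ℝ) f, Q f → Q fun ω => r • f ω

theorem IsLinearClass.sub {Q : (Ω → Stack (Fin m) d) → Prop} (hQ : IsLinearClass Q)
    {f g : Ω → Stack (Fin m) d} (hf : Q f) (hg : Q g) : Q fun ω => f ω - g ω := by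
  have := hQ.add _ _ hf (hQ.smul (-1) _ hg)
  simpa [sub_eq_add_neg] using this

theorem IsLinearClass.sum {Q : (Ω → Stack (Fin m) d) → Prop} (hQ : IsLinearClass Q) {κ : Type*}
    (s : Finset κ) {f : κ → Ω → Stack (Fin m) d} (hf : ∀ k ∈ s, Q (f k)) :
    Q fun ω => ∑ k ∈ s, f k ω := by
  classical
  induction s using Finset.induction_on with
  | empty => simpa using hQ.const 0
  | insert b s hb ih =>
    simp only [Finset.sum_insert hb]
    exact hQ.add _ _ (hf b (Finset.mem_insert_self b s))
      (ih fun k hk => hf k (Finset.mem_insert_of_mem hk))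

variable {QX : (Ω → Stack (Fin m) d) → Prop} {QZ : (Ω → Stack ι d) → Prop}

theorem IsLinearClass.xHat_mem (hQ : IsLinearClass QX) (par : Params) {k : ℕ}
    (hx : ∀ t ≤ par.T k, QX (x k t)) : QX (xHat par x k) := by
  rcases Nat.eq_zero_or_pos k with rfl | hk
  · have : xHat par x 0 = x 0 0 := by funext ω; simp [xHat]
    rw [this]
    exact hx 0 (Nat.zero_le _)
  · have : xHat par x k = fun ω => ((par.T k : ℝ))⁻¹ • ∑ t ∈ Finset.Icc 1 (par.T k), x k t ω := by
      funext ω; simp [xHat, hk.ne']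
    rw [this]
    exact hQ.smul _ _ (hQ.sum _ fun t ht => hx t (Finset.mem_Icc.1 ht).2)

theorem IsRun.query_mem_class (h : IsRun P K O ξ (params P.L P.μ R c a N) N x0 x z u)
    (hQ : IsLinearClass QX) {k : ℕ} (hk : k < N)
    (hx : ∀ j ≤ k, ∀ t ≤ TK P.L P.μ R a j, QX (x j t)) (hu : QX (u k)) : QX (u (k + 1)) := by
  have he : u (k + 1) = fun ω => (1 + (params P.L P.μ R c a N).tau (k + 1))⁻¹ •
      ((x k (TK P.L P.μ R a k) ω + (params P.L P.μ R c a N).lam (k + 1) •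
        (xHat (params P.L P.μ R c a N) x k ω - x (k - 1) (TK P.L P.μ R a (k - 1)) ω))
        + (params P.L P.μ R c a N).tau (k + 1) • u k ω) := by
    funext ω
    exact h.u_step (k + 1) (by omega) hk ω
  rw [he]
  exact hQ.smul _ _ (hQ.add _ _ (hQ.add _ _ (hx k le_rfl _ le_rfl) (hQ.smul _ _ (hQ.sub
    (hQ.xHat_mem (params P.L P.μ R c a N) (hx k le_rfl)) (hx (k - 1) (by omega) _ le_rfl))))
    (hQ.smul _ _ hu))

/-- One induction along the algorithm for two purposes: measurability for a given σ-algebra and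
square integrability. In `hest` the query may be assumed to have the property already, as it is
computed before the estimator. -/
theorem IsRun.iterates_mem_class (hR : 0 < R) (ha : 0 < a) (hx0 : x0 ∈ P.feasible)
    (h : IsRun P K O ξ (params P.L P.μ R c a N) N x0 x z u) (hQ : IsLinearClass QX)
    (hQZ : QZ fun _ => 0)
    (hstate : ∀ k v xp x₀ z₀, QX v → QX xp → QX x₀ → QZ z₀ → ∀ t,
      QX (fun ω => (innerState P K R a k (v ω) (xp ω) (x₀ ω) (z₀ ω) t).2.1)
        ∧ QZ (fun ω => (innerState P K R a k (v ω) (xp ω) (x₀ ω) (z₀ ω) t).2.2)) {n : ℕ}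
    (hn : n ≤ N) (hest : ∀ k < n, QX (u (k + 1)) →
      QX (stackedEstimator O ξ (params P.L P.μ R c a N) u (k + 1))) (k : ℕ) (hk : k ≤ n) :
    (∀ t ≤ TK P.L P.μ R a k, QX (x k t) ∧ QZ (z k t)) ∧ QX (u k) := by
  induction k using Nat.strong_induction_on with
  | _ k ih =>
    cases k with
    | zero =>
      have e1 : ∀ t, x 0 t = fun _ => x0 := fun t => funext fun ω => h.x_init t ω
      have e2 : ∀ t, z 0 t = fun _ => 0 := fun t => funext fun ω => h.z_init t ω
      obtain ⟨u0, -, hu0⟩ := h.u_init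
      have e3 : u 0 = fun _ => u0 := funext hu0
      refine ⟨fun t _ => ⟨?_, ?_⟩, ?_⟩
      · rw [e1]; exact hQ.const _
      · rw [e2]; exact hQZ
      · rw [e3]; exact hQ.const _
    | succ k =>
      have hkN : k < N := by omega
      have hu := h.query_mem_class hQ hkN
        (fun j hj t ht => ((ih j (by omega) (by omega)).1 t ht).1) (ih k (by omega) (by omega)).2
      refine ⟨fun t ht => ?_, hu⟩
      have hprev := (ih k (by omega) (by omega)).1
      have h1 := hstate k _ _ _ _ (hest k (by omega) hu) (hprev (TK P.L P.μ R a k - 1) (by omega)).1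
        (hprev _ le_rfl).1 (hprev _ le_rfl).2 t
      have e1 := fun ω => h.eq_innerState hR ha hx0 ω hkN ht
      rw [funext fun ω => (e1 ω).1, funext fun ω => (e1 ω).2]
      exact h1

theorem noise_add_mean (O : Oracle P S) (w : Stack (Fin m) d) (s : ∀ i, S i) :
    O.mean w + O.noise w s = WithLp.toLp 2 fun i => O.G i (w i) (s i) := by
  refine PiLp.ext fun i => ?_
  exact add_sub_cancel _ _

theorem stackedEstimator_eq (par : Params) {k : ℕ} (hc : 1 ≤ par.c k) (ω : Ω) :
    stackedEstimator O ξ par u k ω = O.mean (u k ω)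
      + ((par.c k : ℝ))⁻¹ • ∑ j ∈ Finset.range (par.c k), O.noise (u k ω) (ξ k j ω) := by
  have hc0 : (par.c k : ℝ) ≠ 0 := by positivity
  have h1 : (par.c k : ℝ) • O.mean (u k ω) + ∑ j ∈ Finset.range (par.c k), O.noise (u k ω) (ξ k j ω)
      = ∑ j ∈ Finset.range (par.c k), WithLp.toLp 2 fun i => O.G i (u k ω i) (ξ k j ω i) := by
    simp only [← noise_add_mean, Finset.sum_add_distrib, Finset.sum_const, Finset.card_range,
      Nat.cast_smul_eq_nsmul]
  have h2 : stackedEstimator O ξ par u k ω = ((par.c k : ℝ))⁻¹ •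
      ∑ j ∈ Finset.range (par.c k), WithLp.toLp 2 fun i => O.G i (u k ω i) (ξ k j ω i) := by
    refine PiLp.ext fun i => ?_
    simp [stackedEstimator, miniBatch]
  rw [h2, ← h1, smul_add, inv_smul_smul₀ hc0]

end Iterates

/-! ### Adaptedness of the iterates and the bias of the estimator. -/

section Noise

variable {m d : ℕ} {ι Ω : Type*} [Fintype ι] {P : Problem m d} {K : Matrix ι (Fin m) ℝ}
  {S : Fin m → Type*} [∀ i, MeasurableSpace (S i)] {O : Oracle P S} {ξ : ℕ → ℕ → Ω → (∀ i, S i)}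
  {R c a : ℝ} {N : ℕ} {x0 : Stack (Fin m) d} {x : ℕ → ℕ → Ω → Stack (Fin m) d}
  {z : ℕ → ℕ → Ω → Stack ι d} {u : ℕ → Ω → Stack (Fin m) d}

theorem isLinearClass_measurable (mΩ : MeasurableSpace Ω) :
    IsLinearClass fun f : Ω → Stack (Fin m) d => Measurable[mΩ] f where
  const _ := measurable_const
  add _ _ hf hg := hf.add hg
  smul r _ hf := hf.const_smul r

theorem isLinearClass_memLp {mΩ : MeasurableSpace Ω} (Pr : Measure Ω) [IsFiniteMeasure Pr] :
    IsLinearClass fun f : Ω → Stack (Fin m) d => MemLp f 2 Pr where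
  const _ := memLp_const _
  add _ _ hf hg := hf.add hg
  smul r _ hf := hf.const_smul r

theorem measurable_innerState {mΩ : MeasurableSpace Ω} (hx0 : x0 ∈ P.feasible) (k : ℕ)
    {v xp x₀ : Ω → Stack (Fin m) d} {z₀ : Ω → Stack ι d} (hv : Measurable v) (hxp : Measurable xp)
    (hx₀ : Measurable x₀) (hz₀ : Measurable z₀) (t : ℕ) :
    Measurable fun ω => innerState P K R a k (v ω) (xp ω) (x₀ ω) (z₀ ω) t :=
  measurable_slidingState (P.isProxable hx0) (pK_pos P.L_pos P.μ_nonneg (by omega))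
    (eta_succ_nonneg P R a k) hv hxp hx₀ hz₀ t

/-- The σ-algebra is arbitrary: the history gives adaptedness, the ambient one gives random
variables. -/
theorem IsRun.measurable_iterates (hR : 0 < R) (ha : 0 < a) (hc : 0 < c) (hx0 : x0 ∈ P.feasible)
    (h : IsRun P K O ξ (params P.L P.μ R c a N) N x0 x z u) {mΩ : MeasurableSpace Ω} {n : ℕ}
    (hn : n ≤ N) (hξ : ∀ k ≤ n, ∀ j, Measurable (ξ k j)) (k : ℕ) (hk : k ≤ n) :
    (∀ t ≤ TK P.L P.μ R a k, Measurable (x k t) ∧ Measurable (z k t)) ∧ Measurable (u k) := by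
  refine h.iterates_mem_class hR ha hx0 (isLinearClass_measurable mΩ)
    (QZ := fun f => Measurable f) measurable_const (fun k v xp x₀ z₀ hv hxp hx₀ hz₀ t => ?_) hn
    (fun k hk hu => ?_) k hk
  · have := measurable_innerState (K := K) (R := R) (a := a) hx0 k hv hxp hx₀ hz₀ t
    exact ⟨this.snd.fst, this.snd.snd⟩
  · have hc1 : 1 ≤ (params P.L P.μ R c a N).c (k + 1) :=
      cK_pos P.L_pos P.μ_nonneg hc (by omega) (by omega)
    rw [funext fun ω => stackedEstimator_eq (O := O) (ξ := ξ) (u := u) _ hc1 ω]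
    have hQ := isLinearClass_measurable (m := m) (d := d) mΩ
    exact hQ.add _ _ (O.measurable_stack_mean.comp hu) (hQ.smul _ _ (hQ.sum _ fun j _ =>
      O.measurable_noise.comp (hu.prodMk (hξ (k + 1) hk j))))

theorem IsRun.measurable_iterates_history (hR : 0 < R) (ha : 0 < a) (hc : 0 < c)
    (hx0 : x0 ∈ P.feasible) (h : IsRun P K O ξ (params P.L P.μ R c a N) N x0 x z u) {k : ℕ}
    (hk : k ≤ N) :
    (∀ t ≤ TK P.L P.μ R a k, Measurable[history (samples ξ) {kj | kj.1 ≤ k}] (x k t)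
      ∧ Measurable[history (samples ξ) {kj | kj.1 ≤ k}] (z k t)) :=
  (h.measurable_iterates hR ha hc hx0 (mΩ := history (samples ξ) {kj | kj.1 ≤ k}) hk
    (fun i hi j => measurable_history (samples ξ) (k := (i, j)) hi) k le_rfl).1

/-- The query of iteration `k + 1` is formed before the samples of that iteration are used, so the
history up to `k` suffices. -/
theorem IsRun.measurable_query_history (hR : 0 < R) (ha : 0 < a) (hc : 0 < c)
    (hx0 : x0 ∈ P.feasible) (h : IsRun P K O ξ (params P.L P.μ R c a N) N x0 x z u) {k : ℕ}
    (hk : k < N) : Measurable[history (samples ξ) {kj | kj.1 ≤ k}] (u (k + 1)) := by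
  have h1 := h.measurable_iterates hR ha hc hx0 (mΩ := history (samples ξ) {kj | kj.1 ≤ k}) hk.le
    (fun i hi j => measurable_history (samples ξ) (k := (i, j)) hi)
  exact h.query_mem_class (isLinearClass_measurable (history (samples ξ) {kj | kj.1 ≤ k})) hk
    (fun j hj t ht => ((h1 j hj).1 t ht).1) (h1 k le_rfl).2

/-- The error of the gradient estimator. -/
noncomputable def estimatorError (O : Oracle P S) (ξ : ℕ → ℕ → Ω → (∀ i, S i)) (par : Params)
    (u : ℕ → Ω → Stack (Fin m) d) (k : ℕ) (ω : Ω) : Stack (Fin m) d :=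
  stackedEstimator O ξ par u k ω - P.grad (u k ω)

theorem IsRun.estimatorError_eq (hR : 0 < R) (ha : 0 < a) (hc : 0 < c) (hx0 : x0 ∈ P.feasible)
    (h : IsRun P K O ξ (params P.L P.μ R c a N) N x0 x z u) {k : ℕ} (hk : k < N) :
    estimatorError O ξ (params P.L P.μ R c a N) u (k + 1) = fun ω =>
      ((cK P.L P.μ c N (k + 1) : ℝ))⁻¹ •
      ∑ j ∈ Finset.range (cK P.L P.μ c N (k + 1)), O.noise (u (k + 1) ω) (ξ (k + 1) j ω) := by
  have hc1 : 1 ≤ (params P.L P.μ R c a N).c (k + 1) :=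
    cK_pos P.L_pos P.μ_nonneg hc (by omega) (by omega)
  funext ω
  rw [estimatorError, stackedEstimator_eq _ hc1,
    O.mean_eq_grad (h.query_mem_domain hR ha hx0 ω hk), add_sub_cancel_left]
  rfl

/-- The average of the inner loop that is run with the exact gradient. -/
noncomputable def noiselessAverage (O : Oracle P S) (K : Matrix ι (Fin m) ℝ) (R a : ℝ)
    (x : ℕ → ℕ → Ω → Stack (Fin m) d) (z : ℕ → ℕ → Ω → Stack ι d)
    (u : ℕ → Ω → Stack (Fin m) d) (k : ℕ) (ω : Ω) : Stack (Fin m) d :=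
  loopAverage (TK P.L P.μ R a (k + 1)) fun t => (innerState P K R a k (O.mean (u (k + 1) ω))
    (x k (TK P.L P.μ R a k - 1) ω) (x k (TK P.L P.μ R a k) ω) (z k (TK P.L P.μ R a k) ω) t).2.1

theorem IsRun.norm_xHat_sub_noiselessAverage_le (hR : 0 < R) (ha : 0 < a)
    (hKa : ‖netOp (d := d) K‖ = a) (hx0 : x0 ∈ P.feasible)
    (h : IsRun P K O ξ (params P.L P.μ R c a N) N x0 x z u) {k : ℕ} (hk : k < N) (ω : Ω) :
    ‖xHat (params P.L P.μ R c a N) x (k + 1) ω - noiselessAverage O K R a x z u k ω‖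
      ≤ 2 / 3 * (‖estimatorError O ξ (params P.L P.μ R c a N) u (k + 1) ω‖
        / pK P.L P.μ (k + 1)) := by
  have hp := pK_pos P.L_pos P.μ_nonneg (k := k + 1) (by omega)
  have hst := stepConditions_params P.L_pos P.μ_nonneg hR ha c N
  rw [xHat_succ, estimatorError, ← O.mean_eq_grad (h.query_mem_domain hR ha hx0 ω hk)]
  exact norm_loopAverage_sub_le (TK_pos P.L_pos P.μ_nonneg hR ha (by omega))
    ((h.isInnerRun hR ha ω hk).norm_sub_le
      (isInnerRun_slidingState (P.isProxable hx0) hp (dual_step_pos P hR ha k).ne'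
        (eta_succ_nonneg P R a k) (O.mean (u (k + 1) ω)) (x k (TK P.L P.μ R a k - 1) ω)
        (x k (TK P.L P.μ R a k) ω) (z k (TK P.L P.μ R a k) ω))
      (h.x_start (k + 1) (by omega) hk ω) (h.z_start (k + 1) (by omega) hk ω)
      P.strongConvexOn_reg P.μ_nonneg hp (dual_step_pos P hR ha k)
      (fun t => by push_cast; rw [add_sub_cancel_right])
      (hst.eta_nonneg (by omega : 1 ≤ k + 1) hk)
      (fun t ht _ => by rw [hKa]; exact hst.norm_sq_le_eta_mul (by omega : 1 ≤ k + 1) hk t ht))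

theorem IsRun.measurable_noiselessAverage (hR : 0 < R) (ha : 0 < a) (hc : 0 < c)
    (hx0 : x0 ∈ P.feasible) (h : IsRun P K O ξ (params P.L P.μ R c a N) N x0 x z u) {k : ℕ}
    (hk : k < N) :
    Measurable[history (samples ξ) {kj | kj.1 ≤ k}] (noiselessAverage O K R a x z u k) := by
  have hQ := isLinearClass_measurable (m := m) (d := d) (history (samples ξ) {kj | kj.1 ≤ k})
  have huH := h.measurable_query_history hR ha hc hx0 hk
  have hxH := h.measurable_iterates_history hR ha hc hx0 hk.le
  refine hQ.smul _ _ (hQ.sum _ fun t _ => ?_)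
  exact (measurable_innerState hx0 k (O.measurable_stack_mean.comp huH)
    (hxH _ (Nat.sub_le _ _)).1 (hxH _ le_rfl).1 (hxH _ le_rfl).2 (t + 1)).snd.fst

variable [mΩ : MeasurableSpace Ω] {Pr : Measure Ω} [IsProbabilityMeasure Pr]

theorem memLp_innerState (hx0 : x0 ∈ P.feasible) (k : ℕ)
    {v xp x₀ : Ω → Stack (Fin m) d} {z₀ : Ω → Stack ι d} (hv : MemLp v 2 Pr) (hxp : MemLp xp 2 Pr)
    (hx₀ : MemLp x₀ 2 Pr) (hz₀ : MemLp z₀ 2 Pr) (t : ℕ) :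
    MemLp (fun ω => (innerState P K R a k (v ω) (xp ω) (x₀ ω) (z₀ ω) t).2.1) 2 Pr
      ∧ MemLp (fun ω => (innerState P K R a k (v ω) (xp ω) (x₀ ω) (z₀ ω) t).2.2) 2 Pr :=
  (memLp_slidingState (P.isProxable hx0) (pK_pos P.L_pos P.μ_nonneg (by omega))
    (eta_succ_nonneg P R a k) hv hxp hx₀ hz₀ t).2

/-- On the domain the mean is the Lipschitz gradient, which grows at most linearly. -/
theorem memLp_mean (hx0 : x0 ∈ P.feasible) {w : Ω → Stack (Fin m) d} (hw : MemLp w 2 Pr)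
    (hwD : ∀ ω, w ω ∈ P.domain) : MemLp (fun ω => O.mean (w ω)) 2 Pr := by
  have h0 : MemLp (fun _ : Ω => ‖P.grad x0‖) 2 Pr := memLp_const _
  have h1 : MemLp (fun ω => P.L * ‖w ω - x0‖) 2 Pr := (hw.sub (memLp_const _)).norm.const_mul _
  refine (h0.add h1).mono (O.measurable_stack_mean.comp_aemeasurable
    hw.1.aemeasurable).aestronglyMeasurable (Filter.Eventually.of_forall fun ω => ?_)
  have h2 := P.norm_grad_sub_le (hwD ω) (P.feasible_subset_domain hx0)
  have h3 := norm_le_norm_add_norm_sub' (P.grad (w ω)) (P.grad x0)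
  have hL := P.L_pos
  rw [Pi.add_apply, Real.norm_of_nonneg (by positivity), O.mean_eq_grad (hwD ω)]
  linarith

theorem IsRun.memLp_iterates (hR : 0 < R) (ha : 0 < a) (hc : 0 < c) (hx0 : x0 ∈ P.feasible)
    (hS : IsSampling O Pr ξ) (h : IsRun P K O ξ (params P.L P.μ R c a N) N x0 x z u) (k : ℕ)
    (hk : k ≤ N) :
    (∀ t ≤ TK P.L P.μ R a k, MemLp (x k t) 2 Pr ∧ MemLp (z k t) 2 Pr) ∧ MemLp (u k) 2 Pr := by
  refine h.iterates_mem_class hR ha hx0 (isLinearClass_memLp Pr)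
    (QZ := fun f => MemLp f 2 Pr) (memLp_const _)
    (fun k v xp x₀ z₀ hv hxp hx₀ hz₀ t => memLp_innerState hx0 k hv hxp hx₀ hz₀ t) le_rfl
    (fun k hk hu => ?_) k hk
  have hc1 : 1 ≤ (params P.L P.μ R c a N).c (k + 1) :=
    cK_pos P.L_pos P.μ_nonneg hc (by omega) (by omega)
  have huD := fun ω => h.query_mem_domain hR ha hx0 ω hk
  rw [funext fun ω => stackedEstimator_eq (O := O) (ξ := ξ) (u := u) _ hc1 ω]
  have hQ := isLinearClass_memLp (m := m) (d := d) Pr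
  exact hQ.add _ _ (memLp_mean hx0 hu huD) (hQ.smul _ _
    (hS.memLp_sum_noise (k := k + 1) (s := {kj | kj.1 ≤ k})
    (fun j => by simp) (h.measurable_query_history hR ha hc hx0 hk) huD _).1)

theorem not_mem_past (k j : ℕ) : (k + 1, j) ∉ {kj : ℕ × ℕ | kj.1 ≤ k} := by simp

theorem IsRun.memLp_estimatorError (hR : 0 < R) (ha : 0 < a) (hc : 0 < c) (hx0 : x0 ∈ P.feasible)
    (hS : IsSampling O Pr ξ) (h : IsRun P K O ξ (params P.L P.μ R c a N) N x0 x z u) {k : ℕ}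
    (hk : k < N) :
    MemLp (estimatorError O ξ (params P.L P.μ R c a N) u (k + 1)) 2 Pr ∧
    ∫ ω, ‖estimatorError O ξ (params P.L P.μ R c a N) u (k + 1) ω‖ ^ 2 ∂Pr
      ≤ O.σ ^ 2 / cK P.L P.μ c N (k + 1) := by
  have hc0 : (0 : ℝ) < cK P.L P.μ c N (k + 1) := by
    exact_mod_cast cK_pos P.L_pos P.μ_nonneg hc (by omega) (by omega)
  obtain ⟨hsum2, hsumle⟩ := hS.memLp_sum_noise (not_mem_past k)
    (h.measurable_query_history hR ha hc hx0 hk) (fun ω => h.query_mem_domain hR ha hx0 ω hk)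
    (cK P.L P.μ c N (k + 1))
  rw [h.estimatorError_eq hR ha hc hx0 hk]
  refine ⟨(isLinearClass_memLp Pr).smul _ _ hsum2, ?_⟩
  simp only [norm_smul, mul_pow, norm_inv, Real.norm_natCast]
  rw [integral_const_mul, le_div_iff₀ hc0]
  have h1 := mul_le_mul_of_nonneg_left hsumle
    (show 0 ≤ ((cK P.L P.μ c N (k + 1) : ℝ)⁻¹) ^ 2 * cK P.L P.μ c N (k + 1) by positivity)
  calc _ = _ := mul_right_comm _ _ _
    _ ≤ _ := h1
    _ = _ := by field_simp

theorem IsRun.memLp_noiselessAverage (hR : 0 < R) (ha : 0 < a) (hc : 0 < c)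
    (hx0 : x0 ∈ P.feasible) (hS : IsSampling O Pr ξ)
    (h : IsRun P K O ξ (params P.L P.μ R c a N) N x0 x z u) {k : ℕ} (hk : k < N) :
    MemLp (noiselessAverage O K R a x z u k) 2 Pr := by
  have hQ := isLinearClass_memLp (m := m) (d := d) Pr
  have hxk := (h.memLp_iterates hR ha hc hx0 hS k hk.le).1
  have hu2 := (h.memLp_iterates hR ha hc hx0 hS (k + 1) hk).2
  refine hQ.smul _ _ (hQ.sum _ fun t _ => ?_)
  exact (memLp_innerState hx0 k (memLp_mean hx0 hu2 fun ω => h.query_mem_domain hR ha hx0 ω hk)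
    (hxk _ (Nat.sub_le _ _)).1 (hxk _ le_rfl).1 (hxk _ le_rfl).2 (t + 1)).1

theorem IsRun.memLp_xHat (hR : 0 < R) (ha : 0 < a) (hc : 0 < c)
    (hx0 : x0 ∈ P.feasible) (hS : IsSampling O Pr ξ)
    (h : IsRun P K O ξ (params P.L P.μ R c a N) N x0 x z u) {k : ℕ} (hk : k ≤ N) :
    MemLp (xHat (params P.L P.μ R c a N) x k) 2 Pr :=
  (isLinearClass_memLp Pr).xHat_mem _ fun t ht =>
    ((h.memLp_iterates hR ha hc hx0 hS k hk).1 t ht).1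

/-- Query and noiseless average are both functions of the past, and the new errors have mean zero
given the past. -/
theorem IsRun.integral_inner_noiselessAverage (hR : 0 < R) (ha : 0 < a) (hc : 0 < c)
    (hx0 : x0 ∈ P.feasible) (hS : IsSampling O Pr ξ)
    (h : IsRun P K O ξ (params P.L P.μ R c a N) N x0 x z u) (y : Stack (Fin m) d) {k : ℕ}
    (hk : k < N) :
    ∫ ω, ⟪estimatorError O ξ (params P.L P.μ R c a N) u (k + 1) ω,
      noiselessAverage O K R a x z u k ω - y⟫_ℝ ∂Pr = 0 := by
  rw [h.estimatorError_eq hR ha hc hx0 hk]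
  simp only [real_inner_smul_left]
  rw [integral_const_mul, hS.integral_inner_sum_noise_eq_zero (not_mem_past k)
    (h.measurable_query_history hR ha hc hx0 hk) (fun ω => h.query_mem_domain hR ha hx0 ω hk)
    ((h.measurable_noiselessAverage hR ha hc hx0 hk).sub_const y)
    ((h.memLp_noiselessAverage hR ha hc hx0 hS hk).sub (memLp_const y)), mul_zero]

/-- The bias caused by the dependence of `x̂` on the noise. -/
theorem IsRun.neg_integral_inner_estimatorError_le (hR : 0 < R) (ha : 0 < a)
    (hKa : ‖netOp (d := d) K‖ = a) (hc : 0 < c) (hx0 : x0 ∈ P.feasible) (hS : IsSampling O Pr ξ)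
    (h : IsRun P K O ξ (params P.L P.μ R c a N) N x0 x z u) (y : Stack (Fin m) d) {k : ℕ}
    (hk : k < N) :
    Integrable (fun ω => ⟪estimatorError O ξ (params P.L P.μ R c a N) u (k + 1) ω,
      xHat (params P.L P.μ R c a N) x (k + 1) ω - y⟫_ℝ) Pr ∧
    -∫ ω, ⟪estimatorError O ξ (params P.L P.μ R c a N) u (k + 1) ω,
      xHat (params P.L P.μ R c a N) x (k + 1) ω - y⟫_ℝ ∂Pr
      ≤ 2 / 3 / (pK P.L P.μ (k + 1) * cK P.L P.μ c N (k + 1)) * O.σ ^ 2 := by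
  have hp := pK_pos P.L_pos P.μ_nonneg (k := k + 1) (by omega)
  obtain ⟨hδ2, hδle⟩ := h.memLp_estimatorError hR ha hc hx0 hS hk
  have hyd2 := h.memLp_noiselessAverage hR ha hc hx0 hS hk
  have hxh2 := h.memLp_xHat hR ha hc hx0 hS hk
  have hclose := h.norm_xHat_sub_noiselessAverage_le hR ha hKa hx0 hk
  have hzero := h.integral_inner_noiselessAverage hR ha hc hx0 hS y hk
  generalize xHat (params P.L P.μ R c a N) x (k + 1) = xh at *
  generalize noiselessAverage O K R a x z u k = yd at *
  generalize estimatorError O ξ (params P.L P.μ R c a N) u (k + 1) = δ at *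
  have hi1 : Integrable (fun ω => ⟪δ ω, xh ω - yd ω⟫_ℝ) Pr :=
    hδ2.integrable_inner_two (hxh2.sub hyd2)
  have hi2 : Integrable (fun ω => ⟪δ ω, yd ω - y⟫_ℝ) Pr :=
    hδ2.integrable_inner_two (hyd2.sub (memLp_const y))
  -- The first term is the reaction of the average to the noise, at most `2/3 ‖δ‖² / p`; the second
  -- has mean zero.
  have hsplit : ∀ ω, ⟪δ ω, xh ω - y⟫_ℝ = ⟪δ ω, xh ω - yd ω⟫_ℝ + ⟪δ ω, yd ω - y⟫_ℝ := by
    intro ω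
    rw [← inner_add_right, sub_add_sub_cancel]
  refine ⟨hδ2.integrable_inner_two (hxh2.sub (memLp_const y)), ?_⟩
  have hi3 := (memLp_two_iff_integrable_sq_norm hδ2.1).1 hδ2
  calc -∫ ω, ⟪δ ω, xh ω - y⟫_ℝ ∂Pr
      = ∫ ω, -⟪δ ω, xh ω - yd ω⟫_ℝ ∂Pr := by
        simp only [hsplit]
        rw [integral_add hi1 hi2, hzero, add_zero, integral_neg]
    _ ≤ ∫ ω, 2 / 3 / pK P.L P.μ (k + 1) * ‖δ ω‖ ^ 2 ∂Pr := by
        refine integral_mono hi1.neg (hi3.const_mul _) fun ω => ?_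
        have h1 := abs_real_inner_le_norm (δ ω) (xh ω - yd ω)
        have h2 := neg_abs_le ⟪δ ω, xh ω - yd ω⟫_ℝ
        have h3 := mul_le_mul_of_nonneg_left (hclose ω) (norm_nonneg (δ ω))
        change -⟪δ ω, xh ω - yd ω⟫_ℝ ≤ _
        calc _ ≤ ‖δ ω‖ * (2 / 3 * (‖δ ω‖ / pK P.L P.μ (k + 1))) := by linarith
          _ = _ := by ring
    _ ≤ 2 / 3 / pK P.L P.μ (k + 1) * (O.σ ^ 2 / cK P.L P.μ c N (k + 1)) := by
        rw [integral_const_mul]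
        exact mul_le_mul_of_nonneg_left hδle (by positivity)
    _ = _ := by field_simp

end Noise

/-- A superlevel set is the trace of an open set on `s`, and `g` stays in `s`; the values of `f`
elsewhere, possibly non-measurable, play no role. -/
theorem measurable_comp_of_lowerSemicontinuousOn {α E : Type*} {mα : MeasurableSpace α}
    [TopologicalSpace E] [MeasurableSpace E] [OpensMeasurableSpace E] {s : Set E} {f : E → ℝ}
    (hf : LowerSemicontinuousOn f s) {g : α → E} (hg : Measurable g) (hgs : ∀ ω, g ω ∈ s) :
    Measurable fun ω => f (g ω) := by
  refine measurable_of_Ioi fun r => ?_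
  obtain ⟨v, hv, hsv⟩ := lowerSemicontinuousOn_iff_preimage_Ioi.1 hf r
  have : (fun ω => f (g ω)) ⁻¹' Set.Ioi r = g ⁻¹' v := by
    ext ω
    constructor
    · intro h
      have h1 : g ω ∈ s ∩ f ⁻¹' Set.Ioi r := ⟨hgs ω, h⟩
      rw [hsv] at h1
      exact h1.2
    · intro h
      have h1 : g ω ∈ s ∩ v := ⟨hgs ω, h⟩
      rw [← hsv] at h1
      exact h1.2
  rw [this]
  exact hg hv.measurableSet

/-! ### The error bounds in expectation. -/

section ErrorBounds

variable {m d : ℕ} {ι Ω : Type*} [Fintype ι] {P : Problem m d} {K : Matrix ι (Fin m) ℝ}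
  {S : Fin m → Type*} [∀ i, MeasurableSpace (S i)] {O : Oracle P S} {ξ : ℕ → ℕ → Ω → (∀ i, S i)}
  {R c : ℝ} {N : ℕ} {x0 xs : Stack (Fin m) d} {zs : Stack ι d} {x : ℕ → ℕ → Ω → Stack (Fin m) d}
  {z : ℕ → ℕ → Ω → Stack ι d} {u : ℕ → Ω → Stack (Fin m) d}

theorem IsSaddlePoint.neg_le_gap (hs : IsSaddlePoint P K xs zs) {y : Stack (Fin m) d}
    (hy : y ∈ P.feasible) : -(‖zs‖ * ‖netOp K y‖) ≤ P.f y - P.f xs := by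
  have h1 := hs.le_add_inner hy
  have h2 := real_inner_le_norm (netOp K y) zs
  rw [mul_comm] at h2
  linarith

/-- A bound on the Lagrangian gap for all multipliers bounds the gap and the residual. -/
theorem gap_and_residual_le (hs : IsSaddlePoint P K xs zs) {y : Stack (Fin m) d}
    (hy : y ∈ P.feasible) {B C Q n : ℝ} (hB : 0 < B) (hQ : 0 ≤ Q)
    (h : ∀ w : Stack ι d, B * (P.f y - P.f xs + ⟪netOp K y, w⟫_ℝ) ≤ C + Q * ‖w‖ ^ 2 - n) :
    B * (P.f y - P.f xs) ≤ C - n ∧ B * ‖netOp K y‖ ≤ Q * (‖zs‖ + 1) ^ 2 + C - n := by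
  refine ⟨by simpa using h 0, ?_⟩
  have h0 := hs.neg_le_gap hy
  rcases eq_or_ne (netOp K y) 0 with e | e
  · have h1 := h 0
    simp only [e, norm_zero, inner_zero_right, mul_zero, neg_zero, add_zero] at h0 h1 ⊢
    have h2 := mul_nonneg hB.le h0
    have h3 : 0 ≤ Q * (‖zs‖ + 1) ^ 2 := by positivity
    linarith
  · have hn : 0 < ‖netOp K y‖ := norm_pos_iff.2 e
    -- A multiplier of norm `‖zs‖ + 1` along the residual: the saddle point costs `‖zs‖` copies of
    -- the residual, and one copy is left.
    have h1 := h (((‖zs‖ + 1) / ‖netOp K y‖) • netOp K y)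
    rw [real_inner_smul_right, real_inner_self_eq_norm_sq, norm_smul, Real.norm_of_nonneg
      (by positivity), div_mul_cancel₀ _ hn.ne'] at h1
    have h2 : (‖zs‖ + 1) / ‖netOp K y‖ * ‖netOp K y‖ ^ 2 = (‖zs‖ + 1) * ‖netOp K y‖ := by
      field_simp
    rw [h2] at h1
    have h3 : ‖netOp K y‖ ≤ P.f y - P.f xs + (‖zs‖ + 1) * ‖netOp K y‖ := by linarith
    have h4 := mul_le_mul_of_nonneg_left h3 hB.le
    linarith

variable [mΩ : MeasurableSpace Ω] {Pr : Measure Ω} [IsProbabilityMeasure Pr]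

theorem IsRun.error_bounds (hR : 0 < R) (hc : 0 < c) (hN : 1 ≤ N) (hA : 0 < ‖netOp (d := d) K‖)
    (hs : IsSaddlePoint P K xs zs) (hx0 : x0 ∈ P.feasible) (hS : IsSampling O Pr ξ)
    (h : IsRun P K O ξ (params P.L P.μ R c ‖netOp (d := d) K‖ N) N x0 x z u) :
    Integrable (fun ω =>
        P.f (xBar (params P.L P.μ R c ‖netOp (d := d) K‖ N) x N ω) - P.f xs) Pr ∧
      ∫ ω, (P.f (xBar (params P.L P.μ R c ‖netOp (d := d) K‖ N) x N ω) - P.f xs) ∂Pr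
        ≤ rate P.L P.μ N * (4 * P.L * ‖x0 - xs‖ ^ 2 + P.L * O.σ ^ 2 / c) ∧
      Integrable (fun ω =>
        ‖netOp K (xBar (params P.L P.μ R c ‖netOp (d := d) K‖ N) x N ω)‖) Pr ∧
      ∫ ω, ‖netOp K (xBar (params P.L P.μ R c ‖netOp (d := d) K‖ N) x N ω)‖ ∂Pr
        ≤ rate P.L P.μ N * (P.L / (8 * R ^ 2) * (‖zs‖ + 1) ^ 2 + 4 * P.L * ‖x0 - xs‖ ^ 2
            + P.L * O.σ ^ 2 / c) := by
  have hL := P.L_pos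
  have hB := sum_betaK_pos (N := N) hL P.μ_nonneg hN
  have hBr := one_le_sum_betaK_mul_rate (N := N) hL P.μ_nonneg hN
  have hnoise := noise_weight_le hL P.μ_nonneg hc hN
  have hmem := fun ω => (h.xBar_mem hR hA hN ω P.convexOn_reg).1
  have hpath := fun ω => gap_and_residual_le hs (hmem ω) hB (by positivity)
    (h.gap_le hR hN hx0 hA hs.mem hs.netOp_eq_zero ω)
  have hbar : xBar (params P.L P.μ R c ‖netOp (d := d) K‖ N) x N = fun ω =>
      (∑ k ∈ Finset.Icc 1 N, betaK P.L P.μ k)⁻¹ • ∑ k ∈ Finset.Icc 1 N,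
        betaK P.L P.μ k • xHat (params P.L P.μ R c ‖netOp (d := d) K‖ N) x k ω := rfl
  have hbarM : Measurable (xBar (params P.L P.μ R c ‖netOp (d := d) K‖ N) x N) := by
    have hQ := isLinearClass_measurable (m := m) (d := d) mΩ
    rw [hbar]
    refine hQ.smul _ _ (hQ.sum _ fun k hk => hQ.smul _ _ (hQ.xHat_mem _ fun t ht => ?_))
    exact ((h.measurable_iterates hR hA hc hx0 le_rfl (fun k _ j => hS.measurable k j) k
      (Finset.mem_Icc.1 hk).2).1 t ht).1
  have hbar2 : MemLp (xBar (params P.L P.μ R c ‖netOp (d := d) K‖ N) x N) 2 Pr := by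
    have hQ := isLinearClass_memLp (m := m) (d := d) Pr
    rw [hbar]
    exact hQ.smul _ _ (hQ.sum _ fun k hk => hQ.smul _ _
      (h.memLp_xHat hR hA hc hx0 hS (Finset.mem_Icc.1 hk).2))
  have hfM : Measurable fun ω =>
      P.f (xBar (params P.L P.μ R c ‖netOp (d := d) K‖ N) x N ω) - P.f xs :=
    (measurable_comp_of_lowerSemicontinuousOn P.lsc_f hbarM hmem).sub_const _
  have hinner := fun k (hk : k ∈ Finset.range N) =>
    h.neg_integral_inner_estimatorError_le hR hA rfl hc hx0 hS xs (Finset.mem_range.1 hk)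
  have hlow := fun ω => hs.neg_le_gap (hmem ω)
  have hresI : Integrable (fun ω =>
      ‖netOp K (xBar (params P.L P.μ R c ‖netOp (d := d) K‖ N) x N ω)‖) Pr :=
    (((netOp K).comp_memLp' hbar2).integrable (by norm_num)).norm
  set noise : Ω → ℝ := fun ω => ∑ k ∈ Finset.range N, betaK P.L P.μ (k + 1)
    * ⟪estimatorError O ξ (params P.L P.μ R c ‖netOp (d := d) K‖ N) u (k + 1) ω,
      xHat (params P.L P.μ R c ‖netOp (d := d) K‖ N) x (k + 1) ω - xs⟫_ℝ with hnoisedef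
  have hnI : Integrable noise Pr :=
    integrable_finsetSum _ fun k hk => (hinner k hk).1.const_mul _
  have hnle : -∫ ω, noise ω ∂Pr
      ≤ (∑ k ∈ Finset.range N, betaK P.L P.μ (k + 1)) * rate P.L P.μ N * (P.L * O.σ ^ 2 / c) := by
    rw [hnoisedef, integral_finsetSum _ fun k hk => (hinner k hk).1.const_mul _,
      ← Finset.sum_neg_distrib]
    calc _ ≤ ∑ k ∈ Finset.range N, betaK P.L P.μ (k + 1)
          * (2 / 3 / (pK P.L P.μ (k + 1) * cK P.L P.μ c N (k + 1))) * O.σ ^ 2 := by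
          refine Finset.sum_le_sum fun k hk => ?_
          rw [integral_const_mul, ← mul_neg, mul_assoc]
          exact mul_le_mul_of_nonneg_left (hinner k hk).2
            (betaK_pos hL P.μ_nonneg (by omega)).le
      _ ≤ _ := by
          rw [← Finset.sum_mul]
          refine (mul_le_mul_of_nonneg_right hnoise (sq_nonneg O.σ)).trans (le_of_eq ?_)
          ring
  have hpath' : ∀ ω, (∑ k ∈ Finset.range N, betaK P.L P.μ (k + 1))
        * (P.f (xBar (params P.L P.μ R c ‖netOp (d := d) K‖ N) x N ω) - P.f xs)
          ≤ 4 * P.L * ‖x0 - xs‖ ^ 2 - noise ω ∧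
      (∑ k ∈ Finset.range N, betaK P.L P.μ (k + 1))
        * ‖netOp K (xBar (params P.L P.μ R c ‖netOp (d := d) K‖ N) x N ω)‖
          ≤ P.L / (8 * R ^ 2) * (‖zs‖ + 1) ^ 2 + 4 * P.L * ‖x0 - xs‖ ^ 2 - noise ω := hpath
  clear_value noise
  generalize xBar (params P.L P.μ R c ‖netOp (d := d) K‖ N) x N = xb at *
  generalize ∑ k ∈ Finset.range N, betaK P.L P.μ (k + 1) = B at *
  -- No growth condition on `f` is available; the gap is dominated from below through the saddle
  -- point and from above by the pathwise estimate.
  have hgapI : Integrable (fun ω => P.f (xb ω) - P.f xs) Pr := by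
    have hbd : Integrable (fun ω => (‖zs‖ * ‖netOp K (xb ω)‖)
        + B⁻¹ * (4 * P.L * ‖x0 - xs‖ ^ 2 + |noise ω|)) Pr :=
      (hresI.const_mul _).add (((integrable_const _).add hnI.abs).const_mul _)
    refine hbd.mono' hfM.aestronglyMeasurable (Filter.Eventually.of_forall fun ω => ?_)
    have h1 := hlow ω
    have h2 := (hpath' ω).1
    have h3 : P.f (xb ω) - P.f xs ≤ B⁻¹ * (4 * P.L * ‖x0 - xs‖ ^ 2 + |noise ω|) := by
      rw [← div_eq_inv_mul, le_div_iff₀ hB, mul_comm]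
      linarith [neg_abs_le (noise ω)]
    have h4 : 0 ≤ B⁻¹ * (4 * P.L * ‖x0 - xs‖ ^ 2 + |noise ω|) := by positivity
    have h5 : 0 ≤ ‖zs‖ * ‖netOp K (xb ω)‖ := by positivity
    rw [Real.norm_eq_abs, abs_le]
    constructor <;> linarith
  have hfinal : ∀ {g : Ω → ℝ} {C : ℝ}, 0 ≤ C → Integrable g Pr → (∀ ω, B * g ω ≤ C - noise ω) →
      ∫ ω, g ω ∂Pr ≤ rate P.L P.μ N * (C + P.L * O.σ ^ 2 / c) := by
    intro g C hC hg hle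
    have h1 := integral_mono (hg.const_mul B) ((integrable_const C).sub hnI) hle
    rw [integral_const_mul] at h1
    have h2 : ∫ ω, (C - noise ω) ∂Pr = C - ∫ ω, noise ω ∂Pr := by
      rw [integral_sub (integrable_const C) hnI]; simp
    have h3 : B * ∫ ω, g ω ∂Pr ≤ C - ∫ ω, noise ω ∂Pr := h1.trans_eq h2
    refine le_of_mul_le_mul_left ?_ hB
    -- Total weight times rate is at least `1`, so the deterministic constant also carries the rate.
    have h4 := mul_le_mul_of_nonneg_right hBr hC
    linarith
  refine ⟨hgapI, hfinal (by positivity) hgapI fun ω => (hpath' ω).1, hresI, ?_⟩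
  exact hfinal (by positivity) hresI fun ω => (hpath' ω).2

end ErrorBounds

/-! ### Numbers of samples, communication rounds and iterations. -/

section Complexity

variable {L μ R c a : ℝ} {N : ℕ}

theorem sum_le_card_add_sum {s : Finset ℕ} {f : ℕ → ℕ} {g : ℕ → ℝ} (h : ∀ k ∈ s, (f k : ℝ) ≤ g k + 1) :
    ∑ k ∈ s, (f k : ℝ) ≤ s.card + ∑ k ∈ s, g k := by
  refine (Finset.sum_le_sum h).trans (le_of_eq ?_)
  rw [Finset.sum_add_distrib, Finset.sum_const, nsmul_eq_mul, mul_one, add_comm]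

theorem cK_le_of_before (hL : 0 < L) (hc : 0 < c) {k : ℕ} (hk : 1 ≤ k) (h : BeforeDelta L μ k) :
    (cK L μ c N k : ℝ) ≤ minNDelta L μ N * (k : ℝ) ^ 2 * (c / (4 * L ^ 2)) + 1 := by
  have hk0 : (0 : ℝ) < k := by exact_mod_cast hk
  have he : (minNDelta L μ N : ℝ) * betaK L μ k * c / (pK L μ k * L)
      = minNDelta L μ N * (k : ℝ) ^ 2 * (c / (4 * L ^ 2)) := by
    rw [betaK_of_before h, pK_of_before h]; field_simp
  rw [cK, if_pos h, he]
  exact (Nat.ceil_lt_add_one (by positivity)).le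

theorem sum_cK_le_of_before (hL : 0 < L) (hc : 0 < c) {M : ℕ} (h : BeforeDelta L μ M) :
    ∑ k ∈ Finset.range M, (cK L μ c N (k + 1) : ℝ)
      ≤ M + minNDelta L μ N * (M : ℝ) ^ 3 * (c / (4 * L ^ 2)) := by
  refine (sum_le_card_add_sum fun k hk => cK_le_of_before hL hc (by omega)
    (h.mono (Finset.mem_range.1 hk))).trans ?_
  rw [Finset.card_range]
  gcongr
  calc _ ≤ ∑ k ∈ Finset.range M, minNDelta L μ N * (M : ℝ) ^ 2 * (c / (4 * L ^ 2)) := by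
        refine Finset.sum_le_sum fun k hk => ?_
        have : ((k + 1 : ℕ) : ℝ) ≤ M := by exact_mod_cast Finset.mem_range.1 hk
        gcongr
    _ = _ := by rw [Finset.sum_const, Finset.card_range, nsmul_eq_mul]; ring

theorem sum_TK_le_of_before (hL : 0 < L) (hR : 0 < R) (ha : 0 < a) {M : ℕ}
    (h : BeforeDelta L μ M) :
    ∑ k ∈ Finset.range M, (TK L μ R a (k + 1) : ℝ) ≤ M + (M : ℝ) * (M + 1) / 2 * (R * a / L) := by
  refine (sum_le_card_add_sum (g := fun k => ((k : ℝ) + 1) * (R * a / L)) fun k hk => ?_).trans ?_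
  · rw [TK, if_pos (h.mono (Finset.mem_range.1 hk))]
    refine (Nat.ceil_lt_add_one (by positivity)).le.trans (le_of_eq ?_)
    push_cast
    ring
  · rw [Finset.card_range, ← Finset.sum_mul, sum_range_succ_cast]

theorem rpow_half_lamC_sq (hL : 0 < L) (hμ : 0 < μ) : (lamC L μ ^ (1 / 2 : ℝ)) ^ 2 = lamC L μ := by
  rw [← Real.rpow_natCast, ← Real.rpow_mul (lamC_pos hL hμ).le]; norm_num

/-- Up to rounding the batch sizes form a geometric sequence. Its largest term, the last one, is of
order `λ^(-n)`, and the sum costs a further factor `2 (1 + τ)`. -/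
theorem sum_cK_DeltaC_add_le (hL : 0 < L) (hμ : 0 < μ) (hc : 0 < c) (n : ℕ) :
    ∑ i ∈ Finset.range n, (cK L μ c (DeltaC L μ + n) (DeltaC L μ + i + 1) : ℝ)
      ≤ n + c * (2 * (1 + tauC L μ) ^ 3 * DeltaC L μ / L ^ 2 * (lamC L μ)⁻¹ ^ n) := by
  have hτ := tauC_pos hL hμ
  have hlam := lamC_pos hL hμ
  set t := lamC L μ ^ (1 / 2 : ℝ) with ht
  refine (sum_le_card_add_sum (g := fun i => (1 + tauC L μ) ^ 2 * DeltaC L μ * c / L ^ 2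
    * (lamC L μ)⁻¹ ^ n * t ^ (n - 1 - i)) fun i hi => ?_).trans ?_
  · have hi := Finset.mem_range.1 hi
    have he : lamC L μ ^ ((((DeltaC L μ + i + 1 : ℕ) : ℝ) + (DeltaC L μ + n : ℕ)
        - 2 * DeltaC L μ) / 2) = ((lamC L μ)⁻¹ ^ n * t ^ (n - 1 - i))⁻¹ := by
      rw [ht, ← Real.rpow_natCast, ← Real.rpow_natCast, ← Real.rpow_mul hlam.le,
        Real.inv_rpow hlam.le, ← Real.rpow_neg hlam.le, ← Real.rpow_add hlam,
        ← Real.rpow_neg hlam.le]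
      congr 1
      rw [Nat.cast_sub (by omega), Nat.cast_sub (by omega)]
      push_cast
      ring
    rw [add_assoc] at he
    rw [add_assoc, cK, if_neg (by rw [beforeDelta_iff hμ]; omega), he]
    refine (Nat.ceil_lt_add_one (by positivity)).le.trans (le_of_eq ?_)
    field_simp
  · rw [Finset.card_range, ← Finset.mul_sum]
    have h1 := mul_le_mul_of_nonneg_left (sum_rpow_half_lamC_pow_le hL hμ n)
      (show 0 ≤ (1 + tauC L μ) ^ 2 * DeltaC L μ * c / L ^ 2 * (lamC L μ)⁻¹ ^ n by positivity)
    rw [← ht] at h1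
    refine (add_le_add_right h1 _).trans (le_of_eq ?_)
    ring

theorem sum_TK_DeltaC_add_le (hL : 0 < L) (hμ : 0 < μ) (hR : 0 < R) (ha : 0 < a) (n : ℕ) :
    ∑ i ∈ Finset.range n, (TK L μ R a (DeltaC L μ + i + 1) : ℝ)
      ≤ n + 4 * (1 + tauC L μ) ^ 2 * (R * a / L) * Real.sqrt ((lamC L μ)⁻¹ ^ n) := by
  have hτ := tauC_pos hL hμ
  have hlam := lamC_pos hL hμ
  set t := lamC L μ ^ (1 / 2 : ℝ) with ht
  have ht0 : 0 < t := by positivity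
  have hts : Real.sqrt ((lamC L μ)⁻¹ ^ n) = t⁻¹ ^ n := by
    rw [Real.sqrt_eq_iff_mul_self_eq (by positivity) (by positivity), ← mul_pow, ← mul_inv, ← pow_two,
      rpow_half_lamC_sq hL hμ]
  rw [hts]
  refine (sum_le_card_add_sum (g := fun i => 2 * (1 + tauC L μ) * (R * a / L)
    * t⁻¹ ^ n * t ^ (n - 1 - i)) fun i hi => ?_).trans ?_
  · have hi := Finset.mem_range.1 hi
    have he : lamC L μ ^ ((((DeltaC L μ + i + 1 : ℕ) : ℝ) - DeltaC L μ) / 2)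
        = (t⁻¹ ^ n * t ^ (n - 1 - i))⁻¹ := by
      have h1 : t ^ n = t ^ (n - 1 - i) * t ^ (i + 1) := by rw [← pow_add]; congr 1; omega
      have h2 : lamC L μ ^ ((((DeltaC L μ + i + 1 : ℕ) : ℝ) - DeltaC L μ) / 2) = t ^ (i + 1) := by
        rw [ht, ← Real.rpow_natCast (lamC L μ ^ (1 / 2 : ℝ)), ← Real.rpow_mul hlam.le]
        congr 1
        push_cast
        ring
      rw [h2, inv_pow, h1]
      field_simp
    rw [add_assoc] at he
    rw [add_assoc, TK, if_neg (by rw [beforeDelta_iff hμ]; omega), he]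
    refine (Nat.ceil_lt_add_one (by positivity)).le.trans (le_of_eq ?_)
    field_simp
  · rw [Finset.card_range, ← Finset.mul_sum]
    have h1 := mul_le_mul_of_nonneg_left (sum_rpow_half_lamC_pow_le hL hμ n)
      (show 0 ≤ 2 * (1 + tauC L μ) * (R * a / L) * t⁻¹ ^ n by positivity)
    rw [← ht] at h1
    refine (add_le_add_right h1 _).trans (le_of_eq ?_)
    ring

theorem cast_sampleCount (L μ R c a : ℝ) (N M : ℕ) : (sampleCount (params L μ R c a M) N : ℝ)
    = ∑ k ∈ Finset.range N, (cK L μ c M (k + 1) : ℝ) := by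
  rw [sampleCount, sum_Icc_one]
  exact Nat.cast_sum _ _

theorem cast_roundCount (L μ R c a : ℝ) (N M : ℕ) : (roundCount (params L μ R c a M) N : ℝ)
    = 2 * ∑ k ∈ Finset.range N, (TK L μ R a (k + 1) : ℝ) := by
  rw [roundCount, sum_Icc_one]
  push_cast
  rfl

theorem sampleCount_le_of_before (hL : 0 < L) (hc : 0 < c) (h : BeforeDelta L μ N) :
    (sampleCount (params L μ R c a N) N : ℝ) ≤ N + (N : ℝ) ^ 4 * (c / (4 * L ^ 2)) := by
  rw [cast_sampleCount]
  refine (sum_cK_le_of_before hL hc h).trans (le_of_eq ?_)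
  rw [minNDelta_of_before h]
  ring

theorem roundCount_le_of_before (hL : 0 < L) (hR : 0 < R) (ha : 0 < a) (h : BeforeDelta L μ N) :
    (roundCount (params L μ R c a N) N : ℝ) ≤ 2 * N + (N : ℝ) * (N + 1) * (R * a / L) := by
  rw [cast_roundCount]
  linarith [sum_TK_le_of_before hL hR ha h]

theorem sampleCount_le (hL : 0 < L) (hμ : 0 < μ) (hc : 0 < c) {Y : ℝ} (hY : 0 ≤ Y)
    (hN : ∀ n, N = DeltaC L μ + n → (lamC L μ)⁻¹ ^ n ≤ Y) :
    (sampleCount (params L μ R c a N) N : ℝ) ≤ N + c * ((DeltaC L μ : ℝ) ^ 4 / (4 * L ^ 2)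
      + 2 * (1 + tauC L μ) ^ 3 * DeltaC L μ / L ^ 2 * Y) := by
  have hτ := tauC_pos hL hμ
  by_cases h : BeforeDelta L μ N
  · refine (sampleCount_le_of_before hL hc h).trans ?_
    have h1 : (N : ℝ) ≤ DeltaC L μ := by exact_mod_cast (beforeDelta_iff hμ N).1 h
    have h2 : (N : ℝ) ^ 4 * (c / (4 * L ^ 2)) ≤ (DeltaC L μ : ℝ) ^ 4 * (c / (4 * L ^ 2)) := by gcongr
    have h3 : 0 ≤ c * (2 * (1 + tauC L μ) ^ 3 * DeltaC L μ / L ^ 2 * Y) := by positivity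
    calc _ ≤ N + ((DeltaC L μ : ℝ) ^ 4 * (c / (4 * L ^ 2))
          + c * (2 * (1 + tauC L μ) ^ 3 * DeltaC L μ / L ^ 2 * Y)) := by linarith
      _ = _ := by ring
  · obtain ⟨-, i, hi⟩ := (not_before_iff hμ.le).1 h
    generalize i + 1 = n at hi
    have hYn := hN n hi
    subst hi
    rw [cast_sampleCount, Finset.sum_range_add]
    have h1 := sum_cK_le_of_before (N := DeltaC L μ + n) hL hc ((beforeDelta_iff hμ _).2 le_rfl)
    rw [minNDelta_DeltaC_add hμ] at h1
    refine (add_le_add h1 (sum_cK_DeltaC_add_le hL hμ hc n)).trans ?_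
    have h2 : c * (2 * (1 + tauC L μ) ^ 3 * DeltaC L μ / L ^ 2 * (lamC L μ)⁻¹ ^ n)
        ≤ c * (2 * (1 + tauC L μ) ^ 3 * DeltaC L μ / L ^ 2 * Y) := by gcongr
    push_cast
    refine (add_le_add_right (add_le_add_right h2 _) _).trans (le_of_eq ?_)
    ring

theorem roundCount_le (hL : 0 < L) (hμ : 0 < μ) (hR : 0 < R) (ha : 0 < a) {Y : ℝ}
    (hN : ∀ n, N = DeltaC L μ + n → (lamC L μ)⁻¹ ^ n ≤ Y) :
    (roundCount (params L μ R c a N) N : ℝ) ≤ 2 * N + R * a / L * (2 * (DeltaC L μ : ℝ) ^ 2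
      + 8 * (1 + tauC L μ) ^ 2 * Real.sqrt Y) := by
  have hτ := tauC_pos hL hμ
  have hD : (1 : ℝ) ≤ DeltaC L μ := by linarith [le_DeltaC L μ]
  have hΔ : ∀ M : ℕ, (M : ℝ) ≤ DeltaC L μ → (M : ℝ) * (M + 1) ≤ 2 * (DeltaC L μ : ℝ) ^ 2 := by
    intro M hM
    have hM0 : (0 : ℝ) ≤ M := by positivity
    nlinarith
  have hs := Real.sqrt_nonneg Y
  by_cases h : BeforeDelta L μ N
  · refine (roundCount_le_of_before hL hR ha h).trans ?_
    have h1 : (N : ℝ) ≤ DeltaC L μ := by exact_mod_cast (beforeDelta_iff hμ N).1 h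
    rw [mul_comm ((N : ℝ) * (N + 1))]
    gcongr
    have h3 : 0 ≤ 8 * (1 + tauC L μ) ^ 2 * Real.sqrt Y := by positivity
    linarith [hΔ N h1]
  · obtain ⟨-, i, hi⟩ := (not_before_iff hμ.le).1 h
    generalize i + 1 = n at hi
    have hYn := hN n hi
    subst hi
    rw [cast_roundCount, Finset.sum_range_add]
    have h1 := sum_TK_le_of_before (R := R) (a := a) hL hR ha
      ((beforeDelta_iff hμ (DeltaC L μ)).2 le_rfl)
    have h2 := sum_TK_DeltaC_add_le hL hμ hR ha n
    have h3 : 4 * (1 + tauC L μ) ^ 2 * (R * a / L) * Real.sqrt ((lamC L μ)⁻¹ ^ n)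
        ≤ 4 * (1 + tauC L μ) ^ 2 * (R * a / L) * Real.sqrt Y := by gcongr
    have h4 := mul_le_mul_of_nonneg_right (hΔ _ le_rfl) (show 0 ≤ R * a / L by positivity)
    push_cast
    calc _ ≤ 2 * ((DeltaC L μ : ℝ) + (DeltaC L μ : ℝ) * (DeltaC L μ + 1) / 2 * (R * a / L)
          + (n + 4 * (1 + tauC L μ) ^ 2 * (R * a / L) * Real.sqrt Y)) := by linarith
      _ ≤ _ := by linarith

/-! ### The number of iterations in the strongly convex case -/

variable {g : ℝ}

theorem one_lt_inv_lamC (hL : 0 < L) (hμ : 0 < μ) : 1 < (lamC L μ)⁻¹ :=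
  (one_lt_inv₀ (lamC_pos hL hμ)).2 (lamC_lt_one hL hμ)

/-- Rounding up costs at most one factor `λ⁻¹`. As `Δ > 0`, the hypothesis excludes a negative
number inside the ceiling. -/
theorem inv_lamC_pow_le (hL : 0 < L) (hμ : 0 < μ) (hg : 0 < g) {n : ℕ}
    (hn : ⌈(DeltaC L μ : ℝ) + Real.logb (lamC L μ)⁻¹ g⌉₊ = DeltaC L μ + n) :
    (lamC L μ)⁻¹ ^ n ≤ (lamC L μ)⁻¹ * g := by
  have h1 := one_lt_inv_lamC hL hμ
  have h0 : 0 < (lamC L μ)⁻¹ := by linarith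
  have hΔ : (0 : ℝ) < DeltaC L μ := by linarith [le_DeltaC L μ, tauC_pos hL hμ]
  have h2 : 0 ≤ (DeltaC L μ : ℝ) + Real.logb (lamC L μ)⁻¹ g := by
    by_contra! h
    rw [Nat.ceil_eq_zero.2 h.le] at hn
    have : (0 : ℝ) < (DeltaC L μ + n : ℕ) := by push_cast; positivity
    rw [← hn] at this
    simp at this
  have h3 := Nat.ceil_lt_add_one h2
  rw [hn] at h3
  push_cast at h3
  have h4 : (n : ℝ) ≤ 1 + Real.logb (lamC L μ)⁻¹ g := by linarith
  calc (lamC L μ)⁻¹ ^ n = (lamC L μ)⁻¹ ^ (n : ℝ) := (Real.rpow_natCast _ _).symm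
    _ ≤ (lamC L μ)⁻¹ ^ (1 + Real.logb (lamC L μ)⁻¹ g) := Real.rpow_le_rpow_of_exponent_le h1.le h4
    _ = _ := by rw [Real.rpow_add h0, Real.rpow_one, Real.rpow_logb h0 h1.ne' hg]

theorem lamC_rpow_le (hL : 0 < L) (hμ : 0 < μ) (hg : 0 < g)
    (hN : (DeltaC L μ : ℝ) + Real.logb (lamC L μ)⁻¹ g ≤ N) :
    lamC L μ ^ ((N : ℝ) - DeltaC L μ) ≤ g⁻¹ := by
  have h1 := one_lt_inv_lamC hL hμ
  have h0 : 0 < (lamC L μ)⁻¹ := by linarith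
  have h2 : g ≤ (lamC L μ)⁻¹ ^ ((N : ℝ) - DeltaC L μ) := by
    calc g = (lamC L μ)⁻¹ ^ (Real.logb (lamC L μ)⁻¹ g) := (Real.rpow_logb h0 h1.ne' hg).symm
      _ ≤ _ := Real.rpow_le_rpow_of_exponent_le h1.le (by linarith)
  rw [Real.inv_rpow (lamC_pos hL hμ).le] at h2
  exact (le_inv_comm₀ (Real.rpow_pos_of_pos (lamC_pos hL hμ) _) hg).2 h2

/-- From `log λ⁻¹ ≥ 1 - λ = 1 / (1 + τ)`. -/
theorem logb_inv_lamC_le (hL : 0 < L) (hμ : 0 < μ) (hg : 1 ≤ g) :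
    Real.logb (lamC L μ)⁻¹ g ≤ (1 + tauC L μ) * Real.log g := by
  have hτ := tauC_pos hL hμ
  have h1 := one_lt_inv_lamC hL hμ
  have hlog : 0 < Real.log (lamC L μ)⁻¹ := Real.log_pos h1
  have h2 := Real.one_sub_inv_le_log_of_pos (show 0 < (lamC L μ)⁻¹ by linarith)
  have h3 : 1 - ((lamC L μ)⁻¹)⁻¹ = 1 / (1 + tauC L μ) := by
    rw [inv_inv, lamC]; field_simp; ring
  rw [h3, div_le_iff₀ (by positivity)] at h2
  rw [Real.logb, div_le_iff₀ hlog]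
  have h4 := mul_le_mul_of_nonneg_right h2 (Real.log_nonneg hg)
  linarith

theorem ceil_iterations_le (hL : 0 < L) (hμ : 0 < μ) (hg : 1 ≤ g) :
    (⌈(DeltaC L μ : ℝ) + Real.logb (lamC L μ)⁻¹ g⌉₊ : ℝ)
      ≤ 3 + 4 * Real.sqrt (L / μ) + (1 + 2 * Real.sqrt (L / μ)) * Real.log g := by
  have h1 := logb_inv_lamC_le hL hμ hg
  have h2 : 0 ≤ Real.logb (lamC L μ)⁻¹ g := Real.logb_nonneg (one_lt_inv_lamC hL hμ) hg
  have h3 := Nat.ceil_lt_add_one (show 0 ≤ (DeltaC L μ : ℝ) + Real.logb (lamC L μ)⁻¹ g by positivity)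
  have h4 := DeltaC_lt hL hμ
  rw [tauC] at h1 h4
  linarith

/-- The summand `κ⁻¹` is needed because `log h` occurs on the left also without the factor `κ`. -/
theorem iterations_le_mul {κ h : ℝ} (hκ : 0 < κ) (hh : 1 ≤ h) :
    3 + 4 * κ + (1 + 2 * κ) * Real.log (5 * h) ≤ (9 + 12 * κ + κ⁻¹) * (1 + κ * Real.log h) := by
  have h1 : Real.log 5 ≤ 4 := by
    have := Real.log_le_sub_one_of_pos (show (0 : ℝ) < 5 by norm_num)
    linarith
  have h2 := Real.log_nonneg hh
  rw [Real.log_mul (by norm_num) (by positivity)]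
  have h3 : (9 + 12 * κ + κ⁻¹) * (1 + κ * Real.log h) = 9 + 12 * κ + κ⁻¹ + 9 * κ * Real.log h
      + 12 * κ ^ 2 * Real.log h + Real.log h := by field_simp; ring
  have h4 : 0 < κ⁻¹ := by positivity
  have h5 : 0 ≤ κ * Real.log h := by positivity
  have h6 : 0 ≤ 12 * κ ^ 2 * Real.log h := by positivity
  rw [h3]
  nlinarith

end Complexity

/-! ### The explicit constants and the choice of `R` and `c`. -/

section Constants

variable {L μ D Z σ a ε g : ℝ} {N : ℕ}

/-- The bracket of `sampleCount_le` for `c = 2 σ² / D²` and `Y = λ⁻¹ 5 L D² / ε`, freed of `σ` and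
`ε` by `A + B / ε ≤ (A + B) (1 + 1 / ε)`. The constant for the rounds arises likewise, with `√Y`. -/
noncomputable def sampleConst (L μ D : ℝ) : ℝ :=
  2 / D ^ 2 * ((DeltaC L μ : ℝ) ^ 4 / (4 * L ^ 2)
    + 2 * (1 + tauC L μ) ^ 3 * DeltaC L μ / L ^ 2 * ((lamC L μ)⁻¹ * (5 * L * D ^ 2)))

noncomputable def roundConst (L μ D Z : ℝ) : ℝ :=
  (Z + 1) / (2 * D) / L * (2 * (DeltaC L μ : ℝ) ^ 2
    + 8 * (1 + tauC L μ) ^ 2 * Real.sqrt ((lamC L μ)⁻¹ * (5 * L * D ^ 2)))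

noncomputable def iterationConst (L μ : ℝ) : ℝ :=
  9 + 12 * Real.sqrt (L / μ) + (Real.sqrt (L / μ))⁻¹

/-- Twice the iteration constant, since the number of rounds contains `2 N`. -/
noncomputable def complexityConst (L μ D Z : ℝ) : ℝ :=
  sampleConst L μ D + roundConst L μ D Z + 2 * iterationConst L μ

theorem sampleConst_nonneg (hL : 0 < L) (hμ : 0 < μ) : 0 ≤ sampleConst L μ D := by
  have := tauC_pos hL hμ
  have := lamC_pos hL hμ
  unfold sampleConst
  positivity

theorem roundConst_nonneg (hL : 0 < L) (hμ : 0 < μ) (hD : 0 < D) (hZ : 0 ≤ Z) :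
    0 ≤ roundConst L μ D Z := by
  have := tauC_pos hL hμ
  unfold roundConst
  positivity

theorem iterationConst_nonneg (L μ : ℝ) : 0 ≤ iterationConst L μ := by
  unfold iterationConst
  positivity

theorem sampleCount_le_sampleConst (hL : 0 < L) (hμ : 0 < μ) (hD : 0 < D) (hσ : 0 < σ)
    (hε : 0 < ε) (R : ℝ)
    (hN : N = ⌈(DeltaC L μ : ℝ) + Real.logb (lamC L μ)⁻¹ (5 * L * D ^ 2 / ε)⌉₊) :
    (sampleCount (params L μ R (2 * σ ^ 2 / D ^ 2) a N) N : ℝ)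
      ≤ N + sampleConst L μ D * (σ ^ 2 * (1 + 1 / ε)) := by
  have hτ := tauC_pos hL hμ
  have hlam := lamC_pos hL hμ
  refine (sampleCount_le hL hμ (by positivity) (Y := (lamC L μ)⁻¹ * (5 * L * D ^ 2 / ε))
    (by positivity) fun n hn => inv_lamC_pow_le hL hμ (by positivity) (hN ▸ hn)).trans (add_le_add_right ?_ _)
  have h1 : 0 ≤ (DeltaC L μ : ℝ) ^ 4 / (4 * L ^ 2) := by positivity
  have h2 : 0 ≤ 2 * (1 + tauC L μ) ^ 3 * DeltaC L μ / L ^ 2 * ((lamC L μ)⁻¹ * (5 * L * D ^ 2)) := by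
    positivity
  have h3 : 2 * (1 + tauC L μ) ^ 3 * DeltaC L μ / L ^ 2 * ((lamC L μ)⁻¹ * (5 * L * D ^ 2 / ε))
      = 2 * (1 + tauC L μ) ^ 3 * DeltaC L μ / L ^ 2 * ((lamC L μ)⁻¹ * (5 * L * D ^ 2)) * (1 / ε) := by
    ring
  rw [h3]
  unfold sampleConst
  generalize (DeltaC L μ : ℝ) ^ 4 / (4 * L ^ 2) = A at *
  generalize 2 * (1 + tauC L μ) ^ 3 * DeltaC L μ / L ^ 2 * ((lamC L μ)⁻¹ * (5 * L * D ^ 2)) = B at *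
  have hε' : 0 < 1 / ε := by positivity
  have h4 : 0 ≤ 2 * σ ^ 2 / D ^ 2 * (A * (1 / ε) + B) := by positivity
  calc _ ≤ 2 * σ ^ 2 / D ^ 2 * (A + B * (1 / ε)) + 2 * σ ^ 2 / D ^ 2 * (A * (1 / ε) + B) := by
        linarith
    _ = _ := by ring

theorem roundCount_le_roundConst (hL : 0 < L) (hμ : 0 < μ) (hD : 0 < D) (hZ : 0 ≤ Z) (ha : 0 < a)
    (hε : 0 < ε) (c : ℝ)
    (hN : N = ⌈(DeltaC L μ : ℝ) + Real.logb (lamC L μ)⁻¹ (5 * L * D ^ 2 / ε)⌉₊) :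
    (roundCount (params L μ ((Z + 1) / (2 * D)) c a N) N : ℝ)
      ≤ 2 * N + roundConst L μ D Z * (a * (1 + 1 / Real.sqrt ε)) := by
  have hτ := tauC_pos hL hμ
  have hlam := lamC_pos hL hμ
  refine (roundCount_le hL hμ (by positivity) ha (Y := (lamC L μ)⁻¹ * (5 * L * D ^ 2 / ε))
    fun n hn => inv_lamC_pow_le hL hμ (by positivity) (hN ▸ hn)).trans (add_le_add_right ?_ _)
  have h3 : Real.sqrt ((lamC L μ)⁻¹ * (5 * L * D ^ 2 / ε))
      = Real.sqrt ((lamC L μ)⁻¹ * (5 * L * D ^ 2)) * (1 / Real.sqrt ε) := by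
    rw [← mul_div_assoc, Real.sqrt_div (by positivity)]; ring
  rw [h3]
  unfold roundConst
  have hε' : 0 < 1 / Real.sqrt ε := by positivity
  generalize 1 / Real.sqrt ε = e at *
  have h4 : 0 ≤ (Z + 1) / (2 * D) * a / L * (2 * (DeltaC L μ : ℝ) ^ 2 * e
      + 8 * (1 + tauC L μ) ^ 2 * Real.sqrt ((lamC L μ)⁻¹ * (5 * L * D ^ 2))) := by positivity
  generalize Real.sqrt ((lamC L μ)⁻¹ * (5 * L * D ^ 2)) = B at *
  calc _ ≤ (Z + 1) / (2 * D) * a / L * (2 * (DeltaC L μ : ℝ) ^ 2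
          + 8 * (1 + tauC L μ) ^ 2 * (B * e)) + (Z + 1) / (2 * D) * a / L
          * (2 * (DeltaC L μ : ℝ) ^ 2 * e + 8 * (1 + tauC L μ) ^ 2 * B) := by linarith
    _ = _ := by ring

theorem strongly_convex_complexity (hL : 0 < L) (hμ : 0 < μ) (hD : 0 < D) (hZ : 0 ≤ Z)
    (hσ : 0 < σ) (ha : 0 < a) (hε : 0 < ε)
    (hN : N = ⌈(DeltaC L μ : ℝ) + Real.logb (lamC L μ)⁻¹ (5 * L * D ^ 2 / ε)⌉₊) :
    (sampleCount (params L μ ((Z + 1) / (2 * D)) (2 * σ ^ 2 / D ^ 2) a N) N : ℝ)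
      ≤ N + complexityConst L μ D Z * (σ ^ 2 * (1 + 1 / ε)) ∧
    (roundCount (params L μ ((Z + 1) / (2 * D)) (2 * σ ^ 2 / D ^ 2) a N) N : ℝ)
      ≤ 2 * N + complexityConst L μ D Z * (a * (1 + 1 / Real.sqrt ε)) ∧
    (ε ≤ L * D ^ 2 →
      (N : ℝ) ≤ 3 + 4 * Real.sqrt (L / μ)
        + (1 + 2 * Real.sqrt (L / μ)) * Real.log (5 * L * D ^ 2 / ε) ∧
      (sampleCount (params L μ ((Z + 1) / (2 * D)) (2 * σ ^ 2 / D ^ 2) a N) N : ℝ)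
        ≤ complexityConst L μ D Z * (1 + Real.sqrt (L / μ) * Real.log (L * D ^ 2 / ε)
          + σ ^ 2 * (1 + 1 / ε)) ∧
      (roundCount (params L μ ((Z + 1) / (2 * D)) (2 * σ ^ 2 / D ^ 2) a N) N : ℝ)
        ≤ complexityConst L μ D Z * (1 + Real.sqrt (L / μ) * Real.log (L * D ^ 2 / ε)
          + a * (1 + 1 / Real.sqrt ε))) := by
  have h1 := sampleConst_nonneg (D := D) hL hμ
  have h2 := roundConst_nonneg hL hμ hD hZ
  have h3 := iterationConst_nonneg L μ
  have hs0 : 0 ≤ σ ^ 2 * (1 + 1 / ε) := by positivity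
  have hr0 : 0 ≤ a * (1 + 1 / Real.sqrt ε) := by positivity
  have hS : (sampleCount (params L μ ((Z + 1) / (2 * D)) (2 * σ ^ 2 / D ^ 2) a N) N : ℝ)
      ≤ N + complexityConst L μ D Z * (σ ^ 2 * (1 + 1 / ε)) := by
    refine (sampleCount_le_sampleConst hL hμ hD hσ hε _ hN).trans ?_
    gcongr
    unfold complexityConst
    linarith
  have hRd : (roundCount (params L μ ((Z + 1) / (2 * D)) (2 * σ ^ 2 / D ^ 2) a N) N : ℝ)
      ≤ 2 * N + complexityConst L μ D Z * (a * (1 + 1 / Real.sqrt ε)) := by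
    refine (roundCount_le_roundConst hL hμ hD hZ ha hε _ hN).trans ?_
    gcongr
    unfold complexityConst
    linarith
  refine ⟨hS, hRd, fun hεle => ?_⟩
  have hh : 1 ≤ L * D ^ 2 / ε := by rwa [le_div_iff₀ hε, one_mul]
  have hg : 5 * L * D ^ 2 / ε = 5 * (L * D ^ 2 / ε) := by ring
  have hNle := ceil_iterations_le hL hμ (g := 5 * L * D ^ 2 / ε) (by rw [hg]; linarith)
  rw [← hN] at hNle
  have hκ : 0 < Real.sqrt (L / μ) := Real.sqrt_pos.2 (by positivity)
  have hNle' := iterations_le_mul hκ hh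
  rw [← hg] at hNle'
  have hlog : 0 ≤ Real.sqrt (L / μ) * Real.log (L * D ^ 2 / ε) :=
    mul_nonneg hκ.le (Real.log_nonneg hh)
  have h4 : 2 * (N : ℝ) ≤ complexityConst L μ D Z
      * (1 + Real.sqrt (L / μ) * Real.log (L * D ^ 2 / ε)) := by
    have h5 : (N : ℝ) ≤ iterationConst L μ * (1 + Real.sqrt (L / μ) * Real.log (L * D ^ 2 / ε)) :=
      hNle.trans hNle'
    have h6 : 2 * iterationConst L μ ≤ complexityConst L μ D Z := by
      unfold complexityConst; linarith
    calc 2 * (N : ℝ) ≤ 2 * iterationConst L μ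
          * (1 + Real.sqrt (L / μ) * Real.log (L * D ^ 2 / ε)) := by linarith
      _ ≤ _ := mul_le_mul_of_nonneg_right h6 (by linarith)
  have hN0 : (0 : ℝ) ≤ N := by positivity
  refine ⟨hNle, ?_, ?_⟩
  · rw [mul_add (complexityConst L μ D Z)]
    linarith
  · rw [mul_add (complexityConst L μ D Z)]
    linarith

/-- With `s² = 10 L D² / ε ≥ 1` one has `N ≤ s + 1 ≤ 2 s`, so `N⁴ ≤ 16 s⁴` and `N (N + 1) ≤ 6 s²`;
the constants are `800 = 16 · 100 · 2 / 4` and `30 = 6 · 10 / 2`. -/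
theorem convex_complexity (hL : 0 < L) (hD : 0 < D) (hZ : 0 ≤ Z) (hσ : 0 < σ) (ha : 0 < a)
    (hε : 0 < ε) (hεle : ε ≤ 10 * L * D ^ 2)
    (hN : N = ⌈Real.sqrt (10 * L * D ^ 2 / ε)⌉₊) :
    (sampleCount (params L 0 ((Z + 1) / (2 * D)) (2 * σ ^ 2 / D ^ 2) a N) N : ℝ)
      ≤ N + 800 * σ ^ 2 * D ^ 2 / ε ^ 2 ∧
    (roundCount (params L 0 ((Z + 1) / (2 * D)) (2 * σ ^ 2 / D ^ 2) a N) N : ℝ)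
      ≤ 2 * N + 30 * D * (Z + 1) * a / ε := by
  have hq : 0 ≤ 10 * L * D ^ 2 / ε := by positivity
  have hs2 := Real.sq_sqrt hq
  set s := Real.sqrt (10 * L * D ^ 2 / ε) with hs
  have hs1 : 1 ≤ s := by
    rw [hs, Real.one_le_sqrt, le_div_iff₀ hε]; linarith
  have hNs : (N : ℝ) ≤ s + 1 := by rw [hN]; exact (Nat.ceil_lt_add_one (by linarith)).le
  have hN0 : (0 : ℝ) ≤ N := by positivity
  constructor
  · refine (sampleCount_le_of_before hL (by positivity) (Or.inl rfl)).trans ?_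
    have h1 : (N : ℝ) ^ 4 ≤ (2 * s) ^ 4 := by gcongr; linarith
    have h2 : (2 * s) ^ 4 = 16 * (10 * L * D ^ 2 / ε) ^ 2 := by rw [← hs2]; ring
    have h3 := mul_le_mul_of_nonneg_right (h1.trans_eq h2)
      (show 0 ≤ 2 * σ ^ 2 / D ^ 2 / (4 * L ^ 2) by positivity)
    refine (add_le_add_right h3 _).trans (le_of_eq ?_)
    field_simp
    ring
  · refine (roundCount_le_of_before hL (by positivity) ha (Or.inl rfl)).trans ?_
    have h1 : (N : ℝ) * (N + 1) ≤ 6 * (10 * L * D ^ 2 / ε) := by rw [← hs2]; nlinarith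
    have h3 := mul_le_mul_of_nonneg_right h1
      (show 0 ≤ (Z + 1) / (2 * D) * a / L by positivity)
    refine (add_le_add_right h3 _).trans (le_of_eq ?_)
    field_simp
    ring

end Constants

section Solution

variable {m d : ℕ} {ι Ω : Type*} [Fintype ι] {P : Problem m d} {K : Matrix ι (Fin m) ℝ}
  {S : Fin m → Type*} [∀ i, MeasurableSpace (S i)] {O : Oracle P S} {ξ : ℕ → ℕ → Ω → (∀ i, S i)}
  {N : ℕ} {x0 xs : Stack (Fin m) d} {zs : Stack ι d} {x : ℕ → ℕ → Ω → Stack (Fin m) d}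
  {z : ℕ → ℕ → Ω → Stack ι d} {u : ℕ → Ω → Stack (Fin m) d}
  [mΩ : MeasurableSpace Ω] {Pr : Measure Ω} [IsProbabilityMeasure Pr]

/-- For these `R` and `c` the dual term and the noise term both equal `L ‖x0 - xs‖² / 2`, so with
the initial term `4 L ‖x0 - xs‖²` the larger bracket is `5 L ‖x0 - xs‖²`. -/
theorem IsRun.isStochasticSolution (hA : 0 < ‖netOp (d := d) K‖)
    (hs : IsSaddlePoint P K xs zs) (hS : IsSampling O Pr ξ) (hx0 : x0 ∈ P.feasible)
    (hσ : 0 < O.σ) (hne : x0 ≠ xs) {ε : ℝ} (hN : 1 ≤ N)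
    (hrate : rate P.L P.μ N * (5 * P.L * ‖x0 - xs‖ ^ 2) ≤ ε)
    (h : IsRun P K O ξ (params P.L P.μ ((‖zs‖ + 1) / (2 * ‖x0 - xs‖))
      (2 * O.σ ^ 2 / ‖x0 - xs‖ ^ 2) ‖netOp (d := d) K‖ N) N x0 x z u) :
    IsStochasticSolution P K Pr xs ε (xBar (params P.L P.μ ((‖zs‖ + 1) / (2 * ‖x0 - xs‖))
      (2 * O.σ ^ 2 / ‖x0 - xs‖ ^ 2) ‖netOp (d := d) K‖ N) x N) := by
  have hD : 0 < ‖x0 - xs‖ := norm_pos_iff.2 (sub_ne_zero.2 hne)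
  have hL := P.L_pos
  obtain ⟨h1, h2, h3, h4⟩ := h.error_bounds (by positivity) (by positivity) hN hA hs hx0 hS
  have hr : 0 ≤ rate P.L P.μ N := by
    have := one_le_sum_betaK_mul_rate (N := N) hL P.μ_nonneg hN
    exact (pos_of_mul_pos_right (zero_lt_one.trans_le this)
      (sum_betaK_pos hL P.μ_nonneg hN).le).le
  have e1 : P.L * O.σ ^ 2 / (2 * O.σ ^ 2 / ‖x0 - xs‖ ^ 2) = P.L * ‖x0 - xs‖ ^ 2 / 2 := by
    field_simp
  have e2 : P.L / (8 * ((‖zs‖ + 1) / (2 * ‖x0 - xs‖)) ^ 2) * (‖zs‖ + 1) ^ 2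
      = P.L * ‖x0 - xs‖ ^ 2 / 2 := by
    have : ‖zs‖ + 1 ≠ 0 := by positivity
    field_simp
    norm_num
  rw [e1] at h2 h4
  rw [e2] at h4
  have hLD : 0 ≤ P.L * ‖x0 - xs‖ ^ 2 := by positivity
  refine ⟨h1, h2.trans (le_trans ?_ hrate), h3, h4.trans (le_trans ?_ hrate)⟩ <;>
  · gcongr
    linarith

theorem rate_mul_le_of_convex {L g ε : ℝ} (hε : 0 < ε)
    (hN : 1 ≤ N) (hNg : Real.sqrt (2 * g / ε) ≤ N) : rate L 0 N * g ≤ ε := by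
  have hN0 : (0 : ℝ) < N := by exact_mod_cast hN
  have h1 := Real.sqrt_le_left hN0.le |>.1 hNg
  rw [div_le_iff₀ hε] at h1
  rw [rate, if_pos rfl, div_mul_eq_mul_div, div_le_iff₀ (by positivity)]
  linarith

theorem rate_mul_le_of_stronglyConvex {L μ g ε : ℝ} (hL : 0 < L) (hμ : 0 < μ) (hg : 0 < g)
    (hε : 0 < ε) (hNg : (DeltaC L μ : ℝ) + Real.logb (lamC L μ)⁻¹ (g / ε) ≤ N) :
    rate L μ N * g ≤ ε := by
  have h1 := lamC_rpow_le hL hμ (by positivity) hNg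
  rw [rate, if_neg hμ.ne']
  calc _ ≤ (g / ε)⁻¹ * g := by
        gcongr
        exact (min_le_right _ _).trans h1
    _ = ε := by field_simp

end Solution

end SPDS

theorem theorem3p2 :
    -- the constant of the strongly convex case, a function of `L`, `μ`, `‖x₀ - x*‖` and `‖z*‖` only
    ∃ C : ℝ → ℝ → ℝ → ℝ → ℝ,
    ∀ (m d : ℕ) (_ : 2 ≤ m) (_ : 1 ≤ d)
      (P : SPDS.Problem m d)
      (ι : Type*) (_ : Fintype ι) (K : Matrix ι (Fin m) ℝ)
      (_ : SPDS.IsNetworkMatrix P.graph K)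
      (xs : SPDS.Stack (Fin m) d) (zs : SPDS.Stack ι d)
      (_ : SPDS.IsSaddlePoint P K xs zs)
      (S : Fin m → Type*) (_ : ∀ i, MeasurableSpace (S i)) (O : SPDS.Oracle P S)
      (Ω : Type*) (_ : MeasurableSpace Ω) (Pr : MeasureTheory.Measure Ω)
      (_ : MeasureTheory.IsProbabilityMeasure Pr)
      (ξ : ℕ → ℕ → Ω → (∀ i, S i)) (_ : SPDS.IsSampling O Pr ξ)
      (x0 : SPDS.Stack (Fin m) d) (_ : x0 ∈ P.feasible),
    -- the error bounds
    (∀ (R c : ℝ) (_ : 0 < R) (_ : 0 < c) (N : ℕ) (_ : 1 ≤ N)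
        (par : SPDS.Params)
        (_ : par = SPDS.params P.L P.μ R c ‖SPDS.netOp (d := d) K‖ N)
        (x : ℕ → ℕ → Ω → SPDS.Stack (Fin m) d) (z : ℕ → ℕ → Ω → SPDS.Stack ι d)
        (u : ℕ → Ω → SPDS.Stack (Fin m) d)
        (_ : SPDS.IsRun P K O ξ par N x0 x z u),
      MeasureTheory.Integrable (fun ω => P.f (SPDS.xBar par x N ω) - P.f xs) Pr ∧
      ∫ ω, (P.f (SPDS.xBar par x N ω) - P.f xs) ∂Pr
        ≤ SPDS.rate P.L P.μ N * (4 * P.L * ‖x0 - xs‖ ^ 2 + P.L * O.σ ^ 2 / c) ∧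
      MeasureTheory.Integrable (fun ω => ‖SPDS.netOp K (SPDS.xBar par x N ω)‖) Pr ∧
      ∫ ω, ‖SPDS.netOp K (SPDS.xBar par x N ω)‖ ∂Pr
        ≤ SPDS.rate P.L P.μ N *
          (P.L / (8 * R ^ 2) * (‖zs‖ + 1) ^ 2 + 4 * P.L * ‖x0 - xs‖ ^ 2
            + P.L * O.σ ^ 2 / c)) ∧
    -- the complexities, for the special choice of `R` and `c`
    (0 < O.σ → x0 ≠ xs →
      ∀ (R c : ℝ) (_ : R = (‖zs‖ + 1) / (2 * ‖x0 - xs‖))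
        (_ : c = 2 * O.σ ^ 2 / ‖x0 - xs‖ ^ 2) (ε : ℝ) (_ : 0 < ε)
        (N : ℕ) (par : SPDS.Params)
        (_ : par = SPDS.params P.L P.μ R c ‖SPDS.netOp (d := d) K‖ N),
      -- the convex case
      (P.μ = 0 → N = ⌈Real.sqrt (10 * P.L * ‖x0 - xs‖ ^ 2 / ε)⌉₊ →
        (∀ (x : ℕ → ℕ → Ω → SPDS.Stack (Fin m) d) (z : ℕ → ℕ → Ω → SPDS.Stack ι d)
            (u : ℕ → Ω → SPDS.Stack (Fin m) d),
          SPDS.IsRun P K O ξ par N x0 x z u →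
            SPDS.IsStochasticSolution P K Pr xs ε (SPDS.xBar par x N)) ∧
        (ε ≤ 10 * P.L * ‖x0 - xs‖ ^ 2 →
          (SPDS.sampleCount par N : ℝ) ≤ N + 800 * O.σ ^ 2 * ‖x0 - xs‖ ^ 2 / ε ^ 2 ∧
          (SPDS.roundCount par N : ℝ)
            ≤ 2 * N + 30 * ‖x0 - xs‖ * (‖zs‖ + 1) * ‖SPDS.netOp (d := d) K‖ / ε)) ∧
      -- the strongly convex case
      (0 < P.μ →
        N = ⌈(SPDS.DeltaC P.L P.μ : ℝ)
              + Real.logb (SPDS.lamC P.L P.μ)⁻¹ (5 * P.L * ‖x0 - xs‖ ^ 2 / ε)⌉₊ →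
        (1 ≤ N →
          ∀ (x : ℕ → ℕ → Ω → SPDS.Stack (Fin m) d) (z : ℕ → ℕ → Ω → SPDS.Stack ι d)
            (u : ℕ → Ω → SPDS.Stack (Fin m) d),
          SPDS.IsRun P K O ξ par N x0 x z u →
            SPDS.IsStochasticSolution P K Pr xs ε (SPDS.xBar par x N)) ∧
        (SPDS.sampleCount par N : ℝ)
          ≤ N + C P.L P.μ ‖x0 - xs‖ ‖zs‖ * (O.σ ^ 2 * (1 + 1 / ε)) ∧
        (SPDS.roundCount par N : ℝ)
          ≤ 2 * N + C P.L P.μ ‖x0 - xs‖ ‖zs‖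
            * (‖SPDS.netOp (d := d) K‖ * (1 + 1 / Real.sqrt ε)) ∧
        (ε ≤ P.L * ‖x0 - xs‖ ^ 2 →
          (N : ℝ) ≤ 3 + 4 * Real.sqrt (P.L / P.μ)
            + (1 + 2 * Real.sqrt (P.L / P.μ)) * Real.log (5 * P.L * ‖x0 - xs‖ ^ 2 / ε) ∧
          (SPDS.sampleCount par N : ℝ)
            ≤ C P.L P.μ ‖x0 - xs‖ ‖zs‖
              * (1 + Real.sqrt (P.L / P.μ) * Real.log (P.L * ‖x0 - xs‖ ^ 2 / ε)
                + O.σ ^ 2 * (1 + 1 / ε)) ∧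
          (SPDS.roundCount par N : ℝ)
            ≤ C P.L P.μ ‖x0 - xs‖ ‖zs‖
              * (1 + Real.sqrt (P.L / P.μ) * Real.log (P.L * ‖x0 - xs‖ ^ 2 / ε)
                + ‖SPDS.netOp (d := d) K‖ * (1 + 1 / Real.sqrt ε))))) := by
  refine ⟨SPDS.complexityConst, ?_⟩
  intro m d hm hd P ι _ K hK xs zs hs S _ O Ω _ Pr _ ξ hS x0 hx0
  have hA := SPDS.norm_netOp_pos hm hd P.connected hK
  refine ⟨?_, ?_⟩
  · rintro R c hR hc N hN par rfl x z u h
    exact h.error_bounds hR hc hN hA hs hx0 hS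
  · rintro hσ hne R c rfl rfl ε hε N par rfl
    have hD : 0 < ‖x0 - xs‖ := norm_pos_iff.2 (sub_ne_zero.2 hne)
    have hL := P.L_pos
    have hg : 0 < 5 * P.L * ‖x0 - xs‖ ^ 2 := by positivity
    refine ⟨fun hμ hN => ⟨fun x z u h => ?_, fun hεle => ?_⟩, fun hμ hN => ⟨fun hN1 x z u h => ?_, ?_⟩⟩
    · have hN1 : 1 ≤ N := by
        rw [hN, Nat.one_le_ceil_iff, Real.sqrt_pos]
        positivity
      refine h.isStochasticSolution hA hs hS hx0 hσ hne hN1 ?_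
      rw [hμ]
      refine SPDS.rate_mul_le_of_convex hε hN1 ?_
      rw [hN]
      refine le_trans (le_of_eq ?_) (Nat.le_ceil _)
      congr 2
      ring
    · rw [hμ]
      exact SPDS.convex_complexity hL hD (norm_nonneg zs) hσ hA hε hεle hN
    · exact h.isStochasticSolution hA hs hS hx0 hσ hne hN1
        (SPDS.rate_mul_le_of_stronglyConvex hL hμ hg hε (hN ▸ Nat.le_ceil _))
    · exact SPDS.strongly_convex_complexity hL hμ hD (norm_nonneg zs) hσ hA hε hN
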